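/- Let $\mathcal G$ be a locally compact, not necessarily Hausdorff, étale groupoid: a groupoid with a locally compact topology such that the groupoid operations are continuous, the unit space $\mathcal G^{(0)}$ is locally compact Hausdorff in the relative topology, and the range and source maps $r,s\colon\mathcal G\to\mathcal G^{(0)}$ are local homeomorphisms. For an open set $U\subset\mathcal G$ let $C_c(U)$ be the linear span, in the space of all functions $\mathcal G\to\mathbb C$, of the functions that are continuous with compact support on some open Hausdorff subset $V\subset U$ and zero off $V$. Then $C_c(\mathcal G)$ is a $*$-algebra under $$(f_1*f_2)(g)=\sum_{r(h)=r(g)}f_1(h)f_2(h^{-1}g),\qquad f^*(g)=\overline{f(g^{-1})},$$ and $C^*(\mathcal G)$ denotes its C$^*$-enveloping algebra. Extension by zero of functions in $C_c(\mathcal G^{(0)})$ induces the embedding $C_0(\mathcal G^{(0)})\subset C^*(\mathcal G)$. Let $X\subset\mathcal G^{(0)}$ be a closed invariant subset (that is, $r(g)\in X$ if and only if $s(g)\in X$, for all $g\in\mathcal G$), and let $\mathcal G_X=r^{-1}(X)=s^{-1}(X)$. Identify $C_0(\mathcal G^{(0)}\setminus X)$ with the set of functions in $C_0(\mathcal G^{(0)})$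 vanishing on $X$. Then the following three subsets of $C^*(\mathcal G)$ coincide: 1. the kernel of the $*$-homomorphism $C^*(\mathcal G)\to C^*(\mathcal G_X)$ extending the restriction $C_c(\mathcal G)\ni f\mapsto f|_{\mathcal G_X}\in C_c(\mathcal G_X)$; 2. the closure of (the image of) $C_c(\mathcal G\setminus\mathcal G_X)$ in $C^*(\mathcal G)$; 3. the closed two-sided ideal of $C^*(\mathcal G)$ generated by $C_0(\mathcal G^{(0)}\setminus X)$. Moreover, the sequence $$0\to C^*(\mathcal G\setminus\mathcal G_X)\to C^*(\mathcal G)\to C^*(\mathcal G_X)\to0$$ is exact, where the first map extends the inclusion $C_c(\mathcal G\setminus\mathcal G_X)\subset C_c(\mathcal G)$ given by extension by zero and the second map is the one in (1). -/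

import Mathlib

noncomputable section

/-! ### C*-seminorms, Hausdorff completions and enveloping C*-algebras of *-algebras -/

section Enveloping

variable {A : Type*} [NonUnitalRing A] [Module ℂ A] [IsScalarTower ℂ A A] [SMulCommClass ℂ A A]
  [StarRing A] [StarModule ℂ A]

/-- A C*-seminorm on a complex *-algebra: a submultiplicative seminorm satisfying the C*-identity.
Equivalently, a seminorm of the form `a ↦ ‖π a‖` for a *-homomorphism `π` into a C*-algebra. -/
structure CStarSeminorm (A : Type*) [NonUnitalRing A] [Module ℂ A] [StarRing A]
    extends Seminorm ℂ A where
  mul_le' : ∀ a b : A, toFun (a * b) ≤ toFun a * toFun b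
  star_mul_self' : ∀ a : A, toFun (star a * a) = toFun a ^ 2

namespace CStarSeminorm

instance (A : Type*) [NonUnitalRing A] [Module ℂ A] [StarRing A] :
    CoeFun (CStarSeminorm A) (fun _ => A → ℝ) := ⟨fun p => p.toSeminorm⟩

theorem mul_le (p : CStarSeminorm A) (a b : A) : p (a * b) ≤ p a * p b := p.mul_le' a b

theorem star_mul_self (p : CStarSeminorm A) (a : A) : p (star a * a) = p a ^ 2 :=
  p.star_mul_self' a

theorem nonneg (p : CStarSeminorm A) (a : A) : 0 ≤ p a := apply_nonneg p.toSeminorm a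

theorem le_star (p : CStarSeminorm A) (a : A) : p a ≤ p (star a) := by
  have h1 := p.star_mul_self a
  have h2 := p.mul_le (star a) a
  by_contra! h
  nlinarith [p.nonneg a, p.nonneg (star a)]

theorem star_eq (p : CStarSeminorm A) (a : A) : p (star a) = p a :=
  le_antisymm (by simpa using p.le_star (star a)) (p.le_star a)

/-- The zero C*-seminorm. -/
instance : Inhabited (CStarSeminorm A) :=
  ⟨{ (0 : Seminorm ℂ A) with
      mul_le' := fun _ _ => (zero_mul (0 : ℝ)).ge
      star_mul_self' := fun _ => (zero_pow two_ne_zero).symm }⟩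

/-- The pullback of a C*-seminorm along a *-homomorphism. -/
def comap {B : Type*} [NonUnitalRing B] [Module ℂ B] [StarRing B] (p : CStarSeminorm B)
    (φ : A →⋆ₙₐ[ℂ] B) : CStarSeminorm A :=
  { p.toSeminorm.comp (φ : A →ₗ[ℂ] B) with
    mul_le' := fun a b => by
      have := p.mul_le' (φ a) (φ b)
      rw [← map_mul] at this
      exact this
    star_mul_self' := fun a => by
      have := p.star_mul_self' (φ a)
      rw [← map_star, ← map_mul] at this
      exact this }

theorem comap_apply {B : Type*} [NonUnitalRing B] [Module ℂ B] [StarRing B]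
    (p : CStarSeminorm B) (φ : A →⋆ₙₐ[ℂ] B) (a : A) : p.comap φ a = p (φ a) := rfl

/-- The norm of a C*-algebra as a C*-seminorm. -/
def ofNorm (B : Type*) [NonUnitalCStarAlgebra B] : CStarSeminorm B :=
  { normSeminorm ℂ B with
    mul_le' := fun a b => norm_mul_le a b
    star_mul_self' := fun a => by
      have := CStarRing.norm_star_mul_self (x := a)
      rw [← pow_two] at this
      exact this }

theorem ofNorm_apply {B : Type*} [NonUnitalCStarAlgebra B] (b : B) : ofNorm B b = ‖b‖ := rfl

/-! #### The Hausdorff completion of a *-algebra with respect to a C*-seminorm -/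

/-- The *-algebra `A` regarded as a seminormed ring with the seminorm `p`. -/
def Pre (_p : CStarSeminorm A) : Type _ := A

variable (p : CStarSeminorm A)

instance : NonUnitalRing p.Pre := inferInstanceAs (NonUnitalRing A)
instance : Module ℂ p.Pre := inferInstanceAs (Module ℂ A)
instance : IsScalarTower ℂ p.Pre p.Pre := inferInstanceAs (IsScalarTower ℂ A A)
instance : SMulCommClass ℂ p.Pre p.Pre := inferInstanceAs (SMulCommClass ℂ A A)
instance : StarRing p.Pre := inferInstanceAs (StarRing A)
instance : StarModule ℂ p.Pre := inferInstanceAs (StarModule ℂ A)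

instance : NonUnitalSeminormedRing p.Pre :=
  { (inferInstance : NonUnitalRing p.Pre),
    AddGroupSeminorm.toSeminormedAddCommGroup (E := A) p.toSeminorm.toAddGroupSeminorm with
    norm_mul_le := fun a b => p.mul_le a b }

theorem Pre.norm_def (a : p.Pre) : ‖a‖ = p a := rfl

instance : NormedSpace ℂ p.Pre where
  norm_smul_le c a := (map_smul_eq_mul p.toSeminorm c a).le

instance : NormedStarGroup p.Pre where
  norm_star_le a := (p.star_eq a).le

/-- The Hausdorff completion of the *-algebra `A` with respect to the C*-seminorm `p`. -/
def CStarCompletion : Type _ := UniformSpace.Completion p.Pre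

namespace CStarCompletion

open UniformSpace

instance : NormedAddCommGroup p.CStarCompletion := inferInstanceAs (NormedAddCommGroup (Completion p.Pre))
instance : NormedSpace ℂ p.CStarCompletion := inferInstanceAs (NormedSpace ℂ (Completion p.Pre))
instance : CompleteSpace p.CStarCompletion := inferInstanceAs (CompleteSpace (Completion p.Pre))

/-- The canonical linear map from `A` into its completion. -/
def coeL : p.Pre →ₗᵢ[ℂ] p.CStarCompletion := Completion.toComplₗᵢ

theorem isDenseInducing_coeL : IsDenseInducing (coeL p) := Completion.isDenseInducing_coe

theorem denseRange_coeL : DenseRange (coeL p) := Completion.denseRange_coe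

@[elab_as_elim]
theorem induction₁ {P : p.CStarCompletion → Prop} (a : p.CStarCompletion) (hP : IsClosed {a | P a})
    (h : ∀ a, P (coeL p a)) : P a := Completion.induction_on a hP h

@[elab_as_elim]
theorem induction₂ {P : p.CStarCompletion → p.CStarCompletion → Prop} (a b : p.CStarCompletion)
    (hP : IsClosed {x : p.CStarCompletion × p.CStarCompletion | P x.1 x.2})
    (h : ∀ a b, P (coeL p a) (coeL p b)) : P a b := Completion.induction_on₂ a b hP h

@[elab_as_elim]
theorem induction₃ {P : p.CStarCompletion → p.CStarCompletion → p.CStarCompletion → Prop} (a b c : p.CStarCompletion)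
    (hP : IsClosed {x : p.CStarCompletion × p.CStarCompletion × p.CStarCompletion | P x.1 x.2.1 x.2.2})
    (h : ∀ a b c, P (coeL p a) (coeL p b) (coeL p c)) : P a b c :=
  Completion.induction_on₃ a b c hP h

/-- The continuous extension of the multiplication. -/
instance : Mul p.CStarCompletion :=
  ⟨fun a b => ((isDenseInducing_coeL p).prodMap (isDenseInducing_coeL p)).extend
    (fun x : p.Pre × p.Pre => coeL p (x.1 * x.2)) (a, b)⟩

theorem coe_mul (a b : p.Pre) : coeL p (a * b) = coeL p a * coeL p b :=
  (((isDenseInducing_coeL p).prodMap (isDenseInducing_coeL p)).extend_eq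
    (f := fun x : p.Pre × p.Pre => coeL p (x.1 * x.2))
    ((coeL p).continuous.comp continuous_mul) (a, b)).symm

instance : ContinuousMul p.CStarCompletion where
  continuous_mul := by
    let m := (AddMonoidHom.mul : p.Pre →+ p.Pre →+ p.Pre).compr₂
      (coeL p : p.Pre →+ p.CStarCompletion)
    have : Continuous fun x : p.Pre × p.Pre => m x.1 x.2 :=
      (coeL p).continuous.comp continuous_mul
    have di : IsDenseInducing ((coeL p : p.Pre →+ p.CStarCompletion) : p.Pre → p.CStarCompletion) :=
      isDenseInducing_coeL p
    exact (di.extend_Z_bilin di this :)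

/-- The continuous extension of the involution. -/
instance : Star p.CStarCompletion := ⟨(isDenseInducing_coeL p).extend (fun a => coeL p (star a))⟩

theorem coe_star (a : p.Pre) : coeL p (star a) = star (coeL p a) :=
  ((isDenseInducing_coeL p).extend_eq ((coeL p).continuous.comp continuous_star) a).symm

theorem isometry_star : Isometry (star : p.CStarCompletion → p.CStarCompletion) := by
  have h : Isometry (fun a : p.Pre => coeL p (star a)) :=
    (coeL p).isometry.comp (starₗᵢ ℂ : p.Pre ≃ₗᵢ⋆[ℂ] p.Pre).isometry
  have h2 : (star : p.CStarCompletion → p.CStarCompletion) = Completion.extension (fun a : p.Pre => coeL p (star a)) := by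
    refine (Completion.extension_unique h.uniformContinuous ?_ ?_).symm
    · have hu : UniformContinuous (fun a : p.Pre => coeL p (star a)) := h.uniformContinuous
      exact uniformContinuous_uniformly_extend (Completion.isUniformInducing_coe _)
        Completion.denseRange_coe hu
    · intro a
      exact coe_star p a
  rw [h2]
  exact h.completion_extension

instance : ContinuousStar p.CStarCompletion := ⟨(isometry_star p).continuous⟩

instance : NonUnitalRing p.CStarCompletion :=
  { (inferInstance : AddCommGroup p.CStarCompletion), (inferInstance : Mul p.CStarCompletion) with
    zero_mul := fun a => induction₁ p a (isClosed_eq (by fun_prop) continuous_const)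
      fun a => by rw [← map_zero (coeL p), ← coe_mul, zero_mul]
    mul_zero := fun a => induction₁ p a (isClosed_eq (by fun_prop) continuous_const)
      fun a => by rw [← map_zero (coeL p), ← coe_mul, mul_zero]
    mul_assoc := fun a b c => induction₃ p a b c (isClosed_eq (by fun_prop) (by fun_prop))
      fun a b c => by simp only [← coe_mul, mul_assoc]
    left_distrib := fun a b c => induction₃ p a b c (isClosed_eq (by fun_prop) (by fun_prop))
      fun a b c => by simp only [← coe_mul, ← map_add, mul_add]
    right_distrib := fun a b c => induction₃ p a b c (isClosed_eq (by fun_prop) (by fun_prop))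
      fun a b c => by simp only [← coe_mul, ← map_add, add_mul] }

theorem smul_mul_aux (c : ℂ) (a b : p.CStarCompletion) : (c • a) * b = c • (a * b) := by
  have h1 : Continuous fun x : p.CStarCompletion × p.CStarCompletion => (c • x.1) * x.2 :=
    (continuous_fst.const_smul c).mul continuous_snd
  have h2 : Continuous fun x : p.CStarCompletion × p.CStarCompletion => c • (x.1 * x.2) :=
    (continuous_fst.mul continuous_snd).const_smul c
  refine induction₂ p a b (isClosed_eq h1 h2) fun a b => ?_
  rw [← map_smul, ← coe_mul, ← coe_mul, ← map_smul, smul_mul_assoc]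

theorem mul_smul_aux (c : ℂ) (a b : p.CStarCompletion) : a * (c • b) = c • (a * b) := by
  have h1 : Continuous fun x : p.CStarCompletion × p.CStarCompletion => x.1 * (c • x.2) :=
    continuous_fst.mul (continuous_snd.const_smul c)
  have h2 : Continuous fun x : p.CStarCompletion × p.CStarCompletion => c • (x.1 * x.2) :=
    (continuous_fst.mul continuous_snd).const_smul c
  refine induction₂ p a b (isClosed_eq h1 h2) fun a b => ?_
  rw [← map_smul, ← coe_mul, ← coe_mul, ← map_smul, mul_smul_comm]

theorem star_smul_aux (c : ℂ) (a : p.CStarCompletion) : star (c • a) = star c • star a := by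
  have h1 : Continuous fun x : p.CStarCompletion => star (c • x) :=
    (continuous_id.const_smul c).star
  have h2 : Continuous fun x : p.CStarCompletion => star c • star x :=
    continuous_star.const_smul (star c)
  refine induction₁ p a (isClosed_eq h1 h2) fun a => ?_
  rw [← map_smul, ← coe_star, ← coe_star, ← map_smul, star_smul]

instance : IsScalarTower ℂ p.CStarCompletion p.CStarCompletion := ⟨smul_mul_aux p⟩

instance : SMulCommClass ℂ p.CStarCompletion p.CStarCompletion :=
  ⟨fun c a b => (mul_smul_aux p c a b).symm⟩

instance : StarRing p.CStarCompletion where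
  star_involutive a := induction₁ p a (isClosed_eq (by fun_prop) continuous_id)
    fun a => by rw [← coe_star, ← coe_star, star_star]
  star_mul a b := induction₂ p a b (isClosed_eq (by fun_prop) (by fun_prop))
    fun a b => by simp only [← coe_mul, ← coe_star, star_mul]
  star_add a b := induction₂ p a b (isClosed_eq (by fun_prop) (by fun_prop))
    fun a b => by simp only [← map_add, ← coe_star, star_add]

instance : StarModule ℂ p.CStarCompletion := ⟨star_smul_aux p⟩

theorem norm_coeL (a : p.Pre) : ‖coeL p a‖ = p a := (coeL p).norm_map a

instance : NonUnitalNormedRing p.CStarCompletion :=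
  { (inferInstance : NonUnitalRing p.CStarCompletion),
    (inferInstance : NormedAddCommGroup p.CStarCompletion) with
    norm_mul_le := fun a b => induction₂ p a b (isClosed_le (by fun_prop) (by fun_prop))
      fun a b => by
        rw [← coe_mul, norm_coeL, norm_coeL, norm_coeL]
        exact p.mul_le a b }

instance : CStarRing p.CStarCompletion where
  norm_mul_self_le a := induction₁ p a (isClosed_le (by fun_prop) (by fun_prop))
    fun a => by
      rw [← coe_star, ← coe_mul, norm_coeL, norm_coeL, ← pow_two]
      exact (p.star_mul_self a).ge

instance : NonUnitalCStarAlgebra p.CStarCompletion where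

end CStarCompletion

/-- The canonical *-homomorphism from `A` into its completion. -/
def toCompl (p : CStarSeminorm A) : A →⋆ₙₐ[ℂ] p.CStarCompletion where
  toFun a := CStarCompletion.coeL p a
  map_smul' c a := (CStarCompletion.coeL p).map_smul c a
  map_zero' := (CStarCompletion.coeL p).map_zero
  map_add' a b := (CStarCompletion.coeL p).map_add a b
  map_mul' a b := CStarCompletion.coe_mul p a b
  map_star' a := CStarCompletion.coe_star p a

theorem norm_toCompl (a : A) : ‖p.toCompl a‖ = p a := CStarCompletion.norm_coeL p a

theorem denseRange_toCompl : DenseRange p.toCompl := CStarCompletion.denseRange_coeL p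

end CStarSeminorm

/-- The class of *-algebras for which the supremum of all C*-seminorms is finite at every element,
so that the enveloping C*-algebra is defined. -/
class HasEnveloping (A : Type*) [NonUnitalRing A] [Module ℂ A] [StarRing A] : Prop where
  bdd : ∀ a : A, BddAbove (Set.range fun p : CStarSeminorm A => p a)

/-- The largest C*-seminorm `a ↦ sup {p a | p a C*-seminorm}`, that is, the supremum of `‖π a‖` over
all *-homomorphisms `π` into C*-algebras, or all representations by bounded operators on
Hilbert spaces. -/
def maxCStarSeminorm (A : Type*) [NonUnitalRing A] [Module ℂ A] [IsScalarTower ℂ A A]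
    [SMulCommClass ℂ A A] [StarRing A] [StarModule ℂ A] [HasEnveloping A] : CStarSeminorm A :=
  { Seminorm.of (fun a : A => ⨆ p : CStarSeminorm A, p a)
      (fun a b => ciSup_le fun p => (map_add_le_add p.toSeminorm a b).trans
        (add_le_add (le_ciSup (HasEnveloping.bdd a) p) (le_ciSup (HasEnveloping.bdd b) p)))
      (fun c a => by
        rw [Real.mul_iSup_of_nonneg (norm_nonneg c)]
        exact iSup_congr fun p => map_smul_eq_mul p.toSeminorm c a) with
    mul_le' := fun a b => ciSup_le fun p => (p.mul_le a b).trans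
      (mul_le_mul (le_ciSup (HasEnveloping.bdd a) p) (le_ciSup (HasEnveloping.bdd b) p)
        (p.nonneg b) ((p.nonneg a).trans (le_ciSup (HasEnveloping.bdd a) p)))
    star_mul_self' := fun a => by
      change (⨆ p : CStarSeminorm A, p (star a * a)) = (⨆ p : CStarSeminorm A, p a) ^ 2
      apply le_antisymm
      · refine ciSup_le fun p => ?_
        rw [p.star_mul_self]
        exact pow_le_pow_left₀ (p.nonneg a) (le_ciSup (HasEnveloping.bdd a) p) 2
      · have hb := HasEnveloping.bdd (star a * a)
        have h0 : 0 ≤ ⨆ p : CStarSeminorm A, p (star a * a) := Real.iSup_nonneg fun p => p.nonneg _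
        refine (Real.le_sqrt (Real.iSup_nonneg fun p => p.nonneg _) h0).1 (ciSup_le fun p => ?_)
        refine Real.le_sqrt_of_sq_le ?_
        rw [← p.star_mul_self]
        exact le_ciSup (f := fun p : CStarSeminorm A => p (star a * a)) hb p }

theorem le_maxCStarSeminorm [HasEnveloping A] (p : CStarSeminorm A) (a : A) :
    p a ≤ maxCStarSeminorm A a :=
  le_ciSup (f := fun p : CStarSeminorm A => p a) (HasEnveloping.bdd a) p

/-- The enveloping C*-algebra of a *-algebra: its Hausdorff completion with respect to the largest
C*-seminorm. -/
abbrev EnvelopingCStar (A : Type*) [NonUnitalRing A] [Module ℂ A] [IsScalarTower ℂ A A]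
    [SMulCommClass ℂ A A] [StarRing A] [StarModule ℂ A] [HasEnveloping A] : Type _ :=
  (maxCStarSeminorm A).CStarCompletion

namespace EnvelopingCStar

variable [HasEnveloping A] {B : Type*} [NonUnitalCStarAlgebra B]

/-- The canonical *-homomorphism into the enveloping C*-algebra. -/
abbrev ofAlg : A →⋆ₙₐ[ℂ] EnvelopingCStar A := (maxCStarSeminorm A).toCompl

theorem norm_le_max (φ : A →⋆ₙₐ[ℂ] B) (a : A) : ‖φ a‖ ≤ ‖(ofAlg a : EnvelopingCStar A)‖ := by
  rw [CStarSeminorm.norm_toCompl]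
  exact le_maxCStarSeminorm ((CStarSeminorm.ofNorm B).comap φ) a

/-- The continuous linear extension of a *-homomorphism. -/
def liftL (φ : A →⋆ₙₐ[ℂ] B) : EnvelopingCStar A →L[ℂ] B :=
  LinearMap.extendOfNorm (φ : A →ₗ[ℂ] B) ((ofAlg : A →⋆ₙₐ[ℂ] EnvelopingCStar A) : A →ₗ[ℂ] _)

theorem liftL_ofAlg (φ : A →⋆ₙₐ[ℂ] B) (a : A) : liftL φ (ofAlg a) = φ a :=
  LinearMap.extendOfNorm_eq (CStarSeminorm.denseRange_toCompl _)
    ⟨1, fun x => by rw [one_mul]; exact norm_le_max φ x⟩ a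

/-- The universal property: every *-homomorphism from `A` to a C*-algebra extends to
the enveloping C*-algebra of `A`. -/
def lift (φ : A →⋆ₙₐ[ℂ] B) : EnvelopingCStar A →⋆ₙₐ[ℂ] B :=
  { liftL φ with
    map_smul' := fun c a => (liftL φ).map_smul c a
    map_zero' := (liftL φ).map_zero
    map_mul' := fun a b => by
      change liftL φ (a * b) = liftL φ a * liftL φ b
      refine (CStarSeminorm.denseRange_toCompl _).induction_on₂
        (isClosed_eq (by fun_prop) (by fun_prop)) (fun a b => ?_) a b
      rw [← map_mul, liftL_ofAlg, liftL_ofAlg, liftL_ofAlg, map_mul]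
    map_star' := fun a => by
      change liftL φ (star a) = star (liftL φ a)
      refine (CStarSeminorm.denseRange_toCompl _).induction_on
        (p := fun a => liftL φ (star a) = star (liftL φ a)) a
        (isClosed_eq (by fun_prop) (by fun_prop)) (fun a => ?_)
      rw [← map_star, liftL_ofAlg, liftL_ofAlg, map_star] }

theorem lift_ofAlg (φ : A →⋆ₙₐ[ℂ] B) (a : A) : lift φ (ofAlg a) = φ a := liftL_ofAlg φ a

/-- The *-homomorphism of enveloping C*-algebras induced by a *-homomorphism. -/
def map {A' : Type*} [NonUnitalRing A'] [Module ℂ A'] [IsScalarTower ℂ A' A']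
    [SMulCommClass ℂ A' A'] [StarRing A'] [StarModule ℂ A'] [HasEnveloping A']
    (φ : A →⋆ₙₐ[ℂ] A') : EnvelopingCStar A →⋆ₙₐ[ℂ] EnvelopingCStar A' :=
  lift ((ofAlg : A' →⋆ₙₐ[ℂ] EnvelopingCStar A').comp φ)

end EnvelopingCStar

end Enveloping

/-! ### Groupoids, locally compact étale groupoids -/

/-- A groupoid, presented by its set `G` of arrows. The units are the arrows `x` with `src x = x`.
The product `mul g h` is meaningful only if `src g = rng h`, and nothing is required of it
otherwise. -/
class ArrowGroupoid (G : Type*) where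
  src : G → G
  rng : G → G
  mul : G → G → G
  inv : G → G
  src_src : ∀ g, src (src g) = src g
  rng_src : ∀ g, rng (src g) = src g
  src_rng : ∀ g, src (rng g) = rng g
  rng_rng : ∀ g, rng (rng g) = rng g
  src_mul : ∀ g h, src g = rng h → src (mul g h) = src h
  rng_mul : ∀ g h, src g = rng h → rng (mul g h) = rng g
  mul_assoc : ∀ g h k, src g = rng h → src h = rng k → mul (mul g h) k = mul g (mul h k)
  rng_mul_self : ∀ g, mul (rng g) g = g
  mul_src_self : ∀ g, mul g (src g) = g
  src_inv : ∀ g, src (inv g) = rng g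
  rng_inv : ∀ g, rng (inv g) = src g
  inv_mul : ∀ g, mul (inv g) g = src g
  mul_inv : ∀ g, mul g (inv g) = rng g

namespace ArrowGroupoid

section Algebra

variable {G : Type*} [ArrowGroupoid G]

theorem inv_mul_mul (k l : G) (h : src k = rng l) : mul (inv k) (mul k l) = l := by
  rw [← mul_assoc _ _ _ (src_inv k) h, inv_mul, h, rng_mul_self]

theorem mul_inv_mul (k h : G) (e : rng k = rng h) : mul k (mul (inv k) h) = h := by
  rw [← mul_assoc _ _ _ (rng_inv k).symm ((src_inv k).trans e), mul_inv, e, rng_mul_self]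

theorem eq_inv_of_mul (a b : G) (e : src a = rng b) (h : mul a b = rng a) : b = inv a := by
  have h1 := inv_mul_mul a b e
  rw [h, ← src_inv, mul_src_self] at h1
  exact h1.symm

theorem inv_inv (g : G) : inv (inv g) = g :=
  (eq_inv_of_mul (inv g) g (src_inv g) (by rw [inv_mul, rng_inv])).symm

theorem inv_mul_rev (g h : G) (e : src g = rng h) : inv (mul g h) = mul (inv h) (inv g) := by
  have e1 : src (inv h) = rng (inv g) := by rw [src_inv, rng_inv, e]
  refine (eq_inv_of_mul _ _ ?_ ?_).symm
  · rw [src_mul _ _ e, rng_mul _ _ e1, rng_inv]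
  · rw [mul_assoc _ _ _ e (by rw [rng_mul _ _ e1, rng_inv]),
      mul_inv_mul _ _ (by rw [rng_inv, e]), mul_inv, rng_mul _ _ e]

theorem mul_mul_inv (g h : G) (e : src g = src h) : mul (mul g (inv h)) h = g := by
  rw [mul_assoc _ _ _ (by rw [rng_inv, e]) (src_inv h), inv_mul, ← e, mul_src_self]

/-- The unit space `G⁰`. It carries the relative topology if `G` is a topological space. -/
abbrev UnitSpace (G : Type*) [ArrowGroupoid G] : Type _ := {x : G // src x = x}

/-- The source map `G → G⁰`. -/
def s (g : G) : UnitSpace G := ⟨src g, src_src g⟩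

/-- The range map `G → G⁰`. -/
def r (g : G) : UnitSpace G := ⟨rng g, src_rng g⟩

theorem rng_unit (x : UnitSpace G) : rng (x : G) = x := by
  have := rng_src (x : G)
  rwa [x.2] at this

theorem r_unit (x : UnitSpace G) : r (x : G) = x := Subtype.ext (rng_unit x)

theorem s_unit (x : UnitSpace G) : s (x : G) = x := Subtype.ext x.2

theorem r_eq_iff {g h : G} : r g = r h ↔ rng g = rng h := Subtype.ext_iff

theorem s_eq_iff {g h : G} : s g = s h ↔ src g = src h := Subtype.ext_iff

/-- The convolution product `(f₁ * f₂) g = ∑ f₁ h * f₂ (h⁻¹ g)` over all `h` with `r h = r g`. -/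
def conv (f₁ f₂ : G → ℂ) (g : G) : ℂ :=
  ∑ᶠ h ∈ {h : G | r h = r g}, f₁ h * f₂ (mul (inv h) g)

/-- The involution `f* g = conj (f g⁻¹)`. -/
def invol (f : G → ℂ) (g : G) : ℂ := star (f (inv g))

/-- The function `f` has finite support in every fibre of the range map. -/
def RFin (f : G → ℂ) : Prop := ∀ x : UnitSpace G, ({h : G | r h = x} ∩ Function.support f).Finite

theorem conv_add {f₁ f₂ f₃ : G → ℂ} (h₁ : RFin f₁) :
    conv f₁ (f₂ + f₃) = conv f₁ f₂ + conv f₁ f₃ := by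
  funext g
  have hf : ∀ f : G → ℂ, ({h : G | r h = r g} ∩
      Function.support fun h => f₁ h * f (mul (inv h) g)).Finite := fun f =>
    (h₁ (r g)).subset (Set.inter_subset_inter_right _ (Function.support_mul_subset_left _ _))
  simp only [conv, Pi.add_apply, mul_add]
  exact finsum_mem_add_distrib' (hf f₂) (hf f₃)

theorem add_conv {f₁ f₂ f₃ : G → ℂ} (h₁ : RFin f₁) (h₂ : RFin f₂) :
    conv (f₁ + f₂) f₃ = conv f₁ f₃ + conv f₂ f₃ := by
  funext g
  have hf : ∀ f : G → ℂ, RFin f → ({h : G | r h = r g} ∩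
      Function.support fun h => f h * f₃ (mul (inv h) g)).Finite := fun f h =>
    (h (r g)).subset (Set.inter_subset_inter_right _ (Function.support_mul_subset_left _ _))
  simp only [conv, Pi.add_apply, add_mul]
  exact finsum_mem_add_distrib' (hf f₁ h₁) (hf f₂ h₂)

theorem smul_conv (c : ℂ) (f₁ f₂ : G → ℂ) : conv (c • f₁) f₂ = c • conv f₁ f₂ := by
  funext g
  simp only [conv, Pi.smul_apply, smul_eq_mul, mul_finsum_mem, _root_.mul_assoc]

theorem conv_smul (c : ℂ) (f₁ f₂ : G → ℂ) : conv f₁ (c • f₂) = c • conv f₁ f₂ := by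
  funext g
  simp only [conv, Pi.smul_apply, smul_eq_mul, mul_finsum_mem, mul_left_comm]

theorem zero_conv (f : G → ℂ) : conv 0 f = 0 := by
  simpa using smul_conv 0 0 f

theorem conv_zero (f : G → ℂ) : conv f 0 = 0 := by
  simpa using conv_smul 0 f 0

theorem bijOn_mul (k : G) :
    Set.BijOn (mul k) {l : G | r l = s k} {h : G | r h = r k} := by
  refine ⟨fun l hl => ?_, fun l hl l' hl' e => ?_, fun h hh => ?_⟩
  · exact r_eq_iff.2 (rng_mul _ _ (congrArg Subtype.val hl).symm)
  · have e1 := congrArg (mul (inv k)) e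
    rwa [inv_mul_mul _ _ (congrArg Subtype.val hl).symm,
      inv_mul_mul _ _ (congrArg Subtype.val hl').symm] at e1
  · have e : rng k = rng h := (congrArg Subtype.val hh).symm
    refine ⟨mul (inv k) h, Subtype.ext ?_, mul_inv_mul k h e⟩
    exact (rng_mul _ _ ((src_inv k).trans e)).trans (rng_inv k)

theorem conv_assoc {f₁ f₂ f₃ : G → ℂ} (h₁ : RFin f₁) (h₂ : RFin f₂) :
    conv (conv f₁ f₂) f₃ = conv f₁ (conv f₂ f₃) := by
  funext g
  set F : Set G := {h : G | r h = r g} with hF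
  set S : Set G := F ∩ Function.support f₁ with hS
  have hSf : S.Finite := h₁ (r g)
  set T : Set G := ⋃ k ∈ S, mul k '' ({l : G | r l = s k} ∩ Function.support f₂) with hT
  have hTf : T.Finite := hSf.biUnion fun k _ => (h₂ (s k)).image _
  have hTF : T ⊆ F := by
    intro h hh
    simp only [hT, Set.mem_iUnion] at hh
    obtain ⟨k, hk, l, ⟨hl, -⟩, rfl⟩ := hh
    exact ((bijOn_mul k).mapsTo hl).trans hk.1
  have inner : ∀ h ∈ F, conv f₁ f₂ h = ∑ᶠ k ∈ S, f₁ k * f₂ (mul (inv k) h) := by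
    intro h hh
    have e : {k : G | r k = r h} = F := by rw [hF]; rw [show r h = r g from hh]
    rw [conv, e]
    refine finsum_mem_inter_support_eq _ _ _ ?_
    ext k
    simp only [hS, Set.mem_inter_iff, Function.mem_support, ne_eq, mul_eq_zero, not_or]
    tauto
  have mem : ∀ k ∈ S, ∀ h ∈ F, f₂ (mul (inv k) h) ≠ 0 → h ∈ T := by
    intro k hk h hh hne
    have e : r h = r k := (show r h = r g from hh).trans (show r k = r g from hk.1).symm
    obtain ⟨l, hl, rfl⟩ := (bijOn_mul k).surjOn e
    rw [inv_mul_mul _ _ (congrArg Subtype.val hl).symm] at hne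
    exact Set.mem_biUnion hk ⟨l, ⟨hl, hne⟩, rfl⟩
  have left : conv (conv f₁ f₂) f₃ g =
      ∑ᶠ h ∈ T, ∑ᶠ k ∈ S, f₁ k * f₂ (mul (inv k) h) * f₃ (mul (inv h) g) := by
    rw [conv, ← hF]
    have : ∑ᶠ h ∈ F, conv f₁ f₂ h * f₃ (mul (inv h) g) =
        ∑ᶠ h ∈ T, conv f₁ f₂ h * f₃ (mul (inv h) g) := by
      refine finsum_mem_inter_support_eq _ _ _ ?_
      ext h
      constructor
      · rintro ⟨hh, hne⟩
        refine ⟨?_, hne⟩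
        have h3 : conv f₁ f₂ h ≠ 0 := left_ne_zero_of_mul hne
        rw [inner h hh] at h3
        obtain ⟨k, hk, hk2⟩ := exists_ne_zero_of_finsum_mem_ne_zero h3
        exact mem k hk h hh (right_ne_zero_of_mul hk2)
      · rintro ⟨hh, hne⟩
        exact ⟨hTF hh, hne⟩
    rw [this]
    refine finsum_mem_congr rfl fun h hh => ?_
    rw [inner h (hTF hh), finsum_mem_mul]
  have right : conv f₁ (conv f₂ f₃) g =
      ∑ᶠ k ∈ S, ∑ᶠ h ∈ T, f₁ k * f₂ (mul (inv k) h) * f₃ (mul (inv h) g) := by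
    rw [conv, ← hF]
    have : ∑ᶠ k ∈ F, f₁ k * conv f₂ f₃ (mul (inv k) g) =
        ∑ᶠ k ∈ S, f₁ k * conv f₂ f₃ (mul (inv k) g) := by
      refine finsum_mem_inter_support_eq _ _ _ ?_
      ext k
      simp only [hS, Set.mem_inter_iff, Function.mem_support, ne_eq, mul_eq_zero, not_or]
      tauto
    rw [this]
    refine finsum_mem_congr rfl fun k hk => ?_
    have hkg : rng k = rng g := r_eq_iff.1 hk.1
    have e1 : r (mul (inv k) g) = s k :=
      Subtype.ext ((rng_mul _ _ ((src_inv k).trans hkg)).trans (rng_inv k))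
    have e2 : conv f₂ f₃ (mul (inv k) g) =
        ∑ᶠ h ∈ F, f₂ (mul (inv k) h) * f₃ (mul (inv h) g) := by
      rw [conv, e1, hF, ← show r k = r g from hk.1]
      refine finsum_mem_eq_of_bijOn (mul k) (bijOn_mul k) fun l hl => ?_
      have hl' : src k = rng l := (congrArg Subtype.val hl).symm
      rw [inv_mul_mul _ _ hl', inv_mul_rev _ _ hl',
        mul_assoc _ _ _ (by rw [src_inv, rng_inv, hl']) ((src_inv k).trans hkg)]
    have e3 : ∑ᶠ h ∈ F, f₂ (mul (inv k) h) * f₃ (mul (inv h) g) =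
        ∑ᶠ h ∈ T, f₂ (mul (inv k) h) * f₃ (mul (inv h) g) := by
      refine finsum_mem_inter_support_eq _ _ _ ?_
      ext h
      constructor
      · rintro ⟨hh, hne⟩
        exact ⟨mem k hk h hh (left_ne_zero_of_mul hne), hne⟩
      · rintro ⟨hh, hne⟩
        exact ⟨hTF hh, hne⟩
    rw [e2, e3, mul_finsum_mem]
    simp only [_root_.mul_assoc]
  rw [left, right]
  exact finsum_mem_comm _ hTf hSf

theorem invol_invol (f : G → ℂ) : invol (invol f) = f := by
  funext g
  simp only [invol, inv_inv, star_star]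

theorem invol_conv (f₁ f₂ : G → ℂ) : invol (conv f₁ f₂) = conv (invol f₂) (invol f₁) := by
  funext g
  have h1 : star (conv f₁ f₂ (inv g)) =
      ∑ᶠ h ∈ {h : G | r h = s g}, star (f₁ h * f₂ (mul (inv h) (inv g))) := by
    have e : r (inv g) = s g := Subtype.ext (rng_inv g)
    rw [conv, e]
    exact ((starAddEquiv : ℂ ≃+ ℂ).map_finsum _).trans
      (finsum_congr fun h => (starAddEquiv : ℂ ≃+ ℂ).map_finsum _)
  rw [invol, h1, conv]
  refine finsum_mem_eq_of_bijOn (mul g) (bijOn_mul g) fun h hh => ?_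
  have hh' : src g = rng h := (congrArg Subtype.val hh).symm
  have e1 : mul (mul (inv h) (inv g)) g = inv h :=
    mul_mul_inv (inv h) g (by rw [src_inv, hh'])
  simp only [invol]
  rw [inv_mul_rev g h hh', e1, inv_inv, star_mul]

end Algebra
end ArrowGroupoid

open scoped CompactlySupported ZeroAtInfty

/-- A locally compact, not necessarily Hausdorff, étale groupoid. -/
class IsLCEtaleGroupoid (G : Type*) [TopologicalSpace G] [ArrowGroupoid G] : Prop where
  locallyCompact : LocallyCompactSpace G
  continuousOn_mul :
    ContinuousOn (fun p : G × G => ArrowGroupoid.mul p.1 p.2)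
      {p | ArrowGroupoid.src p.1 = ArrowGroupoid.rng p.2}
  continuous_inv : Continuous (ArrowGroupoid.inv : G → G)
  t2_units : T2Space (ArrowGroupoid.UnitSpace G)
  locallyCompact_units : LocallyCompactSpace (ArrowGroupoid.UnitSpace G)
  isLocalHomeomorph_r : IsLocalHomeomorph (ArrowGroupoid.r : G → ArrowGroupoid.UnitSpace G)
  isLocalHomeomorph_s : IsLocalHomeomorph (ArrowGroupoid.s : G → ArrowGroupoid.UnitSpace G)

/-! ### The spaces `C_c(U)` -/

section Cc

variable {G : Type*} [TopologicalSpace G]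

/-- The functions in `C_c(V)`, extended by zero to `G`. -/
def CcOn (V : Set G) : Set (G → ℂ) :=
  {f | ∃ φ : C_c(V, ℂ), f = Function.extend (Subtype.val : V → G) φ 0}

/-- For an open set `U`, the span `C_c(U)` of the spaces `C_c(V)` over all open Hausdorff
subsets `V` of `U`, inside the space of all functions on `G`. -/
def Cc (U : Set G) : Submodule ℂ (G → ℂ) :=
  Submodule.span ℂ {f | ∃ V ⊆ U, IsOpen V ∧ T2Space V ∧ f ∈ CcOn V}

theorem mem_CcOn_iff {V : Set G} [T2Space V] {f : G → ℂ} :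
    f ∈ CcOn V ↔ ContinuousOn f V ∧ ∃ K ⊆ V, IsCompact K ∧ ∀ g, g ∉ K → f g = 0 := by
  constructor
  · rintro ⟨φ, rfl⟩
    have hval : ∀ v : V, Function.extend (Subtype.val : V → G) φ 0 v = φ v := fun v =>
      Subtype.val_injective.extend_apply φ 0 v
    refine ⟨?_, Subtype.val '' tsupport φ, ?_, ?_, ?_⟩
    · rw [continuousOn_iff_continuous_domRestrict]
      convert! φ.continuous using 1
      funext v
      exact hval v
    · rintro _ ⟨v, -, rfl⟩
      exact v.2
    · exact φ.hasCompactSupport.isCompact.image continuous_subtype_val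
    · intro g hg
      by_cases hgV : g ∈ V
      · rw [hval ⟨g, hgV⟩]
        refine image_eq_zero_of_notMem_tsupport fun h => hg ⟨⟨g, hgV⟩, h, rfl⟩
      · rw [Function.extend_apply']
        · rfl
        · rintro ⟨v, rfl⟩
          exact hgV v.2
  · rintro ⟨hc, K, hKV, hK, h0⟩
    refine ⟨⟨⟨V.domRestrict f, continuousOn_iff_continuous_domRestrict.1 hc⟩, ?_⟩, ?_⟩
    · refine HasCompactSupport.intro (K := Subtype.val ⁻¹' K) ?_ fun v hv => h0 v hv
      rw [Subtype.isCompact_iff, Subtype.image_preimage_coe, Set.inter_eq_right.2 hKV]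
      exact hK
    · funext g
      by_cases hgV : g ∈ V
      · exact (Subtype.val_injective.extend_apply (V.domRestrict f) 0 ⟨g, hgV⟩).symm
      · rw [Function.extend_apply']
        · exact h0 g fun h => hgV (hKV h)
        · rintro ⟨v, rfl⟩
          exact hgV v.2

theorem CcOn_le_Cc {U V : Set G} (hVU : V ⊆ U) (hV : IsOpen V) [hT : T2Space V] {f : G → ℂ}
    (hf : f ∈ CcOn V) : f ∈ Cc U := Submodule.subset_span ⟨V, hVU, hV, hT, hf⟩

theorem Cc_mono {U V : Set G} (hVU : V ⊆ U) : Cc V ≤ Cc U :=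
  Submodule.span_mono fun _ ⟨W, hW, h⟩ => ⟨W, hW.trans hVU, h⟩

/-- Partition of unity argument: it suffices to take small sets `V`. -/
theorem CcOn_mem_span [LocallyCompactSpace G] {V : Set G} (hV : IsOpen V) [T2Space V]
    (P : Set G → Prop) (hP : ∀ g ∈ V, ∃ B, g ∈ B ∧ IsOpen B ∧ B ⊆ V ∧ P B) {f : G → ℂ}
    (hf : f ∈ CcOn V) :
    f ∈ Submodule.span ℂ {f | ∃ B, IsOpen B ∧ B ⊆ V ∧ P B ∧ f ∈ CcOn B} := by
  obtain ⟨φ, rfl⟩ := hf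
  have : LocallyCompactSpace V := hV.locallyCompactSpace
  choose! B hgB hBo hBV hBP using hP
  have hK : IsCompact (tsupport φ) := φ.hasCompactSupport.isCompact
  obtain ⟨t, -, ht⟩ := hK.elim_nhds_subcover (fun v : V => Subtype.val ⁻¹' (B v))
    (fun v _ => ((hBo v v.2).preimage continuous_subtype_val).mem_nhds (hgB v v.2))
  let e := t.equivFin.symm
  obtain ⟨ρ, hρs, hρ1, -, hρc⟩ := exists_continuous_sum_one_of_isOpen_isCompact
    (s := fun i : Fin t.card => (Subtype.val ⁻¹' (B (e i : V)) : Set V))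
    (fun i => (hBo _ (e i : V).2).preimage continuous_subtype_val) hK (by
      refine ht.trans ?_
      intro v hv
      simp only [Set.mem_iUnion] at hv ⊢
      obtain ⟨w, hw, hv⟩ := hv
      exact ⟨t.equivFin ⟨w, hw⟩, by simpa [e] using hv⟩)
  let F : Fin t.card → G → ℂ := fun i =>
    Function.extend (Subtype.val : V → G) (fun v => (ρ i v : ℂ) * φ v) 0
  have hsum : Function.extend (Subtype.val : V → G) φ 0 = ∑ i, F i := by
    funext g
    rw [Finset.sum_apply]
    by_cases hg : g ∈ V
    · have h1 : ∀ ψ : V → ℂ, Function.extend (Subtype.val : V → G) ψ 0 g = ψ ⟨g, hg⟩ := fun ψ =>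
        Subtype.val_injective.extend_apply ψ 0 ⟨g, hg⟩
      simp only [F, h1, ← Finset.sum_mul]
      by_cases hs : (⟨g, hg⟩ : V) ∈ tsupport φ
      · have h2 := hρ1 hs
        rw [Finset.sum_apply] at h2
        rw [← Complex.ofReal_sum, h2]
        simp
      · rw [image_eq_zero_of_notMem_tsupport hs, mul_zero]
    · have h1 : ∀ ψ : V → ℂ, Function.extend (Subtype.val : V → G) ψ 0 g = 0 := fun ψ => by
        rw [Function.extend_apply']
        · rfl
        · rintro ⟨v, rfl⟩
          exact hg v.2
      simp [F, h1]
  rw [hsum]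
  refine Submodule.sum_mem _ fun i _ => Submodule.subset_span
    ⟨B (e i : V), hBo _ (e i : V).2, hBV _ (e i : V).2, hBP _ (e i : V).2, ?_⟩
  have hBV' := hBV _ (e i : V).2
  have : T2Space (B (e i : V)) := T2Space.of_injective_continuous
    (f := Set.inclusion hBV') (Set.inclusion_injective hBV') (continuous_inclusion hBV')
  refine mem_CcOn_iff.2 ⟨?_, Subtype.val '' tsupport (ρ i), ?_, ?_, ?_⟩
  · refine ContinuousOn.mono (continuousOn_iff_continuous_domRestrict.2 ?_) hBV'
    have : V.domRestrict (F i) = fun v => (ρ i v : ℂ) * φ v := by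
      funext v
      exact Subtype.val_injective.extend_apply (fun v => (ρ i v : ℂ) * φ v) (0 : G → ℂ) v
    rw [this]
    exact (Complex.continuous_ofReal.comp (ρ i).continuous).mul φ.continuous
  · rintro _ ⟨v, hv, rfl⟩
    exact hρs i hv
  · exact (hρc i).isCompact.image continuous_subtype_val
  · intro g hg
    by_cases hgV : g ∈ V
    · have : F i g = (ρ i ⟨g, hgV⟩ : ℂ) * φ ⟨g, hgV⟩ :=
        Subtype.val_injective.extend_apply (fun v => (ρ i v : ℂ) * φ v) (0 : G → ℂ) ⟨g, hgV⟩
      rw [this, image_eq_zero_of_notMem_tsupport fun h => hg ⟨⟨g, hgV⟩, h, rfl⟩]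
      simp
    · refine (Function.extend_apply' _ _ _ ?_).trans rfl
      rintro ⟨v, rfl⟩
      exact hgV v.2

end Cc

namespace ArrowGroupoid

section Etale

variable {G : Type*} [TopologicalSpace G] [ArrowGroupoid G] [IsLCEtaleGroupoid G]

instance : T2Space (UnitSpace G) := IsLCEtaleGroupoid.t2_units
instance : LocallyCompactSpace (UnitSpace G) := IsLCEtaleGroupoid.locallyCompact_units

theorem continuous_r : Continuous (r : G → UnitSpace G) :=
  IsLCEtaleGroupoid.isLocalHomeomorph_r.continuous

theorem continuous_s : Continuous (s : G → UnitSpace G) :=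
  IsLCEtaleGroupoid.isLocalHomeomorph_s.continuous

theorem continuous_inv' : Continuous (inv : G → G) := IsLCEtaleGroupoid.continuous_inv

/-- An open bisection: an open set on which both `r` and `s` are injective. -/
structure IsOpenBisection (B : Set G) : Prop where
  isOpen : IsOpen B
  injOn_r : Set.InjOn (r : G → UnitSpace G) B
  injOn_s : Set.InjOn (s : G → UnitSpace G) B

theorem t2_of_injOn {B : Set G} (h : Set.InjOn (r : G → UnitSpace G) B) : T2Space B :=
  T2Space.of_injective_continuous (f := B.domRestrict (r : G → UnitSpace G))
    (Set.injOn_iff_injective.1 h) (continuous_r.comp continuous_subtype_val)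

theorem IsOpenBisection.t2 {B : Set G} (h : IsOpenBisection B) : T2Space B := t2_of_injOn h.injOn_r

theorem exists_bisection {V : Set G} (hV : IsOpen V) {g : G} (hg : g ∈ V) :
    ∃ B, g ∈ B ∧ IsOpen B ∧ B ⊆ V ∧ IsOpenBisection B := by
  obtain ⟨e₁, h₁, he₁⟩ := IsLCEtaleGroupoid.isLocalHomeomorph_r (G := G) g
  obtain ⟨e₂, h₂, he₂⟩ := IsLCEtaleGroupoid.isLocalHomeomorph_s (G := G) g
  have ho : IsOpen (V ∩ (e₁.source ∩ e₂.source)) :=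
    hV.inter (e₁.open_source.inter e₂.open_source)
  refine ⟨V ∩ (e₁.source ∩ e₂.source), ⟨hg, h₁, h₂⟩, ho, Set.inter_subset_left, ho, ?_, ?_⟩
  · rw [he₁]
    exact e₁.injOn.mono fun x hx => hx.2.1
  · rw [he₂]
    exact e₂.injOn.mono fun x hx => hx.2.2

/-- In the definition of `C_c(U)` it suffices to take open bisections. -/
theorem Cc_eq_span (U : Set G) :
    Cc U = Submodule.span ℂ {f | ∃ B, IsOpenBisection B ∧ B ⊆ U ∧ f ∈ CcOn B} := by
  have : LocallyCompactSpace G := IsLCEtaleGroupoid.locallyCompact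
  apply le_antisymm
  · refine Submodule.span_le.2 ?_
    rintro f ⟨V, hVU, hV, hT, hf⟩
    refine Submodule.span_mono ?_ (CcOn_mem_span hV IsOpenBisection
      (fun g hg => exists_bisection hV hg) hf)
    rintro f ⟨B, -, hBV, hB, hf⟩
    exact ⟨B, hB, hBV.trans hVU, hf⟩
  · refine Submodule.span_mono ?_
    rintro f ⟨B, hB, hBU, hf⟩
    exact ⟨B, hBU, hB.isOpen, hB.t2, hf⟩

theorem RFin.add {f₁ f₂ : G → ℂ} (h₁ : RFin f₁) (h₂ : RFin f₂) : RFin (f₁ + f₂) := fun x => by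
  refine ((h₁ x).union (h₂ x)).subset ?_
  rw [← Set.inter_union_distrib_left]
  exact Set.inter_subset_inter_right _ (Function.support_add f₁ f₂)

theorem RFin.smul {f : G → ℂ} (c : ℂ) (h : RFin f) : RFin (c • f) := fun x =>
  (h x).subset (Set.inter_subset_inter_right _ (Function.support_const_smul_subset c f))

theorem rFin_of_mem_CcOn {B : Set G} (hB : IsOpenBisection B) {f : G → ℂ} (hf : f ∈ CcOn B) :
    RFin f := by
  intro x
  have := hB.t2
  obtain ⟨-, K, hKB, -, h0⟩ := mem_CcOn_iff.1 hf
  refine Set.Subsingleton.finite ?_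
  rintro g ⟨hg, hg'⟩ h ⟨hh, hh'⟩
  refine hB.injOn_r (hKB ?_) (hKB ?_) ((show r g = x from hg).trans (show r h = x from hh).symm)
  · by_contra h
    exact hg' (h0 _ h)
  · by_contra h
    exact hh' (h0 _ h)

theorem rFin_of_mem_Cc {U : Set G} {f : G → ℂ} (hf : f ∈ Cc U) : RFin f := by
  rw [Cc_eq_span] at hf
  induction hf using Submodule.span_induction with
  | mem f h =>
    obtain ⟨B, hB, -, hf⟩ := h
    exact rFin_of_mem_CcOn hB hf
  | zero => exact fun x => by simp
  | add f₁ f₂ _ _ h₁ h₂ => exact h₁.add h₂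
  | smul c f _ h => exact h.smul c

/-- The product of two sets of arrows. -/
def setMul (B₁ B₂ : Set G) : Set G := {g | ∃ h ∈ B₁, ∃ k ∈ B₂, src h = rng k ∧ mul h k = g}

theorem conv_mem_CcOn {B₁ B₂ : Set G} (h₁ : IsOpenBisection B₁) (h₂ : IsOpenBisection B₂)
    {f₁ f₂ : G → ℂ} (hf₁ : f₁ ∈ CcOn B₁) (hf₂ : f₂ ∈ CcOn B₂) :
    IsOpen (setMul B₁ B₂) ∧ Set.InjOn (r : G → UnitSpace G) (setMul B₁ B₂) ∧
      conv f₁ f₂ ∈ CcOn (setMul B₁ B₂) := by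
  have := h₁.t2
  have := h₂.t2
  obtain ⟨hc₁, K₁, hK₁B, hK₁, hz₁⟩ := mem_CcOn_iff.1 hf₁
  obtain ⟨hc₂, K₂, hK₂B, hK₂, hz₂⟩ := mem_CcOn_iff.1 hf₂
  have key : ∀ g ∈ setMul B₁ B₂, ∃ h ∈ B₁, r h = r g ∧ mul (inv h) g ∈ B₂ := by
    rintro _ ⟨h, hh, k, hk, e, rfl⟩
    refine ⟨h, hh, r_eq_iff.2 (rng_mul _ _ e).symm, ?_⟩
    rwa [inv_mul_mul _ _ e]
  have key' : ∀ g, ∀ h ∈ B₁, r h = r g → mul (inv h) g ∈ B₂ → g ∈ setMul B₁ B₂ := by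
    intro g h hh e hk
    refine ⟨h, hh, _, hk, ?_, mul_inv_mul _ _ (r_eq_iff.1 e)⟩
    rw [rng_mul _ _ ((src_inv h).trans (r_eq_iff.1 e)), rng_inv]
  have hinj : Set.InjOn (r : G → UnitSpace G) (setMul B₁ B₂) := by
    intro g hg g' hg' e
    obtain ⟨h, hh, e1, hk⟩ := key g hg
    obtain ⟨h', hh', e1', hk'⟩ := key g' hg'
    obtain rfl : h = h' := h₁.injOn_r hh hh' (e1.trans (e.trans e1'.symm))
    have e2 : mul (inv h) g = mul (inv h) g' := by
      refine h₂.injOn_r hk hk' (r_eq_iff.2 ?_)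
      rw [rng_mul _ _ ((src_inv h).trans (r_eq_iff.1 e1)),
        rng_mul _ _ ((src_inv h).trans (r_eq_iff.1 e1'))]
    rw [← mul_inv_mul h g (r_eq_iff.1 e1), e2, mul_inv_mul h g' (r_eq_iff.1 e1')]
  -- the arrow of the first bisection with the same range
  have hex : ∀ g : G, r g ∈ r '' B₁ → ∃ h ∈ B₁, r h = r g := fun g hg => hg
  choose! σ hσB hσr using hex
  set D : Set G := r ⁻¹' (r '' B₁) with hD
  have hDo : IsOpen D :=
    (IsLCEtaleGroupoid.isLocalHomeomorph_r.isOpenMap _ h₁.isOpen).preimage continuous_r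
  have hσc : ContinuousOn σ D := by
    intro g hg
    refine ContinuousAt.continuousWithinAt ?_
    intro W hW
    obtain ⟨W', hW'W, hW'o, hgW'⟩ := mem_nhds_iff.1 hW
    have hO : IsOpen (r ⁻¹' (r '' (B₁ ∩ W')) : Set G) :=
      (IsLCEtaleGroupoid.isLocalHomeomorph_r.isOpenMap _ (h₁.isOpen.inter hW'o)).preimage
        continuous_r
    refine Filter.mem_map.2 (Filter.mem_of_superset (hO.mem_nhds ⟨σ g, ⟨hσB g hg, hgW'⟩, hσr g hg⟩) ?_)
    rintro g' ⟨b, ⟨hb, hbW⟩, e⟩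
    have hg' : r g' ∈ r '' B₁ := ⟨b, hb, e⟩
    have : σ g' = b := h₁.injOn_r (hσB g' hg') hb ((hσr g' hg').trans e.symm)
    exact hW'W (by rw [this]; exact hbW)
  have huc : ContinuousOn (fun g => mul (inv (σ g)) g) D := by
    refine IsLCEtaleGroupoid.continuousOn_mul.comp
      ((continuous_inv'.comp_continuousOn hσc).prodMk continuousOn_id) ?_
    intro g hg
    exact (src_inv _).trans (r_eq_iff.1 (hσr g hg))
  have hPD : setMul B₁ B₂ = D ∩ (fun g => mul (inv (σ g)) g) ⁻¹' B₂ := by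
    ext g
    constructor
    · intro hg
      obtain ⟨h, hh, e, hk⟩ := key g hg
      have hgD : g ∈ D := ⟨h, hh, e⟩
      refine ⟨hgD, ?_⟩
      obtain rfl : σ g = h := h₁.injOn_r (hσB g hgD) hh ((hσr g hgD).trans e.symm)
      exact hk
    · rintro ⟨hgD, hk⟩
      exact key' g (σ g) (hσB g hgD) (hσr g hgD) hk
  have hPo : IsOpen (setMul B₁ B₂) := by
    rw [hPD]
    exact huc.isOpen_inter_preimage hDo h₂.isOpen
  refine ⟨hPo, hinj, ?_⟩
  have := t2_of_injOn hinj
  have nz : ∀ g, conv f₁ f₂ g ≠ 0 → ∃ h ∈ K₁, r h = r g ∧ mul (inv h) g ∈ K₂ := by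
    intro g hg
    obtain ⟨h, hh, hne⟩ := exists_ne_zero_of_finsum_mem_ne_zero hg
    refine ⟨h, ?_, hh, ?_⟩
    · by_contra hn
      exact left_ne_zero_of_mul hne (hz₁ _ hn)
    · by_contra hn
      exact right_ne_zero_of_mul hne (hz₂ _ hn)
  refine mem_CcOn_iff.2 ⟨?_, (fun p : G × G => mul p.1 p.2) ''
    ((K₁ ×ˢ K₂) ∩ {p | src p.1 = rng p.2}), ?_, ?_, ?_⟩
  · have : Set.EqOn (conv f₁ f₂) (fun g => f₁ (σ g) * f₂ (mul (inv (σ g)) g))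
        (setMul B₁ B₂) := by
      intro g hg
      rw [hPD] at hg
      have hg1 := hg.1
      change ∑ᶠ h ∈ {h : G | r h = r g}, f₁ h * f₂ (mul (inv h) g) = _
      rw [finsum_eq_single _ (σ g)]
      · exact finsum_eq_single _ (hσr g hg1) (fun x hx => absurd rfl hx)
      · intro h hne
        by_contra hn
        obtain ⟨hh, -⟩ : ∃ _ : h ∈ {h : G | r h = r g}, f₁ h * f₂ (mul (inv h) g) ≠ 0 := by
          by_contra hcon
          push Not at hcon
          exact hn (by
            rw [finsum_congr hcon]
            exact finsum_zero)
        have hfh : f₁ h * f₂ (mul (inv h) g) ≠ 0 := fun h0 => hn (by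
          rw [finsum_congr fun _ => h0]
          exact finsum_zero)
        have hhB : h ∈ B₁ := by
          by_contra hb
          exact left_ne_zero_of_mul hfh (hz₁ _ fun hk => hb (hK₁B hk))
        exact hne (h₁.injOn_r hhB (hσB g hg1) ((show r h = r g from hh).trans (hσr g hg1).symm))
    refine ContinuousOn.congr ?_ this
    rw [hPD]
    refine ContinuousOn.mul ?_ ?_
    · exact hc₁.comp (hσc.mono Set.inter_subset_left) fun g hg => hσB g hg.1
    · exact hc₂.comp (huc.mono Set.inter_subset_left) fun g hg => hg.2
  · rintro _ ⟨⟨h, k⟩, ⟨⟨hh, hk⟩, e⟩, rfl⟩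
    exact ⟨h, hK₁B hh, k, hK₂B hk, e, rfl⟩
  · refine IsCompact.image_of_continuousOn ?_
      (IsLCEtaleGroupoid.continuousOn_mul.mono Set.inter_subset_right)
    refine (hK₁.prod hK₂).inter_right ?_
    have : {p : G × G | src p.1 = rng p.2} = {p : G × G | s p.1 = r p.2} := by
      ext p
      exact (Subtype.ext_iff (a1 := s p.1) (a2 := r p.2)).symm
    rw [this]
    exact isClosed_eq (continuous_s.comp continuous_fst) (continuous_r.comp continuous_snd)
  · intro g hg
    by_contra hn
    obtain ⟨h, hh, e, hk⟩ := nz g hn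
    refine hg ⟨(h, mul (inv h) g), ⟨⟨hh, hk⟩, ?_⟩, mul_inv_mul _ _ (r_eq_iff.1 e)⟩
    exact ((rng_mul _ _ ((src_inv h).trans (r_eq_iff.1 e))).trans (rng_inv h)).symm

theorem conv_mem_Cc {f₁ f₂ : G → ℂ} (h₁ : f₁ ∈ Cc (Set.univ : Set G))
    (h₂ : f₂ ∈ Cc (Set.univ : Set G)) : conv f₁ f₂ ∈ Cc (Set.univ : Set G) := by
  have h₁' := h₁
  have h₂' := h₂
  rw [Cc_eq_span] at h₁' h₂'
  induction h₁', h₂' using Submodule.span_induction₂ with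
  | mem_mem f₁ f₂ hf₁ hf₂ =>
    obtain ⟨B₁, hB₁, -, hf₁⟩ := hf₁
    obtain ⟨B₂, hB₂, -, hf₂⟩ := hf₂
    obtain ⟨ho, hi, hc⟩ := conv_mem_CcOn hB₁ hB₂ hf₁ hf₂
    have := t2_of_injOn hi
    exact CcOn_le_Cc (Set.subset_univ _) ho hc
  | zero_left f _ => rw [zero_conv]; exact Submodule.zero_mem _
  | zero_right f _ => rw [conv_zero]; exact Submodule.zero_mem _
  | add_left f f' k hf hf' hk i i' =>
    rw [← Cc_eq_span] at hf hf' hk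
    rw [add_conv (rFin_of_mem_Cc hf) (rFin_of_mem_Cc hf')]
    exact Submodule.add_mem _ (i hf hk) (i' hf' hk)
  | add_right f k k' hf hk hk' i i' =>
    rw [← Cc_eq_span] at hf hk hk'
    rw [conv_add (rFin_of_mem_Cc hf)]
    exact Submodule.add_mem _ (i hf hk) (i' hf hk')
  | smul_left c f k hf hk i =>
    rw [← Cc_eq_span] at hf hk
    rw [smul_conv]
    exact Submodule.smul_mem _ _ (i hf hk)
  | smul_right c f k hf hk i =>
    rw [← Cc_eq_span] at hf hk
    rw [conv_smul]
    exact Submodule.smul_mem _ _ (i hf hk)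

theorem IsOpenBisection.preimage_inv {B : Set G} (hB : IsOpenBisection B) :
    IsOpenBisection (inv ⁻¹' B : Set G) where
  isOpen := hB.isOpen.preimage continuous_inv'
  injOn_r g hg h hh e := by
    have : inv g = inv h := hB.injOn_s hg hh
      (s_eq_iff.2 (by rw [src_inv, src_inv]; exact r_eq_iff.1 e))
    rw [← inv_inv g, this, inv_inv]
  injOn_s g hg h hh e := by
    have : inv g = inv h := hB.injOn_r hg hh
      (r_eq_iff.2 (by rw [rng_inv, rng_inv]; exact s_eq_iff.1 e))
    rw [← inv_inv g, this, inv_inv]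

theorem invol_mem_CcOn {B : Set G} (hB : IsOpenBisection B) {f : G → ℂ} (hf : f ∈ CcOn B) :
    invol f ∈ CcOn (inv ⁻¹' B : Set G) := by
  have := hB.t2
  have := hB.preimage_inv.t2
  obtain ⟨hc, K, hKB, hK, h0⟩ := mem_CcOn_iff.1 hf
  refine mem_CcOn_iff.2 ⟨?_, inv '' K, ?_, hK.image continuous_inv', ?_⟩
  · exact continuous_star.comp_continuousOn (hc.comp continuous_inv'.continuousOn fun g hg => hg)
  · rintro _ ⟨k, hk, rfl⟩
    rw [Set.mem_preimage, inv_inv]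
    exact hKB hk
  · intro g hg
    rw [invol, h0 (inv g) fun h => hg ⟨inv g, h, inv_inv g⟩, star_zero]

theorem invol_add (f₁ f₂ : G → ℂ) : invol (f₁ + f₂) = invol f₁ + invol f₂ := by
  funext g
  simp [invol]

theorem invol_smul (c : ℂ) (f : G → ℂ) : invol (c • f) = star c • invol f := by
  funext g
  simp [invol]

theorem invol_mem_Cc {f : G → ℂ} (h : f ∈ Cc (Set.univ : Set G)) :
    invol f ∈ Cc (Set.univ : Set G) := by
  rw [Cc_eq_span] at h
  induction h using Submodule.span_induction with
  | mem f h =>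
    obtain ⟨B, hB, -, hf⟩ := h
    have := hB.preimage_inv.t2
    exact CcOn_le_Cc (Set.subset_univ _) hB.preimage_inv.isOpen (invol_mem_CcOn hB hf)
  | zero =>
    have : invol (0 : G → ℂ) = 0 := by
      funext g
      simp [invol]
    rw [this]
    exact Submodule.zero_mem _
  | add f₁ f₂ _ _ h₁ h₂ => rw [invol_add]; exact Submodule.add_mem _ h₁ h₂
  | smul c f _ h => rw [invol_smul]; exact Submodule.smul_mem _ _ h

end Etale

/-! ### The *-algebra `C_c(G)` and the full groupoid C*-algebra -/

section ConvolutionAlgebra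

variable (G : Type*) [TopologicalSpace G] [ArrowGroupoid G]

/-- The space `C_c(G)`, regarded as a *-algebra with the convolution product. -/
def CcAlg : Type _ := ↥(Cc (Set.univ : Set G))

instance : AddCommGroup (CcAlg G) := inferInstanceAs (AddCommGroup ↥(Cc (Set.univ : Set G)))
instance : Module ℂ (CcAlg G) := inferInstanceAs (Module ℂ ↥(Cc (Set.univ : Set G)))

variable {G}

/-- The function on `G` underlying an element of `C_c(G)`. -/
def CcAlg.fn (f : CcAlg G) : G → ℂ := f.1

theorem CcAlg.fn_mem (f : CcAlg G) : f.fn ∈ Cc (Set.univ : Set G) := f.2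

theorem CcAlg.ext {f₁ f₂ : CcAlg G} (h : f₁.fn = f₂.fn) : f₁ = f₂ := Subtype.ext h

/-- A function in `C_c(G)` as an element of the *-algebra. -/
def CcAlg.mk (f : G → ℂ) (h : f ∈ Cc (Set.univ : Set G)) : CcAlg G := ⟨f, h⟩

theorem CcAlg.fn_mk (f : G → ℂ) (h : f ∈ Cc (Set.univ : Set G)) : (CcAlg.mk f h).fn = f := rfl

theorem CcAlg.fn_add (f₁ f₂ : CcAlg G) : (f₁ + f₂).fn = f₁.fn + f₂.fn := rfl

theorem CcAlg.fn_zero : (0 : CcAlg G).fn = 0 := rfl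

theorem CcAlg.fn_smul (c : ℂ) (f : CcAlg G) : (c • f).fn = c • f.fn := rfl

variable [IsLCEtaleGroupoid G]

instance : Mul (CcAlg G) := ⟨fun f₁ f₂ => .mk (conv f₁.fn f₂.fn) (conv_mem_Cc f₁.fn_mem f₂.fn_mem)⟩

instance : Star (CcAlg G) := ⟨fun f => .mk (invol f.fn) (invol_mem_Cc f.fn_mem)⟩

theorem CcAlg.fn_mul (f₁ f₂ : CcAlg G) : (f₁ * f₂).fn = conv f₁.fn f₂.fn := rfl

theorem CcAlg.fn_star (f : CcAlg G) : (star f).fn = invol f.fn := rfl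

theorem CcAlg.rFin (f : CcAlg G) : RFin f.fn := rFin_of_mem_Cc f.fn_mem

instance : NonUnitalRing (CcAlg G) :=
  { (inferInstance : AddCommGroup (CcAlg G)), (inferInstance : Mul (CcAlg G)) with
    zero_mul := fun f => CcAlg.ext (zero_conv f.fn)
    mul_zero := fun f => CcAlg.ext (conv_zero f.fn)
    mul_assoc := fun f₁ f₂ _ => CcAlg.ext (conv_assoc f₁.rFin f₂.rFin)
    left_distrib := fun f₁ _ _ => CcAlg.ext (conv_add f₁.rFin)
    right_distrib := fun f₁ f₂ _ => CcAlg.ext (add_conv f₁.rFin f₂.rFin) }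

instance : IsScalarTower ℂ (CcAlg G) (CcAlg G) :=
  ⟨fun c f₁ f₂ => CcAlg.ext (smul_conv c f₁.fn f₂.fn)⟩

instance : SMulCommClass ℂ (CcAlg G) (CcAlg G) :=
  ⟨fun c f₁ f₂ => CcAlg.ext (conv_smul c f₁.fn f₂.fn).symm⟩

instance : StarRing (CcAlg G) where
  star_involutive f := CcAlg.ext (invol_invol f.fn)
  star_mul f₁ f₂ := CcAlg.ext (invol_conv f₁.fn f₂.fn)
  star_add f₁ f₂ := CcAlg.ext (invol_add f₁.fn f₂.fn)

instance : StarModule ℂ (CcAlg G) := ⟨fun c f => CcAlg.ext (invol_smul c f.fn)⟩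

end ConvolutionAlgebra

end ArrowGroupoid

/-! ### Extension of *-homomorphisms from `C_c(Y)` to `C₀(Y)` -/

section CZero

variable {Y : Type*} [TopologicalSpace Y] [T2Space Y]

/-- The inclusion of `C_c(Y)` into `C₀(Y)`. -/
def ccToCZero : C_c(Y, ℂ) →⋆ₙₐ[ℂ] C₀(Y, ℂ) where
  toFun f :=
    { toFun := f
      continuous_toFun := f.continuous
      zero_at_infty' := f.hasCompactSupport.is_zero_at_infty }
  map_smul' _ _ := rfl
  map_zero' := rfl
  map_add' _ _ := rfl
  map_mul' _ _ := rfl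
  map_star' _ := rfl

theorem ccToCZero_apply (f : C_c(Y, ℂ)) (y : Y) : ccToCZero f y = f y := rfl

theorem norm_le_of_bound (f : C₀(Y, ℂ)) {M : ℝ} (hM : 0 ≤ M) (h : ∀ y, ‖f y‖ ≤ M) : ‖f‖ ≤ M := by
  rw [← ZeroAtInftyContinuousMap.norm_toBCF_eq_norm]
  exact (BoundedContinuousFunction.norm_le hM).2 h

theorem norm_apply_le_norm (f : C₀(Y, ℂ)) (y : Y) : ‖f y‖ ≤ ‖f‖ := by
  rw [← ZeroAtInftyContinuousMap.norm_toBCF_eq_norm]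
  exact f.toBCF.norm_coe_le_norm y

/-- The C*-algebra of functions in `C₀(Y)` vanishing off `K`. -/
def supportedIn (K : Set Y) : NonUnitalStarSubalgebra ℂ C₀(Y, ℂ) where
  carrier := {f | ∀ y, y ∉ K → f y = 0}
  add_mem' {f g} hf hg y hy := by
    rw [ZeroAtInftyContinuousMap.add_apply, hf y hy, hg y hy, add_zero]
  zero_mem' _ _ := rfl
  mul_mem' {f g} hf hg y hy := by
    rw [ZeroAtInftyContinuousMap.mul_apply, hf y hy, zero_mul]
  smul_mem' c f hf y hy := by
    rw [ZeroAtInftyContinuousMap.smul_apply, hf y hy, smul_zero]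
  star_mem' {f} hf y hy := by
    change star (f y) = 0
    rw [hf y hy, star_zero]

theorem isClosed_supportedIn (K : Set Y) : IsClosed (supportedIn K : Set C₀(Y, ℂ)) := by
  have h : (supportedIn K : Set C₀(Y, ℂ)) = ⋂ y ∈ Kᶜ, {f : C₀(Y, ℂ) | f y = 0} := by
    ext f
    simp only [Set.mem_iInter]
    rfl
  rw [h]
  refine isClosed_biInter fun y _ => isClosed_eq ?_ continuous_const
  have h2 : LipschitzWith 1 fun f : C₀(Y, ℂ) => f y := by
    refine LipschitzWith.of_dist_le_mul fun f g => ?_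
    rw [NNReal.coe_one, one_mul, dist_eq_norm, dist_eq_norm]
    exact norm_apply_le_norm (f - g) y
  exact h2.continuous

/-- The functions in `C₀(Y)` vanishing off a compact set as elements of `C_c(Y)`. -/
def supportedInToCc (K : Set Y) (hK : IsCompact K) : supportedIn K →⋆ₙₐ[ℂ] C_c(Y, ℂ) where
  toFun f := ⟨f.1.toContinuousMap, HasCompactSupport.intro hK fun y hy => f.2 y hy⟩
  map_smul' _ _ := rfl
  map_zero' := rfl
  map_add' _ _ := rfl
  map_mul' _ _ := rfl
  map_star' _ := rfl

theorem CStarSeminorm.le_of_bound (q : CStarSeminorm C_c(Y, ℂ)) (f : C_c(Y, ℂ)) {M : ℝ}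
    (hM : 0 ≤ M) (h : ∀ y, ‖f y‖ ≤ M) : q f ≤ M := by
  have hcl : IsClosed (supportedIn (tsupport f) : Set C₀(Y, ℂ)) := isClosed_supportedIn _
  let θ := q.toCompl.comp (supportedInToCc (tsupport f) f.hasCompactSupport)
  let f' : supportedIn (tsupport f) :=
    ⟨ccToCZero f, fun y hy => image_eq_zero_of_notMem_tsupport hy⟩
  have h1 : ‖θ f'‖ ≤ ‖f'‖ := NonUnitalStarAlgHom.norm_apply_le θ f'
  have h2 : ‖θ f'‖ = q f := q.norm_toCompl f
  rw [← h2]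
  exact h1.trans (norm_le_of_bound (ccToCZero f) hM h)

theorem denseRange_ccToCZero [LocallyCompactSpace Y] :
    DenseRange (ccToCZero : C_c(Y, ℂ) → C₀(Y, ℂ)) := by
  intro f
  rw [Metric.mem_closure_range_iff]
  intro ε hε
  have hz := f.zero_at_infty'
  have h1 : ∀ᶠ y in Filter.cocompact Y, ‖f y‖ < ε / 2 := by
    have h2 := hz.eventually (Metric.ball_mem_nhds (0 : ℂ) (half_pos hε))
    filter_upwards [h2] with y hy
    simpa using hy
  obtain ⟨K, hK, hKf⟩ := Filter.mem_cocompact.1 h1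
  obtain ⟨χ, hχ1, -, hχc, hχ01⟩ := exists_continuous_one_zero_of_isCompact hK isClosed_empty
    (Set.disjoint_empty K)
  let g : C_c(Y, ℂ) := ⟨⟨fun y => (χ y : ℂ) * f y,
    (Complex.continuous_ofReal.comp χ.continuous).mul f.continuous⟩, by
      refine hχc.mono ?_
      intro y hy
      have : (χ y : ℂ) ≠ 0 := left_ne_zero_of_mul hy
      exact fun h0 => this (by rw [h0, Complex.ofReal_zero])⟩
  refine ⟨g, ?_⟩
  rw [dist_eq_norm]
  refine lt_of_le_of_lt (norm_le_of_bound _ (half_pos hε).le fun y => ?_) (half_lt_self hε)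
  change ‖f y - (χ y : ℂ) * f y‖ ≤ ε / 2
  by_cases hy : y ∈ K
  · rw [hχ1 hy]
    simpa using (half_pos hε).le
  · have h3 : ‖f y‖ < ε / 2 := hKf hy
    have h4 : f y - (χ y : ℂ) * f y = ((1 - χ y : ℝ) : ℂ) * f y := by
      push_cast
      ring
    rw [h4, norm_mul, Complex.norm_real, Real.norm_of_nonneg (by linarith [(hχ01 y).2])]
    nlinarith [(hχ01 y).1, norm_nonneg (f y)]

variable {B : Type*} [NonUnitalCStarAlgebra B] [LocallyCompactSpace Y]

theorem norm_le_ccToCZero (φ : C_c(Y, ℂ) →⋆ₙₐ[ℂ] B) (f : C_c(Y, ℂ)) :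
    ‖φ f‖ ≤ ‖ccToCZero f‖ :=
  CStarSeminorm.le_of_bound ((CStarSeminorm.ofNorm B).comap φ) f (norm_nonneg _)
    fun y => norm_apply_le_norm (ccToCZero f) y

/-- The continuous linear extension to `C₀(Y)` of a *-homomorphism on `C_c(Y)`. -/
def extendCZeroL (φ : C_c(Y, ℂ) →⋆ₙₐ[ℂ] B) : C₀(Y, ℂ) →L[ℂ] B :=
  LinearMap.extendOfNorm (φ : C_c(Y, ℂ) →ₗ[ℂ] B)
    ((ccToCZero : C_c(Y, ℂ) →⋆ₙₐ[ℂ] C₀(Y, ℂ)) : C_c(Y, ℂ) →ₗ[ℂ] _)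

theorem extendCZeroL_apply (φ : C_c(Y, ℂ) →⋆ₙₐ[ℂ] B) (f : C_c(Y, ℂ)) :
    extendCZeroL φ (ccToCZero f) = φ f :=
  LinearMap.extendOfNorm_eq denseRange_ccToCZero
    ⟨1, fun x => by rw [one_mul]; exact norm_le_ccToCZero φ x⟩ f

/-- The extension to `C₀(Y)` of a *-homomorphism from `C_c(Y)` to a C*-algebra. -/
def extendCZero (φ : C_c(Y, ℂ) →⋆ₙₐ[ℂ] B) : C₀(Y, ℂ) →⋆ₙₐ[ℂ] B :=
  { extendCZeroL φ with
    map_smul' := fun c a => (extendCZeroL φ).map_smul c a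
    map_zero' := (extendCZeroL φ).map_zero
    map_mul' := fun a b => by
      change extendCZeroL φ (a * b) = extendCZeroL φ a * extendCZeroL φ b
      refine denseRange_ccToCZero.induction_on₂
        (isClosed_eq (by fun_prop) (by fun_prop)) (fun a b => ?_) a b
      rw [← map_mul, extendCZeroL_apply, extendCZeroL_apply, extendCZeroL_apply, map_mul]
    map_star' := fun a => by
      change extendCZeroL φ (star a) = star (extendCZeroL φ a)
      refine denseRange_ccToCZero.induction_on
        (p := fun a => extendCZeroL φ (star a) = star (extendCZeroL φ a)) a
        (isClosed_eq (by fun_prop) (by fun_prop)) (fun a => ?_)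
      rw [← map_star, extendCZeroL_apply, extendCZeroL_apply, map_star] }

theorem extendCZero_apply (φ : C_c(Y, ℂ) →⋆ₙₐ[ℂ] B) (f : C_c(Y, ℂ)) :
    extendCZero φ (ccToCZero f) = φ f := extendCZeroL_apply φ f

end CZero

namespace ArrowGroupoid

section FullCStar

variable {G : Type*} [TopologicalSpace G] [ArrowGroupoid G] [IsLCEtaleGroupoid G]

/-- The unit space as a subset of the set of arrows. -/
def units (G : Type*) [ArrowGroupoid G] : Set G := {x | src x = x}

theorem isOpen_units : IsOpen (units G) := by
  rw [isOpen_iff_mem_nhds]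
  intro x hx
  obtain ⟨B, hxB, -, -, hB⟩ := exists_bisection (isOpen_univ (X := G)) (Set.mem_univ x)
  have h1 : IsOpen ((fun g : G => ((s g : UnitSpace G) : G)) ⁻¹' B) :=
    hB.isOpen.preimage (continuous_subtype_val.comp continuous_s)
  have hx1 : src x ∈ B := by rw [show src x = x from hx]; exact hxB
  refine Filter.mem_of_superset ((hB.isOpen.inter h1).mem_nhds ⟨hxB, hx1⟩) ?_
  rintro g ⟨hg, hg1⟩
  exact hB.injOn_s hg1 hg (s_eq_iff.2 (src_src g))

instance t2_unitsSet : T2Space (units G) := inferInstanceAs (T2Space (UnitSpace G))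

/-- Extension by zero of a function on the unit space. -/
def extendUnits (φ : UnitSpace G → ℂ) : G → ℂ := Function.extend (Subtype.val : UnitSpace G → G) φ 0

theorem extendUnits_coe (φ : UnitSpace G → ℂ) (x : UnitSpace G) : extendUnits φ (x : G) = φ x :=
  Subtype.val_injective.extend_apply φ 0 x

theorem extendUnits_of_not (φ : UnitSpace G → ℂ) {g : G} (hg : src g ≠ g) :
    extendUnits φ g = 0 := by
  refine (Function.extend_apply' _ _ _ ?_).trans rfl
  rintro ⟨x, rfl⟩
  exact hg x.2

theorem extendUnits_mem_CcOn (φ : C_c(UnitSpace G, ℂ)) : extendUnits φ ∈ CcOn (units G) := ⟨φ, rfl⟩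

theorem inv_unit (x : UnitSpace G) : inv (x : G) = x := by
  have h := mul_inv (x : G)
  have h1 := rng_mul_self (inv (x : G))
  rw [rng_inv, x.2, h, rng_unit] at h1
  exact h1.symm

theorem inv_eq_unit {g : G} (h : src (inv g) = inv g) : src g = g := by
  have := inv_unit (⟨inv g, h⟩ : UnitSpace G)
  rw [inv_inv] at this
  rw [show g = inv g from this]
  exact h

theorem conv_extendUnits (φ ψ : UnitSpace G → ℂ) :
    conv (extendUnits φ) (extendUnits ψ) = extendUnits (φ * ψ) := by
  funext g
  have h1 : conv (extendUnits φ) (extendUnits ψ) g = φ (r g) * extendUnits ψ g := by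
    rw [conv, finsum_eq_single _ ((r g : UnitSpace G) : G)]
    · refine (finsum_eq_single _ (show ((r g : UnitSpace G) : G) ∈ {h : G | r h = r g} from
        r_unit (r g)) (fun x hx => absurd rfl hx)).trans ?_
      rw [extendUnits_coe, inv_unit]
      congr 2
      exact rng_mul_self g
    · intro h hne
      by_cases hu : src h = h
      · have hr : r h ≠ r g := fun e => hne (by rw [← e]; exact (rng_unit ⟨h, hu⟩).symm)
        exact (finsum_congr (g := fun _ => (0 : ℂ)) fun (e : r h = r g) => absurd e hr).trans
          finsum_zero
      · simp only [extendUnits_of_not φ hu, zero_mul]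
        exact finsum_zero
  rw [h1]
  by_cases hu : src g = g
  · have e : r g = ⟨g, hu⟩ := r_unit ⟨g, hu⟩
    rw [e, show extendUnits ψ g = ψ ⟨g, hu⟩ from extendUnits_coe ψ ⟨g, hu⟩,
      show extendUnits (φ * ψ) g = (φ * ψ) ⟨g, hu⟩ from extendUnits_coe (φ * ψ) ⟨g, hu⟩]
    rfl
  · rw [extendUnits_of_not _ hu, extendUnits_of_not _ hu, mul_zero]

theorem invol_extendUnits (φ : UnitSpace G → ℂ) :
    invol (extendUnits φ) = extendUnits (star φ) := by
  funext g
  by_cases hu : src g = g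
  · have h1 : inv g = g := inv_unit ⟨g, hu⟩
    rw [invol, h1, show extendUnits φ g = φ ⟨g, hu⟩ from extendUnits_coe φ ⟨g, hu⟩,
      show extendUnits (star φ) g = (star φ) ⟨g, hu⟩ from extendUnits_coe (star φ) ⟨g, hu⟩]
    rfl
  · rw [extendUnits_of_not _ hu, invol, extendUnits_of_not _ fun h => hu (inv_eq_unit h), star_zero]

theorem extendUnits_add (φ ψ : UnitSpace G → ℂ) :
    extendUnits (φ + ψ) = extendUnits φ + extendUnits ψ := by
  funext g
  by_cases hu : src g = g
  · exact (extendUnits_coe _ ⟨g, hu⟩).trans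
      (congrArg₂ (· + ·) (extendUnits_coe φ ⟨g, hu⟩) (extendUnits_coe ψ ⟨g, hu⟩)).symm
  · rw [Pi.add_apply, extendUnits_of_not _ hu, extendUnits_of_not _ hu, extendUnits_of_not _ hu,
      add_zero]

theorem extendUnits_smul (c : ℂ) (φ : UnitSpace G → ℂ) :
    extendUnits (c • φ) = c • extendUnits φ := by
  funext g
  by_cases hu : src g = g
  · exact (extendUnits_coe _ ⟨g, hu⟩).trans
      (congrArg (c • ·) (extendUnits_coe φ ⟨g, hu⟩)).symm
  · rw [Pi.smul_apply, extendUnits_of_not _ hu, extendUnits_of_not _ hu, smul_zero]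

/-- The inclusion of `C_c(G⁰)`, with the pointwise operations, into `C_c(G)`, by extension
by zero. -/
def unitsHom : C_c(UnitSpace G, ℂ) →⋆ₙₐ[ℂ] CcAlg G where
  toFun φ := .mk (extendUnits φ)
    (CcOn_le_Cc (Set.subset_univ _) isOpen_units (extendUnits_mem_CcOn φ))
  map_smul' c φ := CcAlg.ext (extendUnits_smul c φ)
  map_zero' := CcAlg.ext (by
    have := extendUnits_smul (G := G) 0 0
    rw [zero_smul, zero_smul] at this
    exact this)
  map_add' φ ψ := CcAlg.ext (extendUnits_add φ ψ)
  map_mul' φ ψ := CcAlg.ext (conv_extendUnits φ ψ).symm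
  map_star' φ := CcAlg.ext (invol_extendUnits φ).symm

theorem fn_unitsHom (φ : C_c(UnitSpace G, ℂ)) : (unitsHom φ).fn = extendUnits φ := rfl

theorem CcOn_mono {V V' : Set G} (hVV : V ⊆ V') (hV : IsOpen V) [T2Space V'] :
    CcOn V ⊆ CcOn V' := by
  intro f hf
  have : T2Space V := T2Space.of_injective_continuous
    (f := Set.inclusion hVV) (Set.inclusion_injective hVV) (continuous_inclusion hVV)
  obtain ⟨hc, K, hKV, hK, h0⟩ := mem_CcOn_iff.1 hf
  refine mem_CcOn_iff.2 ⟨?_, K, hKV.trans hVV, hK, h0⟩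
  have hKc : IsClosed (Subtype.val ⁻¹' K : Set V') := by
    refine IsCompact.isClosed ?_
    rw [Subtype.isCompact_iff, Subtype.image_preimage_coe, Set.inter_eq_right.2 (hKV.trans hVV)]
    exact hK
  intro x hx
  by_cases hxV : x ∈ V
  · exact (hc.continuousAt (hV.mem_nhds hxV)).continuousWithinAt
  · have hev : ∀ᶠ g in nhdsWithin x V', f g = 0 := by
      have h1 : (Subtype.val ⁻¹' K : Set V')ᶜ ∈ nhds (⟨x, hx⟩ : V') :=
        hKc.isOpen_compl.mem_nhds fun h => hxV (hKV h)
      rw [nhds_subtype_eq_comap, Filter.mem_comap] at h1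
      obtain ⟨O, hO, hOK⟩ := h1
      refine Filter.mem_of_superset
        (Filter.inter_mem (mem_nhdsWithin_of_mem_nhds hO) self_mem_nhdsWithin) ?_
      rintro g ⟨hgO, hgV⟩
      exact h0 g fun hgK => hOK (a := ⟨g, hgV⟩) hgO hgK
    refine ContinuousWithinAt.congr_of_eventuallyEq (f := fun _ => (0 : ℂ))
      continuousWithinAt_const hev ?_
    exact h0 x fun h => hxV (hKV h)

theorem star_mul_self_mem {B : Set G} (hB : IsOpenBisection B) {f : G → ℂ} (hf : f ∈ CcOn B) :
    conv (invol f) f ∈ CcOn (units G) := by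
  obtain ⟨ho, -, hc⟩ := conv_mem_CcOn hB.preimage_inv hB (invol_mem_CcOn hB hf) hf
  refine CcOn_mono ?_ ho hc
  rintro _ ⟨h, hh, k, hk, e, rfl⟩
  have h1 : k = inv h := hB.injOn_r hk hh (r_eq_iff.2 (by rw [rng_inv, e]))
  change src (mul h k) = mul h k
  rw [h1, mul_inv, src_rng]

/-- The supremum of all C*-seminorms on `C_c(G)` is finite. -/
instance : HasEnveloping (CcAlg G) where
  bdd f := by
    suffices h : ∀ (f : G → ℂ), f ∈ Cc (Set.univ : Set G) →
        ∃ C : ℝ, ∀ (hf : f ∈ Cc (Set.univ : Set G)) (p : CStarSeminorm (CcAlg G)),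
          p (CcAlg.mk f hf) ≤ C by
      obtain ⟨C, hC⟩ := h f.fn f.fn_mem
      exact ⟨C, by rintro _ ⟨p, rfl⟩; exact hC f.fn_mem p⟩
    intro f hf
    have hf' := hf
    rw [Cc_eq_span] at hf'
    induction hf' using Submodule.span_induction with
    | mem f h =>
      obtain ⟨B, hB, -, hfB⟩ := h
      obtain ⟨φ, hφ⟩ := star_mul_self_mem hB hfB
      let φ' : C_c(UnitSpace G, ℂ) := φ
      refine ⟨‖ccToCZero φ'‖ + 1, fun hf p => ?_⟩
      have h1 : star (CcAlg.mk f hf) * CcAlg.mk f hf = unitsHom φ' := CcAlg.ext hφ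
      have h2 : p (unitsHom φ') ≤ ‖ccToCZero φ'‖ :=
        (p.comap unitsHom).le_of_bound φ' (norm_nonneg _) fun y => norm_apply_le_norm (ccToCZero φ') y
      have h3 := p.star_mul_self (CcAlg.mk f hf)
      rw [h1] at h3
      nlinarith [p.nonneg (CcAlg.mk f hf), norm_nonneg (ccToCZero φ')]
    | zero => exact ⟨0, fun hf p => (map_zero p.toSeminorm).le⟩
    | add f₁ f₂ h₁ h₂ i₁ i₂ =>
      rw [← Cc_eq_span] at h₁ h₂
      obtain ⟨C₁, hC₁⟩ := i₁ h₁
      obtain ⟨C₂, hC₂⟩ := i₂ h₂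
      exact ⟨C₁ + C₂, fun _ p => (map_add_le_add p.toSeminorm (CcAlg.mk f₁ h₁)
        (CcAlg.mk f₂ h₂)).trans (add_le_add (hC₁ h₁ p) (hC₂ h₂ p))⟩
    | smul c f h i =>
      rw [← Cc_eq_span] at h
      obtain ⟨C, hC⟩ := i h
      exact ⟨‖c‖ * C, fun _ p => (map_smul_eq_mul p.toSeminorm c (CcAlg.mk f h)).le.trans
        (mul_le_mul_of_nonneg_left (hC h p) (norm_nonneg c))⟩

/-- The full groupoid C*-algebra: the enveloping C*-algebra of `C_c(G)`. -/
abbrev FullCStar (G : Type*) [TopologicalSpace G] [ArrowGroupoid G] [IsLCEtaleGroupoid G] :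
    Type _ := EnvelopingCStar (CcAlg G)

/-- The canonical *-homomorphism `C_c(G) → C*(G)`. -/
abbrev ofCc : CcAlg G →⋆ₙₐ[ℂ] FullCStar G := EnvelopingCStar.ofAlg

/-- The inclusion `C₀(G⁰) → C*(G)`, extending the inclusion of `C_c(G⁰)` into `C_c(G)`. -/
def ofCZeroUnits : C₀(UnitSpace G, ℂ) →⋆ₙₐ[ℂ] FullCStar G := extendCZero (ofCc.comp unitsHom)

end FullCStar

end ArrowGroupoid

/-! ### Reductions of a groupoid to invariant sets of units -/

namespace ArrowGroupoid

section Reduction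

/-- A set `X` of units is invariant if `r g ∈ X` is equivalent to `s g ∈ X`, for all arrows `g`. -/
def IsInvariant {G : Type*} [ArrowGroupoid G] (X : Set (UnitSpace G)) : Prop :=
  ∀ g : G, r g ∈ X ↔ s g ∈ X

theorem IsInvariant.compl {G : Type*} [ArrowGroupoid G] {X : Set (UnitSpace G)}
    (hX : IsInvariant X) : IsInvariant Xᶜ := fun g => not_congr (hX g)

/-- The reduction `G_X = r⁻¹(X) = s⁻¹(X)` of `G` to a locally closed invariant set `X` of units. -/
def Reduction {G : Type*} [TopologicalSpace G] [ArrowGroupoid G] (X : Set (UnitSpace G))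
    (_hX : IsInvariant X) (_hl : IsLocallyClosed X) : Type _ := {g : G // r g ∈ X}

variable {G : Type*} [TopologicalSpace G] [ArrowGroupoid G] {X : Set (UnitSpace G)}
  (hX : IsInvariant X) (hl : IsLocallyClosed X)

namespace Reduction

/-- The inclusion of the reduction `G_X` into `G`. -/
def val (g : Reduction X hX hl) : G := g.1

theorem r_val_mem (g : Reduction X hX hl) : r (val hX hl g) ∈ X := g.2

theorem val_injective : Function.Injective (val hX hl) := Subtype.val_injective

/-- The relative topology. -/
instance : TopologicalSpace (Reduction X hX hl) :=
  inferInstanceAs (TopologicalSpace {g : G // r g ∈ X})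

theorem isEmbedding_val : Topology.IsEmbedding (val hX hl) := Topology.IsEmbedding.subtypeVal

theorem continuous_val : Continuous (val hX hl) := (isEmbedding_val hX hl).continuous

/-- An arrow with range in `X` as an element of the reduction. -/
def mk (g : G) (hg : r g ∈ X) : Reduction X hX hl := ⟨g, hg⟩

theorem val_mk (g : G) (hg : r g ∈ X) : val hX hl (mk hX hl g hg) = g := rfl

theorem ext_val {g h : Reduction X hX hl} (e : val hX hl g = val hX hl h) : g = h :=
  val_injective hX hl e

theorem r_src_mem (hX : IsInvariant X) {g : G} (hg : r g ∈ X) : r (src g) ∈ X := by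
  rw [show r (src g) = s g from Subtype.ext (rng_src g)]
  exact (hX g).1 hg

theorem r_rng_mem {g : G} (hg : r g ∈ X) : r (rng g) ∈ X := by
  rw [show r (rng g) = r g from Subtype.ext (rng_rng g)]
  exact hg

theorem r_inv_mem (hX : IsInvariant X) {g : G} (hg : r g ∈ X) : r (inv g) ∈ X := by
  rw [show r (inv g) = s g from Subtype.ext (rng_inv g)]
  exact (hX g).1 hg

theorem r_mul_mem {g h : G} (e : src g = rng h) (hg : r g ∈ X) : r (mul g h) ∈ X := by
  rw [show r (mul g h) = r g from Subtype.ext (rng_mul _ _ e)]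
  exact hg

open Classical in
/-- The restricted product, defined arbitrarily for non-composable arrows. -/
def mulAux (g h : Reduction X hX hl) : Reduction X hX hl :=
  if e : src (val hX hl g) = rng (val hX hl h) then
    mk hX hl (mul (val hX hl g) (val hX hl h)) (r_mul_mem e (r_val_mem hX hl g))
  else g

theorem val_mulAux (g h : Reduction X hX hl) (e : src (val hX hl g) = rng (val hX hl h)) :
    val hX hl (mulAux hX hl g h) = mul (val hX hl g) (val hX hl h) := by
  rw [mulAux, dif_pos e, val_mk]

/-- The reduction with the restricted groupoid operations. -/
instance : ArrowGroupoid (Reduction X hX hl) where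
  src g := mk hX hl (src (val hX hl g)) (r_src_mem hX (r_val_mem hX hl g))
  rng g := mk hX hl (rng (val hX hl g)) (r_rng_mem (r_val_mem hX hl g))
  mul g h := mulAux hX hl g h
  inv g := mk hX hl (inv (val hX hl g)) (r_inv_mem hX (r_val_mem hX hl g))
  src_src g := ext_val hX hl (src_src (val hX hl g))
  rng_src g := ext_val hX hl (rng_src (val hX hl g))
  src_rng g := ext_val hX hl (src_rng (val hX hl g))
  rng_rng g := ext_val hX hl (rng_rng (val hX hl g))
  src_mul g h e := by
    have e' : src (val hX hl g) = rng (val hX hl h) := congrArg (val hX hl) e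
    refine ext_val hX hl ?_
    rw [val_mk, val_mk, val_mulAux hX hl _ _ e']
    exact src_mul _ _ e'
  rng_mul g h e := by
    have e' : src (val hX hl g) = rng (val hX hl h) := congrArg (val hX hl) e
    refine ext_val hX hl ?_
    rw [val_mk, val_mk, val_mulAux hX hl _ _ e']
    exact rng_mul _ _ e'
  mul_assoc g h k e₁ e₂ := by
    have e₁' : src (val hX hl g) = rng (val hX hl h) := congrArg (val hX hl) e₁
    have e₂' : src (val hX hl h) = rng (val hX hl k) := congrArg (val hX hl) e₂
    have h₁ := val_mulAux hX hl _ _ e₁'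
    have h₂ := val_mulAux hX hl _ _ e₂'
    refine ext_val hX hl ?_
    rw [val_mulAux hX hl (mulAux hX hl g h) k (by rw [h₁, src_mul _ _ e₁', e₂']),
      val_mulAux hX hl g (mulAux hX hl h k) (by rw [h₂, rng_mul _ _ e₂', e₁']), h₁, h₂]
    exact mul_assoc _ _ _ e₁' e₂'
  rng_mul_self g := by
    refine ext_val hX hl ?_
    rw [val_mulAux hX hl _ _ (src_rng _), val_mk]
    exact rng_mul_self _
  mul_src_self g := by
    refine ext_val hX hl ?_
    rw [val_mulAux hX hl _ _ (rng_src _).symm, val_mk]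
    exact mul_src_self _
  src_inv g := ext_val hX hl (src_inv (val hX hl g))
  rng_inv g := ext_val hX hl (rng_inv (val hX hl g))
  inv_mul g := by
    refine ext_val hX hl ?_
    rw [val_mulAux hX hl _ _ (src_inv _), val_mk, val_mk]
    exact inv_mul _
  mul_inv g := by
    refine ext_val hX hl ?_
    rw [val_mulAux hX hl _ _ (rng_inv _).symm, val_mk, val_mk]
    exact mul_inv _

theorem val_src (g : Reduction X hX hl) : val hX hl (src g) = src (val hX hl g) := rfl
theorem val_rng (g : Reduction X hX hl) : val hX hl (rng g) = rng (val hX hl g) := rfl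
theorem val_inv (g : Reduction X hX hl) : val hX hl (inv g) = inv (val hX hl g) := rfl

theorem val_mul (g h : Reduction X hX hl) (e : src (val hX hl g) = rng (val hX hl h)) :
    val hX hl (mul g h) = mul (val hX hl g) (val hX hl h) := val_mulAux hX hl g h e

theorem r_val_iff (g h : Reduction X hX hl) :
    r g = r h ↔ r (val hX hl g) = r (val hX hl h) := by
  rw [r_eq_iff, r_eq_iff, ← val_rng, ← val_rng]
  exact (val_injective hX hl).eq_iff.symm

theorem s_val_iff (g h : Reduction X hX hl) :
    s g = s h ↔ s (val hX hl g) = s (val hX hl h) := by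
  rw [s_eq_iff, s_eq_iff, ← val_src, ← val_src]
  exact (val_injective hX hl).eq_iff.symm

/-- The inclusion of the unit spaces. -/
def unitVal (x : UnitSpace (Reduction X hX hl)) : UnitSpace G :=
  ⟨val hX hl x.1, congrArg (val hX hl) x.2⟩

theorem isEmbedding_unitVal : Topology.IsEmbedding (unitVal hX hl) := by
  have h1 : Topology.IsEmbedding (fun x : UnitSpace (Reduction X hX hl) => val hX hl x.1) :=
    (isEmbedding_val hX hl).comp Topology.IsEmbedding.subtypeVal
  exact Topology.IsEmbedding.of_comp
    (continuous_induced_rng.2 h1.continuous) continuous_subtype_val h1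

theorem range_unitVal : Set.range (unitVal hX hl) = X := by
  ext x
  constructor
  · rintro ⟨y, rfl⟩
    have := r_val_mem hX hl y.1
    rwa [show r (val hX hl y.1) = unitVal hX hl y from r_unit (unitVal hX hl y)] at this
  · intro hx
    refine ⟨⟨mk hX hl x.1 (by rw [r_unit]; exact hx), ext_val hX hl x.2⟩, rfl⟩

variable [IsLCEtaleGroupoid G]

theorem isLocalHomeomorph_aux (t : G → UnitSpace G)
    (t' : Reduction X hX hl → UnitSpace (Reduction X hX hl)) (ht : IsLocalHomeomorph t)
    (htt : ∀ g, unitVal hX hl (t' g) = t (val hX hl g)) (hmem : ∀ g, t g ∈ X → r g ∈ X) :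
    IsLocalHomeomorph t' := by
  have hc : Continuous t' := by
    rw [(isEmbedding_unitVal hX hl).continuous_iff]
    have h1 : unitVal hX hl ∘ t' = t ∘ val hX hl := funext htt
    rw [h1]
    exact ht.continuous.comp (continuous_val hX hl)
  have ho : IsOpenMap t' := by
    intro O hO
    obtain ⟨O', hO', rfl⟩ := (isEmbedding_val hX hl).isOpen_iff.1 hO
    have h1 : t' '' (val hX hl ⁻¹' O') = unitVal hX hl ⁻¹' (t '' O') := by
      ext x
      constructor
      · rintro ⟨g, hg, rfl⟩
        exact ⟨val hX hl g, hg, (htt g).symm⟩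
      · rintro ⟨g, hg, e⟩
        have hgX : r g ∈ X := by
          refine hmem g ?_
          rw [e]
          exact (range_unitVal hX hl).le ⟨x, rfl⟩
        refine ⟨mk hX hl g hgX, hg, (isEmbedding_unitVal hX hl).injective ?_⟩
        rw [htt, ← e, val_mk]
    rw [h1]
    exact (ht.isOpenMap _ hO').preimage (isEmbedding_unitVal hX hl).continuous
  rw [isLocalHomeomorph_iff_isOpenEmbedding_restrict]
  intro g
  obtain ⟨V, hV, hgV, hinj⟩ := ht.isLocallyInjective (val hX hl g)
  have hV' : IsOpen (val hX hl ⁻¹' V) := hV.preimage (continuous_val hX hl)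
  refine ⟨val hX hl ⁻¹' V, hV'.mem_nhds hgV, .of_continuous_injective_isOpenMap
    (hc.comp continuous_subtype_val) ?_ (ho.comp hV'.isOpenMap_subtype_val)⟩
  rintro ⟨a, ha⟩ ⟨b, hb⟩ e
  have e1 : t (val hX hl a) = t (val hX hl b) := by
    rw [← htt, ← htt]
    exact congrArg (unitVal hX hl) e
  exact Subtype.ext (val_injective hX hl (hinj ha hb e1))

instance : IsLCEtaleGroupoid (Reduction X hX hl) where
  locallyCompact :=
    have : LocallyCompactSpace G := IsLCEtaleGroupoid.locallyCompact
    IsLocallyClosed.locallyCompactSpace (s := (r ⁻¹' X : Set G)) (hl.preimage continuous_r)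
  continuousOn_mul := by
    rw [(isEmbedding_val hX hl).continuousOn_iff]
    have h1 : ContinuousOn (fun p : Reduction X hX hl × Reduction X hX hl =>
        mul (val hX hl p.1) (val hX hl p.2)) {p | src p.1 = rng p.2} := by
      refine IsLCEtaleGroupoid.continuousOn_mul.comp
        (((continuous_val hX hl).comp continuous_fst).prodMk
          ((continuous_val hX hl).comp continuous_snd)).continuousOn ?_
      intro p hp
      exact congrArg (val hX hl) hp
    exact h1.congr fun p hp => val_mul hX hl p.1 p.2 (congrArg (val hX hl) hp)
  continuous_inv := by
    rw [(isEmbedding_val hX hl).continuous_iff]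
    exact continuous_inv'.comp (continuous_val hX hl)
  t2_units := T2Space.of_injective_continuous (isEmbedding_unitVal hX hl).injective
    (isEmbedding_unitVal hX hl).continuous
  locallyCompact_units := (isEmbedding_unitVal hX hl).isInducing.locallyCompactSpace
    (by rw [range_unitVal]; exact hl)
  isLocalHomeomorph_r := isLocalHomeomorph_aux hX hl r r IsLCEtaleGroupoid.isLocalHomeomorph_r
    (fun _ => rfl) (fun _ h => h)
  isLocalHomeomorph_s := isLocalHomeomorph_aux hX hl s s IsLCEtaleGroupoid.isLocalHomeomorph_s
    (fun _ => rfl) (fun g h => (hX g).2 h)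

/-- Convolution commutes with restriction to a reduction. -/
theorem conv_comp_val (f₁ f₂ : G → ℂ) :
    conv (f₁ ∘ val hX hl) (f₂ ∘ val hX hl) = conv f₁ f₂ ∘ val hX hl := by
  funext g
  refine finsum_mem_eq_of_bijOn (val hX hl) ⟨?_, ?_, ?_⟩ ?_
  · intro h hh
    exact (r_val_iff hX hl h g).1 hh
  · exact (val_injective hX hl).injOn
  · intro h hh
    have hhX : r h ∈ X := by
      rw [show r h = r (val hX hl g) from hh]
      exact r_val_mem hX hl g
    exact ⟨mk hX hl h hhX, (r_val_iff hX hl (mk hX hl h hhX) g).2 hh, rfl⟩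
  · intro h hh
    have e : src (val hX hl (inv h)) = rng (val hX hl g) := by
      rw [val_inv, src_inv]
      exact r_eq_iff.1 ((r_val_iff hX hl h g).1 hh)
    simp only [Function.comp_apply]
    rw [val_mul hX hl _ _ e, val_inv]

theorem invol_comp_val (f : G → ℂ) : invol (f ∘ val hX hl) = invol f ∘ val hX hl := rfl

end Reduction

variable [IsLCEtaleGroupoid G]

/-! #### Restriction to a closed invariant set -/

theorem isClosedEmbedding_val (hc : IsClosed X) :
    Topology.IsClosedEmbedding (Reduction.val hX hc.isLocallyClosed) :=
  (hc.preimage continuous_r).isClosedEmbedding_subtypeVal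

theorem isOpenEmbedding_val (ho : IsOpen X) :
    Topology.IsOpenEmbedding (Reduction.val hX ho.isLocallyClosed) :=
  (ho.preimage continuous_r).isOpenEmbedding_subtypeVal

theorem comp_val_mem_Cc (hc : IsClosed X) {f : G → ℂ} (hf : f ∈ Cc (Set.univ : Set G)) :
    f ∘ Reduction.val hX hc.isLocallyClosed ∈
      Cc (Set.univ : Set (Reduction X hX hc.isLocallyClosed)) := by
  rw [Cc_eq_span] at hf
  induction hf using Submodule.span_induction with
  | mem f h =>
    obtain ⟨B, hB, -, hf⟩ := h
    have := hB.t2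
    obtain ⟨hcont, K, hKB, hK, h0⟩ := mem_CcOn_iff.1 hf
    have hv := Reduction.continuous_val hX hc.isLocallyClosed
    have hT : T2Space (Reduction.val hX hc.isLocallyClosed ⁻¹' B) :=
      T2Space.of_injective_continuous (f := B.restrictPreimage (Reduction.val hX hc.isLocallyClosed))
        ((Reduction.val_injective hX hc.isLocallyClosed).restrictPreimage _)
        hv.restrictPreimage
    refine CcOn_le_Cc (Set.subset_univ _) (hB.isOpen.preimage hv)
      (mem_CcOn_iff.2 ⟨hcont.comp hv.continuousOn fun g hg => hg,
        Reduction.val hX hc.isLocallyClosed ⁻¹' K, Set.preimage_mono hKB,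
        (isClosedEmbedding_val hX hc).isCompact_preimage hK, fun g hg => h0 _ hg⟩)
  | zero => exact Submodule.zero_mem _
  | add f₁ f₂ _ _ h₁ h₂ => exact Submodule.add_mem _ h₁ h₂
  | smul c f _ h => exact Submodule.smul_mem _ c h

/-- The restriction `C_c(G) → C_c(G_X)`, `f ↦ f|_{G_X}`, for a closed invariant set `X`. -/
def restrictCc (hc : IsClosed X) : CcAlg G →⋆ₙₐ[ℂ] CcAlg (Reduction X hX hc.isLocallyClosed) where
  toFun f := .mk (f.fn ∘ Reduction.val hX hc.isLocallyClosed) (comp_val_mem_Cc hX hc f.fn_mem)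
  map_smul' _ _ := rfl
  map_zero' := rfl
  map_add' _ _ := rfl
  map_mul' f₁ f₂ := CcAlg.ext (Reduction.conv_comp_val hX hc.isLocallyClosed f₁.fn f₂.fn).symm
  map_star' _ := rfl

/-- The *-homomorphism `C*(G) → C*(G_X)` extending the restriction `C_c(G) → C_c(G_X)`. -/
def restrictHom (hc : IsClosed X) :
    FullCStar G →⋆ₙₐ[ℂ] FullCStar (Reduction X hX hc.isLocallyClosed) :=
  EnvelopingCStar.map (restrictCc hX hc)

theorem restrictHom_ofCc (hc : IsClosed X) (f : CcAlg G) :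
    restrictHom hX hc (ofCc f) = ofCc (restrictCc hX hc f) :=
  EnvelopingCStar.lift_ofAlg _ f

/-! #### Extension by zero from an open invariant set -/

/-- Extension by zero of a function from a reduction to `G`. -/
def Reduction.extendZero (f : Reduction X hX hl → ℂ) : G → ℂ :=
  Function.extend (Reduction.val hX hl) f 0

theorem Reduction.extendZero_comp_val (f : Reduction X hX hl → ℂ) :
    Reduction.extendZero hX hl f ∘ Reduction.val hX hl = f :=
  funext fun g => (Reduction.val_injective hX hl).extend_apply f 0 g

theorem Reduction.extendZero_of_notMem (f : Reduction X hX hl → ℂ) {g : G} (hg : r g ∉ X) :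
    Reduction.extendZero hX hl f g = 0 := by
  refine (Function.extend_apply' _ _ _ ?_).trans rfl
  rintro ⟨h, rfl⟩
  exact hg h.2

theorem Reduction.extendZero_unique (f : Reduction X hX hl → ℂ) (F : G → ℂ)
    (h₁ : F ∘ Reduction.val hX hl = f) (h₂ : ∀ g, r g ∉ X → F g = 0) :
    Reduction.extendZero hX hl f = F := by
  funext g
  by_cases hg : r g ∈ X
  · exact congrFun ((Reduction.extendZero_comp_val hX hl f).trans h₁.symm) (Reduction.mk hX hl g hg)
  · rw [Reduction.extendZero_of_notMem hX hl f hg, h₂ g hg]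

theorem Reduction.extendZero_add (f₁ f₂ : Reduction X hX hl → ℂ) :
    Reduction.extendZero hX hl (f₁ + f₂) =
      Reduction.extendZero hX hl f₁ + Reduction.extendZero hX hl f₂ := by
  refine Reduction.extendZero_unique hX hl _ _ ?_ fun g hg => ?_
  · exact congrArg₂ (· + ·) (Reduction.extendZero_comp_val hX hl f₁)
      (Reduction.extendZero_comp_val hX hl f₂)
  · rw [Pi.add_apply, Reduction.extendZero_of_notMem hX hl _ hg,
      Reduction.extendZero_of_notMem hX hl _ hg, add_zero]

theorem Reduction.extendZero_smul (c : ℂ) (f : Reduction X hX hl → ℂ) :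
    Reduction.extendZero hX hl (c • f) = c • Reduction.extendZero hX hl f := by
  refine Reduction.extendZero_unique hX hl _ _ ?_ fun g hg => ?_
  · exact congrArg (c • ·) (Reduction.extendZero_comp_val hX hl f)
  · rw [Pi.smul_apply, Reduction.extendZero_of_notMem hX hl _ hg, smul_zero]

theorem Reduction.extendZero_zero :
    Reduction.extendZero hX hl (0 : Reduction X hX hl → ℂ) = 0 :=
  Reduction.extendZero_unique hX hl _ _ rfl fun _ _ => rfl

theorem Reduction.extendZero_conv (f₁ f₂ : Reduction X hX hl → ℂ) :
    Reduction.extendZero hX hl (conv f₁ f₂) =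
      conv (Reduction.extendZero hX hl f₁) (Reduction.extendZero hX hl f₂) := by
  refine Reduction.extendZero_unique hX hl _ _ ?_ fun g hg => ?_
  · rw [← Reduction.conv_comp_val, Reduction.extendZero_comp_val, Reduction.extendZero_comp_val]
  · refine (finsum_mem_congr rfl fun h hh => ?_).trans (finsum_mem_zero _)
    rw [Reduction.extendZero_of_notMem hX hl f₁ (by rw [show r h = r g from hh]; exact hg),
      zero_mul]

theorem Reduction.extendZero_invol (f : Reduction X hX hl → ℂ) :
    Reduction.extendZero hX hl (invol f) = invol (Reduction.extendZero hX hl f) := by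
  refine Reduction.extendZero_unique hX hl _ _ ?_ fun g hg => ?_
  · rw [← Reduction.invol_comp_val, Reduction.extendZero_comp_val]
  · have h1 : r (inv g) ∉ X := by
      rw [show r (inv g) = s g from Subtype.ext (rng_inv g), ← hX g]
      exact hg
    rw [invol, Reduction.extendZero_of_notMem hX hl f h1, star_zero]

theorem extendZero_mem_Cc (ho : IsOpen X) {f : Reduction X hX ho.isLocallyClosed → ℂ}
    (hf : f ∈ Cc (Set.univ : Set (Reduction X hX ho.isLocallyClosed))) :
    Reduction.extendZero hX ho.isLocallyClosed f ∈ Cc {g : G | r g ∈ X} := by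
  rw [Cc_eq_span] at hf
  induction hf using Submodule.span_induction with
  | mem f h =>
    obtain ⟨B, hB, -, hf⟩ := h
    have := hB.t2
    obtain ⟨hcont, K, hKB, hK, h0⟩ := mem_CcOn_iff.1 hf
    have he := isOpenEmbedding_val hX ho
    have hinj : Set.InjOn (r : G → UnitSpace G) (Reduction.val hX ho.isLocallyClosed '' B) := by
      rintro _ ⟨a, ha, rfl⟩ _ ⟨b, hb, rfl⟩ e
      exact congrArg _ (hB.injOn_r ha hb ((Reduction.r_val_iff hX ho.isLocallyClosed a b).2 e))
    have hT := t2_of_injOn hinj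
    have hval : ∀ g, Reduction.extendZero hX ho.isLocallyClosed f
        (Reduction.val hX ho.isLocallyClosed g) = f g := fun g =>
      congrFun (Reduction.extendZero_comp_val hX ho.isLocallyClosed f) g
    refine CcOn_le_Cc (V := Reduction.val hX ho.isLocallyClosed '' B) ?_
      (he.isOpenMap _ hB.isOpen) (mem_CcOn_iff.2
        ⟨?_, Reduction.val hX ho.isLocallyClosed '' K, Set.image_mono hKB,
          hK.image he.continuous, ?_⟩)
    · rintro _ ⟨a, -, rfl⟩
      exact a.2
    · rintro _ ⟨a, ha, rfl⟩
      refine ContinuousAt.continuousWithinAt ?_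
      rw [← he.continuousAt_iff, Reduction.extendZero_comp_val]
      exact hcont.continuousAt (hB.isOpen.mem_nhds ha)
    · intro g hg
      by_cases hgX : r g ∈ X
      · refine (hval (Reduction.mk hX ho.isLocallyClosed g hgX)).trans (h0 _ fun h => hg ⟨_, h, rfl⟩)
      · exact Reduction.extendZero_of_notMem hX ho.isLocallyClosed f hgX
  | zero =>
    rw [Reduction.extendZero_zero]
    exact Submodule.zero_mem _
  | add f₁ f₂ _ _ h₁ h₂ =>
    rw [Reduction.extendZero_add]
    exact Submodule.add_mem _ h₁ h₂
  | smul c f _ h =>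
    rw [Reduction.extendZero_smul]
    exact Submodule.smul_mem _ c h

/-- The inclusion `C_c(G_X) → C_c(G)` by extension by zero, for an open invariant set `X`. -/
def extendCc (ho : IsOpen X) : CcAlg (Reduction X hX ho.isLocallyClosed) →⋆ₙₐ[ℂ] CcAlg G where
  toFun f := .mk (Reduction.extendZero hX ho.isLocallyClosed f.fn)
    (Cc_mono (Set.subset_univ _) (extendZero_mem_Cc hX ho f.fn_mem))
  map_smul' c f := CcAlg.ext (Reduction.extendZero_smul hX ho.isLocallyClosed c f.fn)
  map_zero' := CcAlg.ext (Reduction.extendZero_zero hX ho.isLocallyClosed)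
  map_add' f₁ f₂ := CcAlg.ext (Reduction.extendZero_add hX ho.isLocallyClosed f₁.fn f₂.fn)
  map_mul' f₁ f₂ := CcAlg.ext (Reduction.extendZero_conv hX ho.isLocallyClosed f₁.fn f₂.fn)
  map_star' f := CcAlg.ext (Reduction.extendZero_invol hX ho.isLocallyClosed f.fn)

/-- The *-homomorphism `C*(G_X) → C*(G)` extending the inclusion `C_c(G_X) → C_c(G)`. -/
def extendHom (ho : IsOpen X) :
    FullCStar (Reduction X hX ho.isLocallyClosed) →⋆ₙₐ[ℂ] FullCStar G :=
  EnvelopingCStar.map (extendCc hX ho)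

theorem extendHom_ofCc (ho : IsOpen X) (f : CcAlg (Reduction X hX ho.isLocallyClosed)) :
    extendHom hX ho (ofCc f) = ofCc (extendCc hX ho f) :=
  EnvelopingCStar.lift_ofAlg _ f

end Reduction

end ArrowGroupoid

/-- The closed two-sided ideal generated by a set `S`: the smallest norm-closed linear subspace
that contains `S` and is stable under multiplication from both sides. -/
def closedIdealSpan {A : Type*} [NonUnitalCStarAlgebra A] (S : Set A) : Submodule ℂ A :=
  sInf {I | IsClosed (I : Set A) ∧ S ⊆ I ∧ ∀ a, ∀ b ∈ I, a * b ∈ I ∧ b * a ∈ I}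

end

open scoped CompactlySupported ZeroAtInfty

/-!
Let `I` be the closure of the image of `C_c(G ∖ G_X)` in `C*(G)`; it is a closed `*`-ideal on which
the map to `C*(G_X)` vanishes. The quotient norm of `C*(G) / I` is a C*-seminorm on `C_c(G)`. Any
C*-seminorm of a function supported in a bisection is at most its sup norm, and by induction on the
number of bisections needed to cover the support, a C*-seminorm that vanishes on `C_c(G ∖ G_X)`
vanishes on every function that is zero on `G_X`. So the quotient norm descends along the surjective
restriction map to a C*-seminorm on `C_c(G_X)`, where it is dominated by the maximal one. Hence
`C*(G) / I → C*(G_X)` is isometric with dense range, which gives the kernel and the surjectivity.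

The ideal `I` is generated by `C₀(G⁽⁰⁾ ∖ X)` because every `f` in `C_c(G ∖ G_X)` equals `χ * f` for
some `χ` in `C_c(G⁽⁰⁾ ∖ X)`.

For an open invariant set `U`, the algebra `C_c(G)` acts on `C_c(G_U)` by left multipliers. They are
bounded for the maximal norm: when `f` lives on a bisection, `‖f‖² - f^* * f`, with the sup norm of
`f`, is the square of a real function on the unit space. The operator norm is thus a C*-seminorm on
`C_c(G)` that dominates the maximal one on `C_c(G_U)`, so `C*(G_U) → C*(G)` is isometric.
-/

noncomputable section

namespace CStarSeminorm

variable {A B : Type*} [NonUnitalRing A] [Module ℂ A] [StarRing A]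

/-- A C*-seminorm from a submultiplicative seminorm satisfying only one half of the C*-identity. -/
def ofSeminorm (q : Seminorm ℂ A) (mul_le : ∀ a b, q (a * b) ≤ q a * q b)
    (sq_le : ∀ a, q a ^ 2 ≤ q (star a * a)) : CStarSeminorm A :=
  have le_star (a : A) : q a ≤ q (star a) := by
    by_contra! h
    nlinarith [sq_le a, mul_le (star a) a, apply_nonneg q a, apply_nonneg q (star a)]
  { q with
    mul_le' := mul_le
    star_mul_self' := fun a => le_antisymm
      (calc q (star a * a) ≤ q (star a) * q a := mul_le _ _
        _ ≤ q a * q a := by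
          gcongr
          exact (le_star (star a)).trans_eq (by rw [star_star])
        _ = q a ^ 2 := (sq _).symm)
      (sq_le a) }

theorem exists_descend [NonUnitalRing B] [Module ℂ B] [StarRing B] (q : CStarSeminorm A)
    (σ : A →⋆ₙₐ[ℂ] B) (hσ : Function.Surjective σ) (h0 : ∀ a, σ a = 0 → q a = 0) :
    ∃ q' : CStarSeminorm B, ∀ a, q' (σ a) = q a := by
  have hle (a b : A) (e : σ a = σ b) : q a ≤ q b := by
    have h1 := map_add_le_add q.toSeminorm (a - b) b
    rwa [sub_add_cancel, h0 (a - b) (by rw [map_sub, e, sub_self]), zero_add] at h1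
  have heq (a b : A) (e : σ a = σ b) : q a = q b := le_antisymm (hle a b e) (hle b a e.symm)
  choose t ht using hσ
  let q' : Seminorm ℂ B := Seminorm.of (fun b => q (t b))
    (fun x y => by
      rw [heq (t (x + y)) (t x + t y) (by simp only [map_add, ht])]
      exact map_add_le_add q.toSeminorm _ _)
    (fun c x => by
      rw [heq (t (c • x)) (c • t x) (by simp only [map_smul, ht])]
      exact map_smul_eq_mul q.toSeminorm _ _)
  have hmul (x y : B) : q' (x * y) ≤ q' x * q' y :=
    (heq (t (x * y)) (t x * t y) (by simp only [map_mul, ht])).trans_le (q.mul_le' _ _)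
  have hsq (x : B) : q' x ^ 2 ≤ q' (star x * x) :=
    ((heq (t (star x * x)) (star (t x) * t x) (by simp only [map_mul, map_star, ht])).trans
      (q.star_mul_self' _)).ge
  exact ⟨ofSeminorm q' hmul hsq, fun a => heq _ _ (ht _)⟩

theorem exists_of_action [NonUnitalRing B] [Module ℂ B] [IsScalarTower ℂ B B] [SMulCommClass ℂ B B]
    [StarRing B] [StarModule ℂ B] (p : CStarSeminorm B) (L : A →ₗ[ℂ] B →ₗ[ℂ] B)
    (hmul : ∀ a a' b, L (a * a') b = L a (L a' b))
    (hadj : ∀ a b, star (L a b) * L a b = star b * L (star a * a) b)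
    (hbdd : ∀ a, ∃ C, ∀ b, p (L a b) ≤ C * p b) :
    ∃ q : CStarSeminorm A, ∀ a b, p (L a b) ≤ q a * p b := by
  let T : A →ₗ[ℂ] p.Pre →L[ℂ] p.Pre :=
    { toFun := fun a =>
        LinearMap.mkContinuousOfExistsBound (L a : p.Pre →ₗ[ℂ] p.Pre) (hbdd a)
      map_add' := fun a a' =>
        ContinuousLinearMap.ext fun b => LinearMap.congr_fun (L.map_add a a') b
      map_smul' := fun c a =>
        ContinuousLinearMap.ext fun b => LinearMap.congr_fun (L.map_smul c a) b }
  have hop (a : A) (b : B) : p (L a b) ≤ ‖T a‖ * p b := (T a).le_opNorm b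
  have hT_mul (a a' : A) : ‖T (a * a')‖ ≤ ‖T a‖ * ‖T a'‖ := by
    rw [show T (a * a') = (T a).comp (T a') from ContinuousLinearMap.ext fun b => hmul a a' b]
    exact ContinuousLinearMap.opNorm_comp_le _ _
  have hT_sq (a : A) : ‖T a‖ ^ 2 ≤ ‖T (star a * a)‖ := by
    refine (Real.le_sqrt (norm_nonneg _) (norm_nonneg _)).1 ?_
    refine ContinuousLinearMap.opNorm_le_bound _ (Real.sqrt_nonneg _) fun (b : B) => ?_
    refine le_of_sq_le_sq (?_ : p (L a b) ^ 2 ≤ _) (mul_nonneg (Real.sqrt_nonneg _) (p.nonneg b))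
    rw [mul_pow, Real.sq_sqrt (norm_nonneg _)]
    calc p (L a b) ^ 2 = p (star b * L (star a * a) b) := by rw [← p.star_mul_self, hadj]
      _ ≤ p b * p (L (star a * a) b) := (p.mul_le _ _).trans_eq (by rw [p.star_eq])
      _ ≤ p b * (‖T (star a * a)‖ * p b) := mul_le_mul_of_nonneg_left (hop _ b) (p.nonneg b)
      _ = ‖T (star a * a)‖ * p b ^ 2 := by ring
  exact ⟨ofSeminorm ((normSeminorm ℂ (p.Pre →L[ℂ] p.Pre)).comp T) hT_mul hT_sq, hop⟩

variable [IsScalarTower ℂ A A] [SMulCommClass ℂ A A] [StarModule ℂ A]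

theorem le_mul_of_star_mul_self_add (p : CStarSeminorm A) {a b c : A} {M : ℝ} (hM : 0 ≤ M)
    (h : star b * b + star c * c = ((M ^ 2 : ℝ) : ℂ) • (star a * a)) : p b ≤ M * p a := by
  let _ : PartialOrder p.CStarCompletion := CStarAlgebra.spectralOrder _
  have : StarOrderedRing p.CStarCompletion := CStarAlgebra.spectralOrderedRing _
  have hle : star (p.toCompl b) * p.toCompl b ≤
      ((M ^ 2 : ℝ) : ℂ) • (star (p.toCompl a) * p.toCompl a) := by
    simp only [← map_star, ← map_mul, ← map_smul, ← h]
    rw [map_add, map_mul _ (star c), map_star]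
    exact le_add_of_nonneg_right (star_mul_self_nonneg _)
  have hnorm := CStarAlgebra.norm_le_norm_of_nonneg_of_le (star_mul_self_nonneg _) hle
  rw [norm_smul, CStarRing.norm_star_mul_self, CStarRing.norm_star_mul_self, norm_toCompl,
    norm_toCompl, Complex.norm_real, Real.norm_of_nonneg (sq_nonneg M)] at hnorm
  exact le_of_sq_le_sq (by linarith) (mul_nonneg hM (p.nonneg a))

end CStarSeminorm

/-- A two-sided *-ideal of a complex *-algebra. Stability under right multiplication follows by
taking adjoints. -/
structure IsStarIdeal {A : Type*} [NonUnitalRing A] [Module ℂ A] [StarRing A]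
    (I : Submodule ℂ A) : Prop where
  mul_mem_left : ∀ a, ∀ b ∈ I, a * b ∈ I
  star_mem : ∀ b ∈ I, star b ∈ I

namespace IsStarIdeal

variable {A : Type*} [NonUnitalRing A] [Module ℂ A] [StarRing A] {I : Submodule ℂ A}

theorem mul_mem_right (hI : IsStarIdeal I) (a : A) {b : A} (hb : b ∈ I) : b * a ∈ I := by
  have h := hI.star_mem _ (hI.mul_mem_left (star a) _ (hI.star_mem b hb))
  rwa [star_mul, star_star, star_star] at h

theorem topologicalClosure_map (hI : IsStarIdeal I) {B : Type*} [NonUnitalCStarAlgebra B]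
    {φ : A →⋆ₙₐ[ℂ] B} (hφ : DenseRange φ) :
    IsStarIdeal (I.map (φ : A →ₗ[ℂ] B)).topologicalClosure := by
  have mul_mem (a : A) : ∀ b ∈ (I.map (φ : A →ₗ[ℂ] B)).topologicalClosure,
      φ a * b ∈ (I.map (φ : A →ₗ[ℂ] B)).topologicalClosure := by
    refine fun b hb => map_mem_closure (by fun_prop) hb ?_
    rintro _ ⟨i, hi, rfl⟩
    exact ⟨a * i, hI.mul_mem_left a i hi, map_mul φ a i⟩
  refine ⟨fun a b hb => ?_, fun b hb => ?_⟩
  · exact hφ.induction_on (p := fun a => a * b ∈ (I.map (φ : A →ₗ[ℂ] B)).topologicalClosure) a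
      (isClosed_closure.preimage (by fun_prop)) fun a => mul_mem a b hb
  · refine map_mem_closure continuous_star hb ?_
    rintro _ ⟨i, hi, rfl⟩
    exact ⟨star i, hI.star_mem i hi, map_star φ i⟩

end IsStarIdeal

section Quotient

variable {B : Type*} [NonUnitalCStarAlgebra B]

theorem norm_sub_star_mul_self_mul_le {y : B} (hy : ‖star y * y‖ ≤ 1) (a : B) :
    ‖a - star y * y * a‖ ≤ ‖a‖ := by
  let _ : PartialOrder B := CStarAlgebra.spectralOrder _
  have : StarOrderedRing B := CStarAlgebra.spectralOrderedRing _
  set e : B := star y * y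
  have he : (e : Unitization ℂ B) ∈ Set.Icc 0 1 := CStarAlgebra.mem_Icc_iff_norm_le_one.2
    ⟨Unitization.inr_nonneg_iff.2 (star_mul_self_nonneg y), by rwa [Unitization.norm_inr]⟩
  have hnorm : ‖1 - (e : Unitization ℂ B)‖ ≤ 1 :=
    (CStarAlgebra.mem_Icc_iff_norm_le_one.1 (Set.sub_mem_Icc_zero_iff_right.2 he)).2
  rw [← Unitization.norm_inr (𝕜 := ℂ), ← Unitization.norm_inr (𝕜 := ℂ) (a := a),
    Unitization.inr_sub, Unitization.inr_mul, ← one_sub_mul]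
  exact (norm_mul_le _ _).trans (mul_le_of_le_one_left (norm_nonneg _) hnorm)

theorem norm_sub_mul_star_mul_self_le {y : B} (hy : ‖star y * y‖ ≤ 1) (a : B) :
    ‖a - a * (star y * y)‖ ≤ ‖a‖ := by
  simpa only [star_sub, star_mul, star_star, norm_star] using
    norm_sub_star_mul_self_mul_le hy (star a) |>.trans_eq' (norm_star _).symm

namespace IsStarIdeal

variable {I : Submodule ℂ B}

theorem exists_norm_sub_mul_lt (hI : IsStarIdeal I) (hc : IsClosed (I : Set B)) {j : B}
    (hj : j ∈ I) {ε : ℝ} (hε : 0 < ε) :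
    ∃ y ∈ I, ‖star y * y‖ ≤ 1 ∧ ‖j - j * (star y * y)‖ < ε := by
  let S : NonUnitalStarSubalgebra ℂ B :=
    { I with
      mul_mem' := fun _ hb => hI.mul_mem_left _ _ hb
      star_mem' := fun hb => hI.star_mem _ hb }
  have : IsClosed (S : Set B) := hc
  let _ : PartialOrder S := CStarAlgebra.spectralOrder _
  have : StarOrderedRing S := CStarAlgebra.spectralOrderedRing _
  have hS := CStarAlgebra.increasingApproximateUnit S
  have hlim := (Metric.tendsto_nhds.1 (hS.tendsto_mul_left ⟨j, hj⟩)) ε hε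
  have := hS.neBot
  obtain ⟨e, ⟨he, he_norm⟩, he_dist⟩ :=
    ((hS.eventually_nonneg.and hS.eventually_norm).and hlim).exists
  obtain ⟨y, rfl⟩ := CStarAlgebra.nonneg_iff_eq_star_mul_self.1 he
  rw [dist_comm, dist_eq_norm] at he_dist
  exact ⟨y, y.2, he_norm, he_dist⟩

theorem norm_mk_mul_le (hI : IsStarIdeal I) (a b : B) :
    ‖I.mkQ (a * b)‖ ≤ ‖I.mkQ a‖ * ‖I.mkQ b‖ := by
  have hlim : Filter.Tendsto (fun ε : ℝ => (‖I.mkQ a‖ + ε) * (‖I.mkQ b‖ + ε))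
      (nhdsWithin 0 (Set.Ioi 0)) (nhds (‖I.mkQ a‖ * ‖I.mkQ b‖)) := by
    have hcont : Continuous fun ε : ℝ => (‖I.mkQ a‖ + ε) * (‖I.mkQ b‖ + ε) := by fun_prop
    simpa using (hcont.tendsto 0).mono_left nhdsWithin_le_nhds
  refine ge_of_tendsto hlim (eventually_mem_nhdsWithin.mono fun ε (hε : 0 < ε) => ?_)
  obtain ⟨a', ha, ha'⟩ := Submodule.Quotient.norm_mk_lt (I.mkQ a) hε
  obtain ⟨b', hb, hb'⟩ := Submodule.Quotient.norm_mk_lt (I.mkQ b) hε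
  have hab : I.mkQ (a * b) = I.mkQ (a' * b') := by
    refine (Submodule.Quotient.eq I).2 ?_
    rw [show a * b - a' * b' = -((a' - a) * b + a' * (b' - b)) by noncomm_ring]
    exact I.neg_mem (I.add_mem (hI.mul_mem_right _ ((Submodule.Quotient.eq I).1 ha))
      (hI.mul_mem_left _ _ ((Submodule.Quotient.eq I).1 hb)))
  calc ‖I.mkQ (a * b)‖ ≤ ‖a' * b'‖ := hab ▸ Submodule.Quotient.norm_mk_le I _
    _ ≤ ‖a'‖ * ‖b'‖ := norm_mul_le _ _
    _ ≤ _ := by gcongr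

theorem sq_norm_mk_le (hI : IsStarIdeal I) (hc : IsClosed (I : Set B)) (a : B) :
    ‖I.mkQ a‖ ^ 2 ≤ ‖I.mkQ (star a * a)‖ := by
  refine le_of_forall_pos_lt_add fun ε hε => ?_
  obtain ⟨k, hk, hk_norm⟩ := Submodule.Quotient.norm_mk_lt (I.mkQ (star a * a)) (half_pos hε)
  have hj : star a * a - k ∈ I := (Submodule.Quotient.eq I).1 hk.symm
  obtain ⟨y, hy, hy_norm, hjy⟩ := hI.exists_norm_sub_mul_lt hc hj (half_pos hε)
  set e := star y * y
  have he_star : star e = e := by simp only [e, star_mul, star_star]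
  have hae : I.mkQ a = I.mkQ (a - a * e) := by
    refine (Submodule.Quotient.eq I).2 ?_
    rw [sub_sub_cancel]
    exact hI.mul_mem_left _ _ (hI.mul_mem_left _ _ hy)
  have hsq : star (a - a * e) * (a - a * e) =
      (star a * a - star a * a * e) - e * (star a * a - star a * a * e) := by
    rw [star_sub, star_mul, he_star]
    noncomm_ring
  calc ‖I.mkQ a‖ ^ 2 ≤ ‖a - a * e‖ ^ 2 := by
        rw [hae]
        gcongr
        exact Submodule.Quotient.norm_mk_le I _
    _ = ‖star (a - a * e) * (a - a * e)‖ := by rw [CStarRing.norm_star_mul_self, sq]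
    _ ≤ ‖star a * a - star a * a * e‖ := hsq ▸ norm_sub_star_mul_self_mul_le hy_norm _
    _ = ‖(k - k * e) + ((star a * a - k) - (star a * a - k) * e)‖ := by
        congr 1
        noncomm_ring
    _ ≤ ‖k - k * e‖ + ‖(star a * a - k) - (star a * a - k) * e‖ := norm_add_le _ _
    _ < ‖I.mkQ (star a * a)‖ + ε := by
        linarith [norm_sub_mul_star_mul_self_le hy_norm k]

/-- The norm of the quotient of a C*-algebra by a closed *-ideal, as a C*-seminorm. -/
def quotientSeminorm (hI : IsStarIdeal I) (hc : IsClosed (I : Set B)) : CStarSeminorm B :=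
  .ofSeminorm ((normSeminorm ℂ (B ⧸ I)).comp I.mkQ) hI.norm_mk_mul_le (hI.sq_norm_mk_le hc)

end IsStarIdeal

end Quotient

section CompactSupport

variable {G : Type*} [TopologicalSpace G] {U V W : Set G} {f f₁ f₂ : G → ℂ}

theorem t2Space_of_subset [T2Space V] (h : W ⊆ V) : T2Space W :=
  (Topology.IsEmbedding.inclusion h).t2Space

theorem t2Space_preimage {Y Z : Type*} [TopologicalSpace Y] [TopologicalSpace Z] {f : Y → Z}
    (hf : Continuous f) (hi : Function.Injective f) {B : Set Z} [T2Space B] :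
    T2Space (f ⁻¹' B) :=
  T2Space.of_injective_continuous (hi.restrictPreimage B) hf.restrictPreimage

theorem eq_zero_of_mem_CcOn (hf : f ∈ CcOn V) {g : G} (hg : g ∉ V) : f g = 0 := by
  obtain ⟨φ, rfl⟩ := hf
  exact Function.extend_apply' _ _ _ fun ⟨v, hv⟩ => hg (hv ▸ v.2)

theorem eq_zero_of_mem_Cc (hf : f ∈ Cc U) {g : G} (hg : g ∉ U) : f g = 0 := by
  have h : Cc U ≤ LinearMap.ker (LinearMap.proj (R := ℂ) (φ := fun _ : G => ℂ) g) := by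
    refine Submodule.span_le.2 ?_
    rintro f ⟨V, hVU, -, -, hf⟩
    exact eq_zero_of_mem_CcOn hf fun h => hg (hVU h)
  exact h hf

namespace CcOn

variable [T2Space V]

theorem mul_left {ψ : G → ℂ} (hf : f ∈ CcOn V) (hψ : ContinuousOn ψ V) :
    (fun g => ψ g * f g) ∈ CcOn V := by
  obtain ⟨hc, K, hKV, hK, h0⟩ := mem_CcOn_iff.1 hf
  exact mem_CcOn_iff.2 ⟨hψ.mul hc, K, hKV, hK, fun g hg => by rw [h0 g hg, mul_zero]⟩

theorem add (h₁ : f₁ ∈ CcOn V) (h₂ : f₂ ∈ CcOn V) : f₁ + f₂ ∈ CcOn V := by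
  obtain ⟨hc₁, K₁, hKV₁, hK₁, hz₁⟩ := mem_CcOn_iff.1 h₁
  obtain ⟨hc₂, K₂, hKV₂, hK₂, hz₂⟩ := mem_CcOn_iff.1 h₂
  refine mem_CcOn_iff.2 ⟨hc₁.add hc₂, K₁ ∪ K₂, Set.union_subset hKV₁ hKV₂, hK₁.union hK₂,
    fun g hg => ?_⟩
  rw [Pi.add_apply, hz₁ g fun h => hg (.inl h), hz₂ g fun h => hg (.inr h), add_zero]

theorem smul (c : ℂ) (hf : f ∈ CcOn V) : c • f ∈ CcOn V :=
  mul_left hf continuousOn_const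

theorem exists_norm_le (hf : f ∈ CcOn V) : ∃ M, 0 ≤ M ∧ ∀ g, ‖f g‖ ≤ M := by
  obtain ⟨hc, K, hKV, hK, h0⟩ := mem_CcOn_iff.1 hf
  obtain ⟨M, hM⟩ := hK.exists_bound_of_continuousOn (hc.mono hKV)
  refine ⟨max M 0, le_max_right _ _, fun g => ?_⟩
  by_cases hg : g ∈ K
  · exact (hM g hg).trans (le_max_left _ _)
  · rw [h0 g hg, norm_zero]
    exact le_max_right _ _

theorem isCompact_le (hf : f ∈ CcOn V) {δ : ℝ} (hδ : 0 < δ) :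
    IsCompact {v : V | δ ≤ ‖f v‖} := by
  obtain ⟨hc, K, hKV, hK, h0⟩ := mem_CcOn_iff.1 hf
  have hK' : IsCompact (Subtype.val ⁻¹' K : Set V) := by
    rw [Subtype.isCompact_iff, Subtype.image_preimage_coe, Set.inter_eq_right.2 hKV]
    exact hK
  refine hK'.of_isClosed_subset (isClosed_le continuous_const
    (continuousOn_iff_continuous_domRestrict.1 hc).norm) fun v (hv : δ ≤ ‖f v‖) => ?_
  by_contra hn
  rw [h0 v hn, norm_zero] at hv
  exact hδ.not_ge hv

end CcOn

end CompactSupport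

/-- The radial retraction of the complex plane onto the disc of radius `δ`. -/
def radialRetraction (δ : ℝ) (z : ℂ) : ℂ := ((δ / max δ ‖z‖ : ℝ) : ℂ) * z

section RadialRetraction

variable {δ : ℝ}

theorem continuous_radialRetraction (hδ : 0 < δ) : Continuous (radialRetraction δ) := by
  have : Continuous fun z : ℂ => δ / max δ ‖z‖ :=
    continuous_const.div (continuous_const.max continuous_norm)
      fun z => (lt_max_of_lt_left hδ).ne'
  exact (Complex.continuous_ofReal.comp this).mul continuous_id

theorem norm_radialRetraction_le (hδ : 0 < δ) (z : ℂ) : ‖radialRetraction δ z‖ ≤ δ := by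
  have h0 : 0 < max δ ‖z‖ := lt_max_of_lt_left hδ
  rw [radialRetraction, norm_mul, Complex.norm_real, Real.norm_of_nonneg (by positivity),
    div_mul_eq_mul_div, div_le_iff₀ h0]
  exact mul_le_mul_of_nonneg_left (le_max_right _ _) hδ.le

theorem radialRetraction_eq (hδ : 0 < δ) {z : ℂ} (hz : ‖z‖ ≤ δ) : radialRetraction δ z = z := by
  rw [radialRetraction, max_eq_left hz, div_self hδ.ne', Complex.ofReal_one, one_mul]

theorem CcOn.exists_truncation {G : Type*} [TopologicalSpace G] {V W : Set G} [T2Space V]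
    {f : G → ℂ} (hf : f ∈ CcOn V) (hδ : 0 < δ) (h : ∀ g ∉ W, ‖f g‖ < δ) :
    ∃ f₁ ∈ CcOn (V ∩ W), ∃ f₂ ∈ CcOn V, f = f₁ + f₂ ∧ ∀ g, ‖f₂ g‖ ≤ δ := by
  have := t2Space_of_subset (Set.inter_subset_left (s := V) (t := W))
  obtain ⟨hc, K, hKV, hK, h0⟩ := mem_CcOn_iff.1 hf
  have hr : ContinuousOn (fun g => radialRetraction δ (f g)) V :=
    (continuous_radialRetraction hδ).comp_continuousOn hc
  refine ⟨fun g => f g - radialRetraction δ (f g),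
    mem_CcOn_iff.2 ⟨(hc.sub hr).mono Set.inter_subset_left, Subtype.val '' {v : V | δ ≤ ‖f v‖}, ?_,
      (CcOn.isCompact_le hf hδ).image continuous_subtype_val, fun g hg => ?_⟩,
    fun g => radialRetraction δ (f g), mem_CcOn_iff.2 ⟨hr, K, hKV, hK, fun g hg => ?_⟩,
    funext fun g => (sub_add_cancel _ _).symm, fun g => norm_radialRetraction_le hδ _⟩
  · rintro _ ⟨v, hv, rfl⟩
    exact ⟨v.2, by_contra fun hn => (h v hn).not_ge hv⟩
  · have hg_le : ‖f g‖ ≤ δ := by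
      by_cases hgV : g ∈ V
      · exact le_of_not_ge fun hn => hg ⟨⟨g, hgV⟩, hn, rfl⟩
      · rw [eq_zero_of_mem_CcOn hf hgV, norm_zero]
        exact hδ.le
    rw [radialRetraction_eq hδ hg_le, sub_self]
  · rw [h0 g hg, radialRetraction, mul_zero]

end RadialRetraction

namespace ArrowGroupoid

section Diagonal

variable {G : Type*} [ArrowGroupoid G]

/-- Multiplication of a function on `G` by the pullback of a function on the unit space along the
range map. -/
def diagMul (ψ : UnitSpace G → ℂ) (f : G → ℂ) : G → ℂ := fun g => ψ (r g) * f g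

theorem diagMul_conv (ψ : UnitSpace G → ℂ) (f h : G → ℂ) :
    conv (diagMul ψ f) h = diagMul ψ (conv f h) := by
  funext g
  simp only [diagMul, conv, mul_finsum_mem]
  refine finsum_mem_congr rfl fun k hk => ?_
  rw [show r k = r g from hk, _root_.mul_assoc]

theorem r_inv_mul {h g : G} (e : r h = r g) : r (mul (inv h) g) = r (inv h) :=
  r_eq_iff.2 (rng_mul _ _ ((src_inv h).trans (r_eq_iff.1 e)))

theorem conv_invol_diagMul (ψ ψ' : UnitSpace G → ℂ) (f f' : G → ℂ) :
    conv (invol (diagMul ψ f)) (diagMul ψ' f') = conv (invol f) (diagMul (star ψ * ψ') f') := by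
  funext g
  refine finsum_mem_congr rfl fun h hh => ?_
  simp only [invol, diagMul, Pi.mul_apply, Pi.star_apply, r_inv_mul hh, star_mul']
  ring

theorem conv_invol_self_apply_unit (f : G → ℂ) (x : UnitSpace G) :
    conv (invol f) f x = ∑ᶠ h ∈ {h : G | r h = r (x : G)}, ((‖f (inv h)‖ ^ 2 : ℝ) : ℂ) := by
  refine finsum_mem_congr rfl fun h (hh : r h = r (x : G)) => ?_
  have hx : src (inv h) = x := by rw [src_inv, r_eq_iff.1 hh, rng_unit]
  rw [← hx, mul_src_self, invol, Complex.star_def, Complex.conj_mul', Complex.ofReal_pow]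

theorem exists_conv_invol_self_eq {B : Set G} (hB : Set.InjOn (s : G → UnitSpace G) B) {f : G → ℂ}
    (h0 : ∀ g ∉ B, f g = 0) {M : ℝ} (hM : ∀ g, ‖f g‖ ≤ M) (x : UnitSpace G) :
    ∃ t ∈ Set.Icc 0 (M ^ 2), conv (invol f) f x = (t : ℂ) := by
  let F : G → ℂ := fun h => ((‖f (inv h)‖ ^ 2 : ℝ) : ℂ)
  have hFB (h : G) (hh : h ∈ Function.support F) : inv h ∈ B := by
    by_contra hn
    exact hh (by simp only [F, h0 _ hn, norm_zero, zero_pow two_ne_zero, Complex.ofReal_zero])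
  have hsub : ({h : G | r h = r (x : G)} ∩ Function.support F).Subsingleton := by
    rintro h ⟨hr, hh⟩ k ⟨kr, hk⟩
    have hs : src (inv h) = src (inv k) := by
      rw [src_inv, src_inv]
      exact r_eq_iff.1 (hr.trans kr.symm)
    rw [← inv_inv h, hB (hFB h hh) (hFB k hk) (s_eq_iff.2 hs), inv_inv]
  rw [conv_invol_self_apply_unit, ← finsum_mem_inter_support]
  obtain hempty | ⟨h, hh⟩ := hsub.eq_empty_or_singleton
  · exact ⟨0, ⟨le_rfl, sq_nonneg M⟩, by rw [hempty, finsum_mem_empty, Complex.ofReal_zero]⟩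
  · exact ⟨‖f (inv h)‖ ^ 2, ⟨sq_nonneg _, pow_le_pow_left₀ (norm_nonneg _) (hM _) 2⟩,
      by rw [hh, finsum_mem_singleton]⟩

end Diagonal

section Etale

variable {G : Type*} [TopologicalSpace G] [ArrowGroupoid G] [IsLCEtaleGroupoid G]

theorem conv_extendUnits_left (ψ : UnitSpace G → ℂ) (f : G → ℂ) :
    conv (extendUnits ψ) f = diagMul ψ f := by
  funext g
  rw [conv, finsum_mem_inter_support_eq' _ _ {((r g : UnitSpace G) : G)}, finsum_mem_singleton,
    extendUnits_coe, inv_unit, show mul (r g : G) g = g from rng_mul_self g, diagMul]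
  intro h hh
  have hu : src h = h := by_contra fun hu =>
    left_ne_zero_of_mul hh (extendUnits_of_not ψ hu)
  rw [Set.mem_ofPred_eq, Set.mem_singleton_iff, show r h = ⟨h, hu⟩ from r_unit ⟨h, hu⟩,
    Subtype.ext_iff]

theorem diagMul_mem_Cc {U : Set G} {ψ : UnitSpace G → ℂ} (hψ : Continuous ψ) {f : G → ℂ}
    (hf : f ∈ Cc U) : diagMul ψ f ∈ Cc U := by
  have h : Cc U ≤ (Cc U).comap (LinearMap.mulLeft ℂ (ψ ∘ r : G → ℂ)) := by
    refine Submodule.span_le.2 ?_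
    rintro f ⟨V, hVU, hV, hT, hf⟩
    exact Submodule.subset_span
      ⟨V, hVU, hV, hT, CcOn.mul_left hf (hψ.comp continuous_r).continuousOn⟩
  exact h hf

theorem CcAlg.exists_star_mul_self_eq {B : Set G} (hB : IsOpenBisection B) {f : CcAlg G}
    (hf : f.fn ∈ CcOn B) {M : ℝ} (hM : ∀ g, ‖f.fn g‖ ≤ M) :
    ∃ φ : C_c(UnitSpace G, ℂ), star f * f = unitsHom φ ∧
      ∀ x, ∃ t ∈ Set.Icc 0 (M ^ 2), φ x = (t : ℂ) := by
  obtain ⟨φ, hφ⟩ := star_mul_self_mem hB hf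
  refine ⟨φ, CcAlg.ext hφ, fun x => ?_⟩
  obtain ⟨t, ht, hft⟩ := exists_conv_invol_self_eq hB.injOn_s
    (fun g hg => eq_zero_of_mem_CcOn hf hg) hM x
  exact ⟨t, ht, by rw [← hft, hφ]; exact (extendUnits_coe _ x).symm⟩

theorem _root_.CStarSeminorm.le_of_mem_CcOn (q : CStarSeminorm (CcAlg G)) {B : Set G}
    (hB : IsOpenBisection B) {f : CcAlg G} (hf : f.fn ∈ CcOn B) {M : ℝ} (hM0 : 0 ≤ M)
    (hM : ∀ g, ‖f.fn g‖ ≤ M) : q f ≤ M := by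
  obtain ⟨φ, hφ, hφM⟩ := CcAlg.exists_star_mul_self_eq hB hf hM
  have hle : q (unitsHom φ) ≤ M ^ 2 := (q.comap unitsHom).le_of_bound φ (sq_nonneg M) fun x => by
    obtain ⟨t, ⟨ht0, htM⟩, ht⟩ := hφM x
    rwa [ht, Complex.norm_real, Real.norm_of_nonneg ht0]
  rw [← hφ, q.star_mul_self] at hle
  exact le_of_sq_le_sq hle hM0

/-- Pointwise multiplication `(ψ, f) ↦ (ψ ∘ r) f` of `C_c(G)` by continuous functions on the unit
space, that is, the action of the multipliers of `C_c(G)` that live on the unit space. -/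
def CcAlg.diag : C(UnitSpace G, ℂ) →ₗ[ℂ] CcAlg G →ₗ[ℂ] CcAlg G :=
  LinearMap.mk₂ ℂ (fun ψ f => .mk (diagMul ψ f.fn) (diagMul_mem_Cc ψ.continuous f.fn_mem))
    (fun _ _ _ => CcAlg.ext (funext fun _ => add_mul _ _ _))
    (fun _ _ _ => CcAlg.ext (funext fun _ => _root_.mul_assoc _ _ _))
    (fun _ _ _ => CcAlg.ext (funext fun _ => mul_add _ _ _))
    (fun _ _ _ => CcAlg.ext (funext fun _ => mul_left_comm _ _ _))

namespace CcAlg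

theorem fn_diag (ψ : C(UnitSpace G, ℂ)) (f : CcAlg G) : (diag ψ f).fn = diagMul ψ f.fn := rfl

theorem diag_one (f : CcAlg G) : diag 1 f = f :=
  CcAlg.ext (funext fun _ => one_mul _)

theorem diag_mul (ψ : C(UnitSpace G, ℂ)) (a b : CcAlg G) : diag ψ (a * b) = diag ψ a * b :=
  CcAlg.ext (diagMul_conv ψ a.fn b.fn).symm

theorem star_diag_mul_diag (ψ ψ' : C(UnitSpace G, ℂ)) (a b : CcAlg G) :
    star (diag ψ a) * diag ψ' b = star a * diag (star ψ * ψ') b :=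
  CcAlg.ext (conv_invol_diagMul ψ ψ' a.fn b.fn)

theorem unitsHom_mul (χ : C_c(UnitSpace G, ℂ)) (f : CcAlg G) :
    unitsHom χ * f = diag (χ : C(UnitSpace G, ℂ)) f :=
  CcAlg.ext (conv_extendUnits_left χ f.fn)

end CcAlg

end Etale

end ArrowGroupoid

namespace CcOn

variable {G : Type*} [TopologicalSpace G] {V : Set G} {f : G → ℂ}

theorem of_continuousOn {O : Set G} [T2Space O] (hV : IsOpen V) (hf : ContinuousOn f V)
    {K : Set G} (hK : IsCompact K) (hKVO : K ⊆ V ∩ O) (h0 : ∀ g ∉ K, f g = 0) : f ∈ CcOn O := by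
  refine mem_CcOn_iff.2 ⟨fun g hg => ?_, K, hKVO.trans Set.inter_subset_right, hK, h0⟩
  by_cases hgK : g ∈ K
  · exact (hf.continuousAt (hV.mem_nhds (hKVO hgK).1)).continuousWithinAt
  · have hKc : IsClosed (Subtype.val ⁻¹' K : Set O) := by
      refine (Subtype.isCompact_iff.2 ?_).isClosed
      rwa [Subtype.image_preimage_coe, Set.inter_eq_right.2 fun _ h => (hKVO h).2]
    have hKg : Kᶜ ∈ nhdsWithin g O :=
      (preimage_coe_mem_nhds_subtype (a := ⟨g, hg⟩)).1 (hKc.isOpen_compl.mem_nhds hgK)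
    exact continuousWithinAt_const.congr_of_eventuallyEq (Filter.mem_of_superset hKg h0)
      (h0 g hgK)

theorem exists_partition_of_unity [T2Space V] [LocallyCompactSpace G] (hV : IsOpen V) {K : Set V}
    (hK : IsCompact K) {n : ℕ} {B : Fin n → Set G} (hB : ∀ i, IsOpen (B i))
    (hKB : ∀ v ∈ K, ∃ i, (v : G) ∈ B i) :
    ∃ R : Fin n → G → ℂ, (∀ i, ContinuousOn (R i) V) ∧
      (∀ i, ∃ L ⊆ V ∩ B i, IsCompact L ∧ ∀ g ∉ L, R i g = 0) ∧
      (∀ i g, ‖R i g‖ ≤ 1) ∧ ∀ v ∈ K, ∑ i, R i v = 1 := by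
  have : LocallyCompactSpace V := hV.locallyCompactSpace
  obtain ⟨ρ, hρB, hρ1, hρ01, hρc⟩ := exists_continuous_sum_one_of_isOpen_isCompact
    (s := fun i => (Subtype.val ⁻¹' B i : Set V))
    (fun i => (hB i).preimage continuous_subtype_val) hK
    (fun v hv => Set.mem_iUnion.2 (hKB v hv))
  let R (i : Fin n) : G → ℂ := Function.extend (Subtype.val : V → G) (fun v => (ρ i v : ℂ)) 0
  have hR (i : Fin n) (v : V) : R i v = ρ i v := Subtype.val_injective.extend_apply _ _ v
  have hR0 (i : Fin n) (g : G) (hg : g ∉ Subtype.val '' tsupport (ρ i)) : R i g = 0 := by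
    by_cases hgV : g ∈ V
    · rw [hR i ⟨g, hgV⟩, image_eq_zero_of_notMem_tsupport fun h => hg ⟨_, h, rfl⟩,
        Complex.ofReal_zero]
    · exact Function.extend_apply' _ _ _ fun ⟨v, hv⟩ => hgV (hv ▸ v.2)
  refine ⟨R, fun i => ?_, fun i => ⟨Subtype.val '' tsupport (ρ i), ?_,
    (hρc i).isCompact.image continuous_subtype_val, hR0 i⟩, fun i g => ?_, fun v hv => ?_⟩
  · rw [continuousOn_iff_continuous_domRestrict, show V.domRestrict (R i) = _ from funext (hR i)]
    exact Complex.continuous_ofReal.comp (ρ i).continuous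
  · rintro _ ⟨v, hv, rfl⟩
    exact ⟨v.2, hρB i hv⟩
  · by_cases hg : g ∈ Subtype.val '' tsupport (ρ i)
    · obtain ⟨v, -, rfl⟩ := hg
      rw [hR, Complex.norm_real, Real.norm_of_nonneg (hρ01 i v).1]
      exact (hρ01 i v).2
    · rw [hR0 i g hg, norm_zero]
      exact zero_le_one
  · simp only [hR, ← Complex.ofReal_sum, ← Finset.sum_apply, hρ1 hv, Pi.one_apply,
      Complex.ofReal_one]

theorem exists_sum_decomposition [T2Space V] [LocallyCompactSpace G] (hV : IsOpen V)
    (hf : f ∈ CcOn V) {n : ℕ} {B : Fin n → Set G} (hBo : ∀ i, IsOpen (B i))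
    (hBT : ∀ i, T2Space (B i)) {W : Set G} (hW : IsOpen W) {δ : ℝ} (hδ : 0 < δ)
    (h : ∀ g ∉ W, δ ≤ ‖f g‖ → ∃ i, g ∈ B i) :
    ∃ (F : Fin n → G → ℂ) (e : G → ℂ), f = ∑ i, F i + e ∧ (∀ i, F i ∈ CcOn (B i)) ∧
      e ∈ CcOn V ∧ ∀ g ∉ W, ‖e g‖ < (n + 1) * δ := by
  have hK : IsCompact ({v : V | δ ≤ ‖f v‖} ∩ Subtype.val ⁻¹' Wᶜ) :=
    (isCompact_le hf hδ).inter_right (hW.isClosed_compl.preimage continuous_subtype_val)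
  obtain ⟨R, hRc, hR0, hR_le, hR1⟩ := exists_partition_of_unity hV hK hBo
    fun v hv => h v hv.2 hv.1
  have hfc := (mem_CcOn_iff.1 hf).1
  refine ⟨fun i g => R i g * f g, fun g => (1 - ∑ i, R i g) * f g, ?_, fun i => ?_,
    mul_left hf (continuousOn_const.sub (continuousOn_finsetSum _ fun i _ => hRc i)),
    fun g hg => ?_⟩
  · funext g
    simp only [Pi.add_apply, Finset.sum_apply, ← Finset.sum_mul]
    ring
  · obtain ⟨L, hL, hLc, hL0⟩ := hR0 i
    have := hBT i
    exact of_continuousOn hV ((hRc i).mul hfc) hLc hL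
      fun g hg => by simp only [hL0 g hg, zero_mul]
  · have hpos : 0 < ((n : ℝ) + 1) * δ := by positivity
    have hcoeff : ‖1 - ∑ i, R i g‖ ≤ n + 1 := by
      refine (norm_sub_le _ _).trans ?_
      rw [norm_one, add_comm]
      gcongr
      exact (norm_sum_le_of_le _ fun i _ => hR_le i g).trans_eq (by simp)
    change ‖(1 - ∑ i, R i g) * f g‖ < _
    by_cases hgV : g ∈ V
    · by_cases hge : δ ≤ ‖f g‖
      · have hR1g : ∑ i, R i g = 1 := hR1 ⟨g, hgV⟩ ⟨hge, hg⟩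
        rwa [hR1g, sub_self, zero_mul, norm_zero]
      · rw [norm_mul]
        exact mul_lt_mul' hcoeff (not_le.1 hge) (norm_nonneg _) (by positivity)
    · rwa [eq_zero_of_mem_CcOn hf hgV, mul_zero, norm_zero]

end CcOn

namespace ArrowGroupoid

variable {G : Type*} [TopologicalSpace G] [ArrowGroupoid G] [IsLCEtaleGroupoid G]

namespace CcAlg

/-- The functions in `C_c(U)` as elements of the convolution algebra. -/
def supported (U : Set G) : Submodule ℂ (CcAlg G) where
  carrier := {f | f.fn ∈ Cc U}
  add_mem' h₁ h₂ := (Cc U).add_mem h₁ h₂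
  zero_mem' := (Cc U).zero_mem
  smul_mem' c _ h := (Cc U).smul_mem c h

/-- An element of `C_c(B)`, for an open bisection `B`, as an element of the convolution algebra. -/
def ofBisection {B : Set G} (hB : IsOpenBisection B) (f : G → ℂ) (hf : f ∈ CcOn B) : CcAlg G :=
  have := hB.t2
  .mk f (CcOn_le_Cc (Set.subset_univ _) hB.isOpen hf)

theorem fn_ofBisection {B : Set G} (hB : IsOpenBisection B) (f : G → ℂ) (hf : f ∈ CcOn B) :
    (ofBisection hB f hf).fn = f := rfl

theorem fn_sum {ι : Type*} (t : Finset ι) (F : ι → CcAlg G) :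
    (∑ i ∈ t, F i).fn = ∑ i ∈ t, (F i).fn :=
  map_sum (Cc (Set.univ : Set G)).subtype F t

theorem exists_eq_sum {U : Set G} {f : CcAlg G} (hf : f ∈ supported U) :
    ∃ (n : ℕ) (B : Fin n → Set G) (F : Fin n → CcAlg G), (∀ i, IsOpenBisection (B i)) ∧
      (∀ i, B i ⊆ U) ∧ (∀ i, (F i).fn ∈ CcOn (B i)) ∧ f = ∑ i, F i := by
  have hf : f.fn ∈ Cc U := hf
  rw [Cc_eq_span, Submodule.mem_span_set'] at hf
  obtain ⟨n, c, g, h⟩ := hf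
  choose B hB hBU hg using fun i => (g i).2
  have := fun i => (hB i).t2
  refine ⟨n, B, fun i => c i • ofBisection (hB i) (g i) (hg i), hB, hBU,
    fun i => CcOn.smul _ (hg i), CcAlg.ext ?_⟩
  rw [← h, fn_sum]
  rfl

end CcAlg

section Vanishing

variable {W : Set G} {q : CStarSeminorm (CcAlg G)}

theorem seminorm_le_of_norm_lt_off (hW : IsOpen W) (hq : ∀ a ∈ CcAlg.supported W, q a = 0)
    {B : Set G} (hB : IsOpenBisection B) {f : CcAlg G} (hf : f.fn ∈ CcOn B) {δ : ℝ} (hδ : 0 < δ)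
    (h : ∀ g ∉ W, ‖f.fn g‖ < δ) : q f ≤ δ := by
  have := hB.t2
  have hBW : IsOpenBisection (B ∩ W) := ⟨hB.isOpen.inter hW,
    hB.injOn_r.mono Set.inter_subset_left, hB.injOn_s.mono Set.inter_subset_left⟩
  have := hBW.t2
  obtain ⟨f₁, hf₁, f₂, hf₂, hf_eq, hle⟩ := CcOn.exists_truncation hf hδ h
  have hsum : f = CcAlg.ofBisection hBW f₁ hf₁ + CcAlg.ofBisection hB f₂ hf₂ := CcAlg.ext hf_eq
  calc q f ≤ q (CcAlg.ofBisection hBW f₁ hf₁) + q (CcAlg.ofBisection hB f₂ hf₂) := by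
        rw [hsum]
        exact map_add_le_add q.toSeminorm _ _
    _ ≤ 0 + δ := add_le_add
        (hq _ (show f₁ ∈ Cc W from CcOn_le_Cc Set.inter_subset_right hBW.isOpen hf₁)).le
        (q.le_of_mem_CcOn (f := CcAlg.ofBisection hB f₂ hf₂) hB hf₂ hδ.le hle)
    _ = δ := zero_add δ

theorem exists_sum_castSucc_add {n : ℕ} (hW : IsOpen W) {B : Fin (n + 1) → Set G}
    {F : Fin (n + 1) → CcAlg G} (hB : ∀ i, IsOpenBisection (B i))
    (hF : ∀ i, (F i).fn ∈ CcOn (B i)) {ε : ℝ} (hε : 0 < ε)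
    (h : ∀ g ∉ W, ‖(∑ i, F i).fn g‖ ≤ ε) :
    ∃ (H : Fin n → CcAlg G) (E : CcAlg G), ∑ i, F i = ∑ i, H i + E ∧
      (∀ i, (H i).fn ∈ CcOn (B i.castSucc)) ∧ E.fn ∈ CcOn (B (Fin.last n)) ∧
      ∀ g ∉ W, ‖E.fn g‖ < (n + 1) * (2 * ε) := by
  have : LocallyCompactSpace G := IsLCEtaleGroupoid.locallyCompact
  have hBT := fun i => (hB i).t2
  -- Off the other bisections the last summand is the whole sum, hence small there.
  have hcover (g : G) (hg : g ∉ W) (hge : 2 * ε ≤ ‖(F (Fin.last n)).fn g‖) :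
      ∃ i : Fin n, g ∈ B i.castSucc := by
    by_contra! hn
    have hg_le := h g hg
    rw [CcAlg.fn_sum, Finset.sum_apply, Fin.sum_univ_castSucc,
      Finset.sum_eq_zero fun i _ => eq_zero_of_mem_CcOn (hF _) (hn i), zero_add] at hg_le
    linarith
  obtain ⟨F', e, hlast, hF', he, he_lt⟩ := CcOn.exists_sum_decomposition (hB (Fin.last n)).isOpen
    (hF (Fin.last n)) (fun i => (hB _).isOpen) (fun i => hBT _) hW (by positivity) hcover
  refine ⟨fun i => F i.castSucc + CcAlg.ofBisection (hB i.castSucc) (F' i) (hF' i),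
    CcAlg.ofBisection (hB _) e he, CcAlg.ext ?_, fun i => CcOn.add (hF _) (hF' i), he, he_lt⟩
  simp only [Finset.sum_add_distrib, CcAlg.fn_add, CcAlg.fn_sum, CcAlg.fn_ofBisection,
    Fin.sum_univ_castSucc, hlast, add_assoc]

theorem exists_seminorm_sum_le (hW : IsOpen W) (hq : ∀ a ∈ CcAlg.supported W, q a = 0) (n : ℕ) :
    ∃ C : ℝ, ∀ (B : Fin n → Set G) (F : Fin n → CcAlg G), (∀ i, IsOpenBisection (B i)) →
      (∀ i, (F i).fn ∈ CcOn (B i)) → ∀ ε > 0, (∀ g ∉ W, ‖(∑ i, F i).fn g‖ ≤ ε) →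
      q (∑ i, F i) ≤ C * ε := by
  induction n with
  | zero =>
    refine ⟨0, fun B F _ _ ε _ _ => ?_⟩
    rw [Finset.univ_eq_empty, Finset.sum_empty, zero_mul]
    exact (map_zero q.toSeminorm).le
  | succ n ih =>
    obtain ⟨C, ih⟩ := ih
    refine ⟨C * (1 + (n + 1) * 2) + (n + 1) * 2, fun B F hB hF ε hε h => ?_⟩
    obtain ⟨H, E, hsum, hH, hE, hE_lt⟩ := exists_sum_castSucc_add hW hB hF hε h
    have hH_le (g : G) (hg : g ∉ W) : ‖(∑ i, H i).fn g‖ ≤ (1 + (n + 1) * 2) * ε :=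
      calc ‖(∑ i, H i).fn g‖ = ‖(∑ i, F i).fn g - E.fn g‖ := by
            rw [hsum, CcAlg.fn_add, Pi.add_apply, add_sub_cancel_right]
        _ ≤ ‖(∑ i, F i).fn g‖ + ‖E.fn g‖ := norm_sub_le _ _
        _ ≤ ε + (n + 1) * (2 * ε) := add_le_add (h g hg) (hE_lt g hg).le
        _ = (1 + (n + 1) * 2) * ε := by ring
    calc q (∑ i, F i) ≤ q (∑ i, H i) + q E := by
          rw [hsum]
          exact map_add_le_add q.toSeminorm _ _
      _ ≤ C * ((1 + (n + 1) * 2) * ε) + (n + 1) * (2 * ε) := add_le_add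
          (ih _ H (fun i => hB _) hH _ (by positivity) hH_le)
          (seminorm_le_of_norm_lt_off hW hq (hB _) hE (by positivity) hE_lt)
      _ = (C * (1 + (n + 1) * 2) + (n + 1) * 2) * ε := by ring

theorem seminorm_eq_zero_of_eq_zero_off (hW : IsOpen W) (hq : ∀ a ∈ CcAlg.supported W, q a = 0)
    {f : CcAlg G} (hf : ∀ g ∉ W, f.fn g = 0) : q f = 0 := by
  obtain ⟨n, B, F, hB, -, hF, rfl⟩ := CcAlg.exists_eq_sum f.fn_mem
  obtain ⟨C, hC⟩ := exists_seminorm_sum_le hW hq n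
  have hlim : Filter.Tendsto (fun ε => C * ε) (nhdsWithin 0 (Set.Ioi 0)) (nhds 0) := by
    simpa using ((continuous_const_mul C).tendsto 0).mono_left nhdsWithin_le_nhds
  refine le_antisymm (ge_of_tendsto hlim (eventually_mem_nhdsWithin.mono fun ε (hε : 0 < ε) =>
    hC B F hB hF ε hε fun g hg => ?_)) (q.nonneg _)
  rw [hf g hg, norm_zero]
  exact hε.le

end Vanishing

end ArrowGroupoid

theorem exists_bump_of_isCompact {Y : Type*} [TopologicalSpace Y] [T2Space Y]
    [LocallyCompactSpace Y] {K U : Set Y} (hK : IsCompact K) (hU : IsOpen U) (hKU : K ⊆ U) :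
    ∃ χ : C_c(Y, ℂ), Set.EqOn χ 1 K ∧ tsupport χ ⊆ U := by
  obtain ⟨f, hf1, hfc, hfU, -⟩ := exists_continuousMap_one_of_isCompact_subset_isOpen hK hU hKU
  have hsupp : tsupport (fun y => (f y : ℂ)) ⊆ tsupport f :=
    tsupport_comp_subset Complex.ofReal_zero f
  refine ⟨⟨⟨fun y => f y, by fun_prop⟩, hfc.of_isClosed_subset (isClosed_tsupport _) hsupp⟩,
    fun y hy => ?_, hsupp.trans hfU⟩
  change (f y : ℂ) = 1
  rw [hf1 hy, Pi.one_apply, Complex.ofReal_one]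

namespace ArrowGroupoid

variable {G : Type*} [TopologicalSpace G] [ArrowGroupoid G] [IsLCEtaleGroupoid G]
  {U : Set (UnitSpace G)}

namespace CcAlg

theorem diag_mem_supported (hU : IsOpen U) {χ : C_c(UnitSpace G, ℂ)} (hχ : tsupport χ ⊆ U)
    (f : CcAlg G) :
    diag (χ : C(UnitSpace G, ℂ)) f ∈ supported {g : G | r g ∈ U} := by
  obtain ⟨n, B, F, hB, -, hF, rfl⟩ := exists_eq_sum f.fn_mem
  rw [map_sum]
  refine Submodule.sum_mem _ fun i _ => ?_
  have := (hB i).t2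
  have := t2Space_of_subset (Set.inter_subset_left (s := B i) (t := {g : G | r g ∈ U}))
  have hU' : IsOpen {g : G | r g ∈ U} := hU.preimage continuous_r
  obtain ⟨hc, K, hKB, hK, h0⟩ := mem_CcOn_iff.1 (hF i)
  refine CcOn_le_Cc Set.inter_subset_right ((hB i).isOpen.inter hU')
    (CcOn.of_continuousOn (K := K ∩ r ⁻¹' tsupport χ) (hB i).isOpen
      ((χ.continuous.comp continuous_r).continuousOn.mul hc)
      (hK.inter_right ((isClosed_tsupport χ).preimage continuous_r))
      (fun g hg => ⟨hKB hg.1, hKB hg.1, hχ hg.2⟩) fun g hg => ?_)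
  by_cases hgK : g ∈ K
  · exact mul_eq_zero_of_left (image_eq_zero_of_notMem_tsupport fun h => hg ⟨hgK, h⟩) _
  · exact mul_eq_zero_of_right _ (h0 g hgK)

theorem exists_isCompact_of_mem_supported {f : CcAlg G} (hf : f ∈ supported {g : G | r g ∈ U}) :
    ∃ L ⊆ U, IsCompact L ∧ ∀ g, f.fn g ≠ 0 → r g ∈ L := by
  obtain ⟨n, B, F, hB, hBU, hF, rfl⟩ := exists_eq_sum hf
  have := fun i => (hB i).t2
  choose _ K hKB hK h0 using fun i => mem_CcOn_iff.1 (hF i)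
  refine ⟨⋃ i, r '' K i, Set.iUnion_subset fun i => ?_,
    isCompact_iUnion fun i => (hK i).image continuous_r, fun g hg => ?_⟩
  · rintro _ ⟨g, hg, rfl⟩
    exact hBU i (hKB i hg)
  · rw [fn_sum, Finset.sum_apply] at hg
    obtain ⟨i, -, hi⟩ := Finset.exists_ne_zero_of_sum_ne_zero hg
    exact Set.mem_iUnion.2 ⟨i, g, not_not.1 fun hn => hi (h0 i g hn), rfl⟩

theorem exists_diag_eq_self (hU : IsOpen U) {f : CcAlg G}
    (hf : f ∈ supported {g : G | r g ∈ U}) :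
    ∃ χ : C_c(UnitSpace G, ℂ), tsupport χ ⊆ U ∧ diag (χ : C(UnitSpace G, ℂ)) f = f := by
  obtain ⟨L, hLU, hL, h⟩ := exists_isCompact_of_mem_supported hf
  obtain ⟨χ, hχ1, hχU⟩ := exists_bump_of_isCompact hL hU hLU
  refine ⟨χ, hχU, CcAlg.ext (funext fun g => ?_)⟩
  change χ (r g) * f.fn g = f.fn g
  by_cases hg : f.fn g = 0
  · rw [hg, mul_zero]
  · rw [hχ1 (h g hg), Pi.one_apply, one_mul]

theorem mul_mem_supported_left (hU : IsOpen U) {f : CcAlg G}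
    (hf : f ∈ supported {g : G | r g ∈ U}) (h : CcAlg G) :
    f * h ∈ supported {g : G | r g ∈ U} := by
  obtain ⟨χ, hχU, hχ⟩ := exists_diag_eq_self hU hf
  rw [← hχ, ← diag_mul]
  exact diag_mem_supported hU hχU _

theorem star_mem_supported (hX : IsInvariant U) {f : CcAlg G}
    (hf : f ∈ supported {g : G | r g ∈ U}) : star f ∈ supported {g : G | r g ∈ U} := by
  obtain ⟨n, B, F, hB, hBU, hF, rfl⟩ := exists_eq_sum hf
  rw [star_sum]
  refine Submodule.sum_mem _ fun i _ => ?_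
  have := (hB i).preimage_inv.t2
  refine CcOn_le_Cc (fun g hg => (hX g).2 ?_) (hB i).preimage_inv.isOpen
    (invol_mem_CcOn (hB i) (hF i))
  rw [← show r (inv g) = s g from Subtype.ext (rng_inv g)]
  exact hBU i hg

theorem isStarIdeal_supported (hU : IsOpen U) (hX : IsInvariant U) :
    IsStarIdeal (supported {g : G | r g ∈ U}) where
  mul_mem_left a f hf := by
    have h := star_mem_supported hX
      (mul_mem_supported_left hU (star_mem_supported hX hf) (star a))
    rwa [star_mul, star_star, star_star] at h
  star_mem _ := star_mem_supported hX

end CcAlg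

/-- The closure in `C*(G)` of the functions in `C_c(r⁻¹(U))`, which is the ideal of `C*(G)`
attached to an open invariant set `U` of units. -/
def idealOver (U : Set (UnitSpace G)) : Submodule ℂ (FullCStar G) :=
  ((CcAlg.supported {g : G | r g ∈ U}).map
    ((ofCc : CcAlg G →⋆ₙₐ[ℂ] FullCStar G) : CcAlg G →ₗ[ℂ] FullCStar G)).topologicalClosure

theorem isClosed_idealOver (U : Set (UnitSpace G)) : IsClosed (idealOver U : Set (FullCStar G)) :=
  isClosed_closure

theorem isStarIdeal_idealOver (hU : IsOpen U) (hX : IsInvariant U) : IsStarIdeal (idealOver U) :=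
  (CcAlg.isStarIdeal_supported hU hX).topologicalClosure_map (CStarSeminorm.denseRange_toCompl _)

end ArrowGroupoid

theorem exists_comp_eq_of_isClosedEmbedding {Y Z : Type*} [TopologicalSpace Y] [T2Space Y]
    [LocallyCompactSpace Y] [TopologicalSpace Z] {i : Z → Y} (hi : Topology.IsClosedEmbedding i)
    (φ : C_c(Z, ℂ)) : ∃ Φ : C_c(Y, ℂ), Φ ∘ i = φ := by
  obtain ⟨χ, hχ, -⟩ := exists_bump_of_isCompact
    (φ.hasCompactSupport.isCompact.image hi.continuous) isOpen_univ (Set.subset_univ _)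
  let S : Set Z := i ⁻¹' tsupport χ
  have : CompactSpace S :=
    isCompact_iff_compactSpace.1 (hi.isCompact_preimage χ.hasCompactSupport.isCompact)
  have hj : Topology.IsClosedEmbedding fun z : S => (i z : OnePoint Y) :=
    (OnePoint.continuous_coe.comp (hi.continuous.comp continuous_subtype_val)).isClosedEmbedding
      (OnePoint.coe_injective.comp (hi.injective.comp Subtype.val_injective))
  obtain ⟨Ψ, hΨ⟩ := ContinuousMap.exists_extension hj ((φ : C(Z, ℂ)).restrict S)
  have hΨS (z : Z) (hz : z ∈ S) : Ψ (i z) = φ z := congrArg (fun k : C(S, ℂ) => k ⟨z, hz⟩) hΨ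
  refine ⟨⟨⟨fun y => χ y * Ψ y, χ.continuous.mul (Ψ.continuous.comp OnePoint.continuous_coe)⟩,
    χ.hasCompactSupport.mul_right⟩, funext fun z => ?_⟩
  change χ (i z) * Ψ (i z) = φ z
  by_cases hzφ : z ∈ tsupport φ
  · rw [hχ ⟨z, hzφ, rfl⟩, Pi.one_apply, one_mul]
    exact hΨS z (subset_tsupport χ (by simp [hχ ⟨z, hzφ, rfl⟩]))
  · have hφz := image_eq_zero_of_notMem_tsupport hzφ
    by_cases hzS : z ∈ S
    · rw [hΨS z hzS, hφz, mul_zero]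
    · rw [hφz, image_eq_zero_of_notMem_tsupport hzS, zero_mul]

theorem CcOn.exists_comp_eq {G Y : Type*} [TopologicalSpace G] [LocallyCompactSpace G]
    [TopologicalSpace Y] {e : Y → G} (he : Topology.IsClosedEmbedding e) {V : Set G}
    (hV : IsOpen V) [T2Space V] {f : Y → ℂ} (hf : f ∈ CcOn (e ⁻¹' V)) :
    ∃ F ∈ CcOn V, F ∘ e = f := by
  have : LocallyCompactSpace V := hV.locallyCompactSpace
  obtain ⟨φ, rfl⟩ := hf
  obtain ⟨Φ, hΦ⟩ := exists_comp_eq_of_isClosedEmbedding (he.restrictPreimage V) φ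
  refine ⟨_, ⟨Φ, rfl⟩, funext fun y => ?_⟩
  by_cases hy : e y ∈ V
  · exact (Subtype.val_injective.extend_apply Φ 0 ⟨e y, hy⟩).trans <|
      (congrFun hΦ ⟨y, hy⟩).trans (Subtype.val_injective.extend_apply φ 0 ⟨y, hy⟩).symm
  · have hyV : ¬∃ v : V, (v : G) = e y := fun ⟨v, hv⟩ => hy (hv ▸ v.2)
    have hyV' : ¬∃ v : e ⁻¹' V, (v : Y) = y := fun ⟨v, hv⟩ => hy (hv ▸ v.2)
    rw [Function.comp_apply, Function.extend_apply' _ _ _ hyV, Function.extend_apply' _ _ _ hyV',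
      Pi.zero_apply, Pi.zero_apply]

namespace ArrowGroupoid

section ClosedReduction

variable {G : Type*} [TopologicalSpace G] [ArrowGroupoid G] [IsLCEtaleGroupoid G]
  {X : Set (UnitSpace G)} (hX : IsInvariant X) (hc : IsClosed X)

theorem restrictCc_surjective : Function.Surjective (restrictCc hX hc) := by
  let v := Reduction.val hX hc.isLocallyClosed
  have he : Topology.IsClosedEmbedding v := isClosedEmbedding_val hX hc
  have : LocallyCompactSpace G := IsLCEtaleGroupoid.locallyCompact
  have : LocallyCompactSpace (Reduction X hX hc.isLocallyClosed) :=
    IsLCEtaleGroupoid.locallyCompact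
  have hrange : Cc (Set.univ : Set (Reduction X hX hc.isLocallyClosed)) ≤
      (Cc (Set.univ : Set G)).map (LinearMap.funLeft ℂ ℂ v) := by
    rw [Cc_eq_span]
    refine Submodule.span_le.2 ?_
    rintro f ⟨V, hV, -, hf⟩
    have := hV.t2
    have hcover (g) (hg : g ∈ V) : ∃ S, g ∈ S ∧ IsOpen S ∧ S ⊆ V ∧
        ∃ B : Set G, IsOpenBisection B ∧ v ⁻¹' B = S := by
      obtain ⟨O, hO, rfl⟩ := he.isInducing.isOpen_iff.1 hV.isOpen
      obtain ⟨B, hgB, hBo, hBO, hB⟩ := exists_bisection hO (show v g ∈ O from hg)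
      exact ⟨v ⁻¹' B, hgB, hBo.preimage he.continuous, Set.preimage_mono hBO, B, hB, rfl⟩
    refine Submodule.span_le.2 ?_ (CcOn_mem_span hV.isOpen _ hcover hf)
    rintro f ⟨_, -, -, ⟨B, hB, rfl⟩, hf⟩
    have := hB.t2
    obtain ⟨F, hF, hFf⟩ := CcOn.exists_comp_eq he hB.isOpen hf
    exact ⟨F, CcOn_le_Cc (Set.subset_univ _) hB.isOpen hF, hFf⟩
  intro f
  obtain ⟨F, hF, hFf⟩ := hrange f.fn_mem
  exact ⟨.mk F hF, CcAlg.ext hFf⟩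

theorem continuous_restrictHom : Continuous (restrictHom hX hc) :=
  (EnvelopingCStar.liftL _).continuous

theorem restrictHom_eq_zero_of_mem_idealOver {a : FullCStar G} (ha : a ∈ idealOver Xᶜ) :
    restrictHom hX hc a = 0 := by
  refine closure_minimal ?_ (isClosed_eq (continuous_restrictHom hX hc) continuous_const) ha
  rintro _ ⟨f, hf, rfl⟩
  have hf0 : restrictCc hX hc f = 0 := CcAlg.ext (funext fun g =>
    eq_zero_of_mem_Cc hf (not_not.2 (Reduction.r_val_mem hX hc.isLocallyClosed g)))
  exact (restrictHom_ofCc hX hc f).trans (by rw [hf0, map_zero])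

theorem norm_mkQ_idealOver_le (a : FullCStar G) :
    ‖(idealOver Xᶜ).mkQ a‖ ≤ ‖restrictHom hX hc a‖ := by
  let Q := (isStarIdeal_idealOver hc.isOpen_compl hX.compl).quotientSeminorm
    (isClosed_idealOver Xᶜ)
  have hQ (f : CcAlg G) (hf : f ∈ CcAlg.supported {g : G | r g ∈ Xᶜ}) : Q.comap ofCc f = 0 := by
    have hmem : ofCc f ∈ idealOver Xᶜ := subset_closure ⟨f, hf, rfl⟩
    exact (congrArg norm ((Submodule.Quotient.mk_eq_zero _).2 hmem)).trans norm_zero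
  have hker (f : CcAlg G) (hf : restrictCc hX hc f = 0) : Q.comap ofCc f = 0 := by
    have hW : IsOpen {g : G | r g ∈ Xᶜ} := hc.isOpen_compl.preimage continuous_r
    refine seminorm_eq_zero_of_eq_zero_off hW hQ fun g hg => ?_
    exact congrArg (fun h => h.fn (Reduction.mk hX hc.isLocallyClosed g (not_not.1 hg))) hf
  obtain ⟨Q', hQ'⟩ := (Q.comap ofCc).exists_descend _ (restrictCc_surjective hX hc) hker
  refine (CStarSeminorm.denseRange_toCompl _).induction_on a (isClosed_le (by fun_prop)
    (continuous_restrictHom hX hc).norm) fun f => ?_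
  calc ‖(idealOver Xᶜ).mkQ (ofCc f)‖ = Q' (restrictCc hX hc f) := (hQ' f).symm
    _ ≤ maxCStarSeminorm _ (restrictCc hX hc f) := le_maxCStarSeminorm Q' _
    _ = ‖restrictHom hX hc (ofCc f)‖ := by rw [restrictHom_ofCc, CStarSeminorm.norm_toCompl]

theorem restrictHom_eq_zero_iff {a : FullCStar G} :
    restrictHom hX hc a = 0 ↔ a ∈ idealOver Xᶜ := by
  refine ⟨fun ha => ?_, restrictHom_eq_zero_of_mem_idealOver hX hc⟩
  have h := norm_mkQ_idealOver_le hX hc a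
  rw [ha, norm_zero] at h
  have hcl : IsClosed (idealOver Xᶜ : Set (FullCStar G)) := isClosed_idealOver Xᶜ
  rw [← SetLike.mem_coe, ← hcl.closure_eq]
  exact QuotientAddGroup.norm_mk_eq_zero_iff_mem_closure.1 (h.antisymm (norm_nonneg _))

theorem restrictHom_surjective : Function.Surjective (restrictHom hX hc) := by
  let φ := (idealOver Xᶜ).liftQ
    (restrictHom hX hc : FullCStar G →ₗ[ℂ] FullCStar (Reduction X hX hc.isLocallyClosed))
    fun _ ha => LinearMap.mem_ker.2 (restrictHom_eq_zero_of_mem_idealOver hX hc ha)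
  have hφc : Continuous φ :=
    (idealOver Xᶜ).isQuotientMap_mkQ.continuous_iff.2 (continuous_restrictHom hX hc)
  have hφ : AntilipschitzWith 1 φ := AddMonoidHomClass.antilipschitz_of_bound φ fun x => by
    obtain ⟨a, rfl⟩ := (idealOver Xᶜ).mkQ_surjective x
    rw [NNReal.coe_one, one_mul]
    exact norm_mkQ_idealOver_le hX hc a
  have hclosed : IsClosed (Set.range φ) := hφ.isClosed_range 
    (uniformContinuous_addMonoidHom_of_continuous hφc)
  have hdense : DenseRange φ := (CStarSeminorm.denseRange_toCompl _).mono <| by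
    rintro _ ⟨b, rfl⟩
    obtain ⟨f, rfl⟩ := restrictCc_surjective hX hc b
    exact ⟨(idealOver Xᶜ).mkQ (ofCc f), restrictHom_ofCc hX hc f⟩
  intro b
  obtain ⟨x, rfl⟩ := hclosed.closure_eq ▸ hdense b
  obtain ⟨a, rfl⟩ := (idealOver Xᶜ).mkQ_surjective x
  exact ⟨a, rfl⟩

end ClosedReduction

section OpenReduction

theorem RFin.comp_val {G : Type*} [TopologicalSpace G] [ArrowGroupoid G] {U : Set (UnitSpace G)}
    (hU : IsInvariant U) (hl : IsLocallyClosed U) {f : G → ℂ} (hf : RFin f) :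
    RFin (f ∘ Reduction.val hU hl) := fun x => by
  refine ((hf (Reduction.unitVal hU hl x)).preimage
    (Reduction.val_injective hU hl).injOn).subset ?_
  rintro g ⟨hg, hg'⟩
  exact ⟨congrArg (Reduction.unitVal hU hl) hg, hg'⟩

variable {G : Type*} [TopologicalSpace G] [ArrowGroupoid G] [IsLCEtaleGroupoid G]
  {U : Set (UnitSpace G)} (hU : IsInvariant U) (ho : IsOpen U)

theorem comp_val_mem_CcOn {B : Set G} [T2Space B] (hBU : B ⊆ {g : G | r g ∈ U}) {f : G → ℂ}
    (hf : f ∈ CcOn B) : f ∘ Reduction.val hU ho.isLocallyClosed ∈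
      CcOn (Reduction.val hU ho.isLocallyClosed ⁻¹' B) := by
  obtain ⟨hcont, K, hKB, hK, h0⟩ := mem_CcOn_iff.1 hf
  have he := isOpenEmbedding_val hU ho
  have : T2Space (Reduction.val hU ho.isLocallyClosed ⁻¹' B) :=
    t2Space_preimage he.continuous he.injective
  have hKrange : K ⊆ Set.range (Reduction.val hU ho.isLocallyClosed) := fun g hg =>
    ⟨Reduction.mk hU ho.isLocallyClosed g (hBU (hKB hg)), rfl⟩
  exact mem_CcOn_iff.2 ⟨hcont.comp he.continuous.continuousOn fun g hg => hg,
    Reduction.val hU ho.isLocallyClosed ⁻¹' K, Set.preimage_mono hKB,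
    (he.isInducing.isCompact_preimage_iff hKrange).2 hK, fun g hg => h0 _ hg⟩

theorem comp_val_mem_Cc_of_supported {f : CcAlg G} (hf : f ∈ CcAlg.supported {g : G | r g ∈ U}) :
    f.fn ∘ Reduction.val hU ho.isLocallyClosed ∈
      Cc (Set.univ : Set (Reduction U hU ho.isLocallyClosed)) := by
  obtain ⟨n, B, F, hB, hBU, hF, rfl⟩ := CcAlg.exists_eq_sum hf
  have he := isOpenEmbedding_val hU ho
  have hsum : (∑ i, F i).fn ∘ Reduction.val hU ho.isLocallyClosed =
      ∑ i, (F i).fn ∘ Reduction.val hU ho.isLocallyClosed := by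
    funext g
    simp only [CcAlg.fn_sum, Function.comp_apply, Finset.sum_apply]
  rw [hsum]
  refine Submodule.sum_mem _ fun i _ => ?_
  have := (hB i).t2
  have : T2Space (Reduction.val hU ho.isLocallyClosed ⁻¹' B i) :=
    t2Space_preimage he.continuous he.injective
  exact CcOn_le_Cc (Set.subset_univ _) ((hB i).isOpen.preimage he.continuous)
    (comp_val_mem_CcOn hU ho (hBU i) (hF i))

theorem exists_extendCc_eq {f : CcAlg G} (hf : f ∈ CcAlg.supported {g : G | r g ∈ U}) :
    ∃ h, extendCc hU ho h = f :=
  ⟨.mk _ (comp_val_mem_Cc_of_supported hU ho hf), CcAlg.ext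
    (Reduction.extendZero_unique hU ho.isLocallyClosed _ _ rfl fun _ hg => eq_zero_of_mem_Cc hf hg)⟩

theorem conv_comp_val_mem_Cc (f : CcAlg G) (h : CcAlg (Reduction U hU ho.isLocallyClosed)) :
    conv (f.fn ∘ Reduction.val hU ho.isLocallyClosed) h.fn ∈
      Cc (Set.univ : Set (Reduction U hU ho.isLocallyClosed)) := by
  have hmem : f * extendCc hU ho h ∈ CcAlg.supported {g : G | r g ∈ U} :=
    (CcAlg.isStarIdeal_supported ho hU).mul_mem_left f _ (extendZero_mem_Cc hU ho h.fn_mem)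
  have hval : (extendCc hU ho h).fn ∘ Reduction.val hU ho.isLocallyClosed = h.fn :=
    Reduction.extendZero_comp_val hU ho.isLocallyClosed h.fn
  have hconv := comp_val_mem_Cc_of_supported hU ho hmem
  rwa [CcAlg.fn_mul, ← Reduction.conv_comp_val, hval] at hconv

/-- The action of `C_c(G)` by left multipliers on `C_c(G_U)`, for an open invariant set `U`. -/
def leftAction : CcAlg G →ₗ[ℂ] CcAlg (Reduction U hU ho.isLocallyClosed) →ₗ[ℂ]
    CcAlg (Reduction U hU ho.isLocallyClosed) :=
  LinearMap.mk₂ ℂ (fun f h => .mk _ (conv_comp_val_mem_Cc hU ho f h))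
    (fun f₁ f₂ _ => CcAlg.ext (add_conv (f₁.rFin.comp_val hU _) (f₂.rFin.comp_val hU _)))
    (fun c f h => CcAlg.ext (smul_conv c (f.fn ∘ Reduction.val hU ho.isLocallyClosed) h.fn))
    (fun f _ _ => CcAlg.ext (conv_add (f.rFin.comp_val hU _)))
    (fun c f h => CcAlg.ext (conv_smul c (f.fn ∘ Reduction.val hU ho.isLocallyClosed) h.fn))

theorem fn_leftAction (f : CcAlg G) (h : CcAlg (Reduction U hU ho.isLocallyClosed)) :
    (leftAction hU ho f h).fn = conv (f.fn ∘ Reduction.val hU ho.isLocallyClosed) h.fn := rfl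

theorem leftAction_mul (f₁ f₂ : CcAlg G) (h : CcAlg (Reduction U hU ho.isLocallyClosed)) :
    leftAction hU ho (f₁ * f₂) h = leftAction hU ho f₁ (leftAction hU ho f₂ h) := by
  refine CcAlg.ext ?_
  rw [fn_leftAction, CcAlg.fn_mul, ← Reduction.conv_comp_val,
    conv_assoc (f₁.rFin.comp_val hU _) (f₂.rFin.comp_val hU _), fn_leftAction, fn_leftAction]

theorem star_leftAction_mul_leftAction (f : CcAlg G)
    (h k : CcAlg (Reduction U hU ho.isLocallyClosed)) :
    star (leftAction hU ho f h) * leftAction hU ho f k =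
      star h * leftAction hU ho (star f * f) k := by
  refine CcAlg.ext ?_
  rw [leftAction_mul, CcAlg.fn_mul, CcAlg.fn_star, fn_leftAction, invol_conv, ← CcAlg.fn_star h,
    Reduction.invol_comp_val, ← CcAlg.fn_star f,
    conv_assoc (star h).rFin ((star f).rFin.comp_val hU _), CcAlg.fn_mul,
    fn_leftAction hU ho (star f)]

theorem leftAction_extendCc (h k : CcAlg (Reduction U hU ho.isLocallyClosed)) :
    leftAction hU ho (extendCc hU ho h) k = h * k := by
  refine CcAlg.ext ?_
  rw [fn_leftAction, CcAlg.fn_mul]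
  exact congrArg (conv · k.fn) (Reduction.extendZero_comp_val hU ho.isLocallyClosed h.fn)

theorem extendUnits_comp_val (ψ : UnitSpace G → ℂ) :
    extendUnits ψ ∘ Reduction.val hU ho.isLocallyClosed =
      extendUnits (ψ ∘ Reduction.unitVal hU ho.isLocallyClosed) := by
  funext g
  by_cases hg : src g = g
  · exact (extendUnits_coe ψ (Reduction.unitVal hU ho.isLocallyClosed ⟨g, hg⟩)).trans
      (extendUnits_coe (ψ ∘ Reduction.unitVal hU ho.isLocallyClosed) ⟨g, hg⟩).symm
  · rw [Function.comp_apply, extendUnits_of_not _ hg, extendUnits_of_not]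
    exact fun e => hg (Reduction.ext_val hU ho.isLocallyClosed e)

/-- The inclusion of the unit space `U` of `G_U` into the unit space of `G`. -/
def unitInclusion : C(UnitSpace (Reduction U hU ho.isLocallyClosed), UnitSpace G) :=
  ⟨Reduction.unitVal hU ho.isLocallyClosed,
    (Reduction.isEmbedding_unitVal hU ho.isLocallyClosed).continuous⟩

theorem leftAction_unitsHom (φ : C_c(UnitSpace G, ℂ))
    (b : CcAlg (Reduction U hU ho.isLocallyClosed)) :
    leftAction hU ho (unitsHom φ) b =
      CcAlg.diag ((φ : C(UnitSpace G, ℂ)).comp (unitInclusion hU ho)) b := by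
  refine CcAlg.ext ?_
  rw [fn_leftAction, CcAlg.fn_diag]
  change conv (extendUnits φ ∘ Reduction.val hU ho.isLocallyClosed) b.fn = _
  rw [extendUnits_comp_val hU ho]
  exact conv_extendUnits_left _ b.fn

theorem leftAction_le_of_mem_CcOn {B : Set G} (hB : IsOpenBisection B) {f : CcAlg G}
    (hf : f.fn ∈ CcOn B) {M : ℝ} (hM0 : 0 ≤ M) (hM : ∀ g, ‖f.fn g‖ ≤ M)
    (p : CStarSeminorm (CcAlg (Reduction U hU ho.isLocallyClosed)))
    (b : CcAlg (Reduction U hU ho.isLocallyClosed)) :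
    p (leftAction hU ho f b) ≤ M * p b := by
  obtain ⟨φ, hφ, hφM⟩ := CcAlg.exists_star_mul_self_eq hB hf hM
  let ψ : C(_, ℂ) := (φ : C(UnitSpace G, ℂ)).comp (unitInclusion hU ho)
  let χ : C(UnitSpace (Reduction U hU ho.isLocallyClosed), ℂ) :=
    ⟨fun x => ((√(M ^ 2 - (ψ x).re) : ℝ) : ℂ), by fun_prop⟩
  have hsum : ψ + star χ * χ = ((M ^ 2 : ℝ) : ℂ) • 1 := by
    ext x
    obtain ⟨t, ⟨-, htM⟩, ht⟩ := hφM (unitInclusion hU ho x)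
    have hψ : ψ x = t := ht
    change ψ x + star ((√(M ^ 2 - (ψ x).re) : ℝ) : ℂ) * ((√(M ^ 2 - (ψ x).re) : ℝ) : ℂ) =
      ((M ^ 2 : ℝ) : ℂ) * 1
    rw [hψ, Complex.star_def, Complex.conj_ofReal, ← Complex.ofReal_mul, Complex.ofReal_re,
      Real.mul_self_sqrt (sub_nonneg.2 htM), mul_one, ← Complex.ofReal_add, add_sub_cancel]
  refine p.le_mul_of_star_mul_self_add (c := CcAlg.diag χ b) hM0 ?_
  calc star (leftAction hU ho f b) * leftAction hU ho f b +
        star (CcAlg.diag χ b) * CcAlg.diag χ b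
      = star b * CcAlg.diag ψ b + star b * CcAlg.diag (star χ * χ) b := by
        rw [star_leftAction_mul_leftAction, hφ, leftAction_unitsHom, CcAlg.star_diag_mul_diag]
    _ = star b * CcAlg.diag (((M ^ 2 : ℝ) : ℂ) • 1) b := by
        rw [← mul_add, ← LinearMap.add_apply, ← map_add, hsum]
    _ = ((M ^ 2 : ℝ) : ℂ) • (star b * b) := by
        rw [map_smul, LinearMap.smul_apply, CcAlg.diag_one, mul_smul_comm]

theorem exists_leftAction_le (p : CStarSeminorm (CcAlg (Reduction U hU ho.isLocallyClosed)))
    (f : CcAlg G) : ∃ C, ∀ b, p (leftAction hU ho f b) ≤ C * p b := by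
  obtain ⟨n, B, F, hB, -, hF, rfl⟩ := CcAlg.exists_eq_sum f.fn_mem
  refine Finset.sum_induction F (fun f => ∃ C, ∀ b, p (leftAction hU ho f b) ≤ C * p b) ?_ ?_ ?_
  · rintro f₁ f₂ ⟨C₁, h₁⟩ ⟨C₂, h₂⟩
    refine ⟨C₁ + C₂, fun b => ?_⟩
    rw [map_add, LinearMap.add_apply, add_mul]
    exact (map_add_le_add p.toSeminorm _ _).trans (add_le_add (h₁ b) (h₂ b))
  · refine ⟨0, fun b => ?_⟩
    rw [map_zero, LinearMap.zero_apply, zero_mul]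
    exact (map_zero p.toSeminorm).le
  · intro i _
    have := (hB i).t2
    obtain ⟨M, hM0, hM⟩ := CcOn.exists_norm_le (hF i)
    exact ⟨M, leftAction_le_of_mem_CcOn hU ho (hB i) (hF i) hM0 hM p⟩

theorem exists_le_comp_extendCc
    (p : CStarSeminorm (CcAlg (Reduction U hU ho.isLocallyClosed))) :
    ∃ q : CStarSeminorm (CcAlg G), ∀ h, p h ≤ q (extendCc hU ho h) := by
  obtain ⟨q, hq⟩ := p.exists_of_action (leftAction hU ho) (leftAction_mul hU ho)
    (fun f b => star_leftAction_mul_leftAction hU ho f b b) (exists_leftAction_le hU ho p)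
  refine ⟨q, fun h => ?_⟩
  have hle : p h * p h ≤ q (extendCc hU ho h) * p h := by
    have hstar := p.star_mul_self (star h)
    rw [star_star, p.star_eq, sq] at hstar
    calc p h * p h = p (leftAction hU ho (extendCc hU ho h) (star h)) := by
          rw [leftAction_extendCc, hstar]
      _ ≤ q (extendCc hU ho h) * p (star h) := hq _ _
      _ = q (extendCc hU ho h) * p h := by rw [p.star_eq]
  obtain hp | hp := (p.nonneg h).eq_or_lt
  · exact hp ▸ q.nonneg _
  · exact le_of_mul_le_mul_right hle hp

theorem extendHom_injective : Function.Injective (extendHom hU ho) := by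
  have hcont : Continuous (extendHom hU ho) := (EnvelopingCStar.liftL _).continuous
  have hle (a) : ‖a‖ ≤ ‖extendHom hU ho a‖ := by
    obtain ⟨q, hq⟩ := exists_le_comp_extendCc hU ho (maxCStarSeminorm _)
    refine (CStarSeminorm.denseRange_toCompl _).induction_on a
      (isClosed_le continuous_norm hcont.norm) fun h => ?_
    rw [extendHom_ofCc, CStarSeminorm.norm_toCompl, CStarSeminorm.norm_toCompl]
    exact (hq h).trans (le_maxCStarSeminorm q _)
  refine (injective_iff_map_eq_zero _).2 fun a ha => norm_le_zero_iff.1 ?_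
  exact (hle a).trans_eq (by rw [ha, norm_zero])

theorem range_extendHom :
    Set.range (extendHom hU ho) = (idealOver U : Set (FullCStar G)) := by
  have hiso : Isometry (extendHom hU ho) :=
    NonUnitalStarAlgHom.isometry (extendHom hU ho) (extendHom_injective hU ho)
  refine Set.Subset.antisymm ?_ (closure_minimal ?_ hiso.isClosedEmbedding.isClosed_range)
  · rintro _ ⟨a, rfl⟩
    refine map_mem_closure hiso.continuous (CStarSeminorm.denseRange_toCompl _ a) ?_
    rintro _ ⟨h, rfl⟩
    exact ⟨extendCc hU ho h, extendZero_mem_Cc hU ho h.fn_mem, (extendHom_ofCc hU ho h).symm⟩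
  · rintro _ ⟨f, hf, rfl⟩
    obtain ⟨h, rfl⟩ := exists_extendCc_eq hU ho hf
    exact ⟨ofCc h, extendHom_ofCc hU ho h⟩

end OpenReduction

end ArrowGroupoid

theorem isCompact_le_norm_zeroAtInfty {Y : Type*} [TopologicalSpace Y] (φ : C₀(Y, ℂ)) {ε : ℝ}
    (hε : 0 < ε) : IsCompact {y | ε ≤ ‖φ y‖} := by
  obtain ⟨K, hK, hKφ⟩ := Filter.mem_cocompact.1
    (φ.zero_at_infty'.eventually (Metric.ball_mem_nhds (0 : ℂ) hε))
  refine hK.of_isClosed_subset (isClosed_le continuous_const φ.continuous.norm)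
    fun y (hy : ε ≤ ‖φ y‖) => not_not.1 fun hn => hy.not_gt ?_
  exact mem_ball_zero_iff.1 (hKφ hn)

theorem exists_norm_sub_ccToCZero_le {Y : Type*} [TopologicalSpace Y] [T2Space Y] {U : Set Y}
    (φ : C₀(Y, ℂ)) (hφ : ∀ y ∉ U, φ y = 0) {ε : ℝ} (hε : 0 < ε) :
    ∃ χ : C_c(Y, ℂ), tsupport χ ⊆ U ∧ ‖φ - ccToCZero χ‖ ≤ ε := by
  have h0 (y : Y) (hy : y ∉ {y | ε ≤ ‖φ y‖}) : φ y - radialRetraction ε (φ y) = 0 := by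
    rw [radialRetraction_eq hε (not_le.1 hy).le, sub_self]
  let χ : C_c(Y, ℂ) := ⟨⟨fun y => φ y - radialRetraction ε (φ y),
    φ.continuous.sub ((continuous_radialRetraction hε).comp φ.continuous)⟩,
    HasCompactSupport.intro (isCompact_le_norm_zeroAtInfty φ hε) h0⟩
  have hχ : tsupport χ ⊆ {y | ε ≤ ‖φ y‖} :=
    closure_minimal (fun y hy => not_not.1 fun hn => hy (h0 y hn))
      (isCompact_le_norm_zeroAtInfty φ hε).isClosed
  refine ⟨χ, fun y hy => not_not.1 fun hn => hε.not_ge ?_, norm_le_of_bound _ hε.le fun y => ?_⟩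
  · have hle : ε ≤ ‖φ y‖ := hχ hy
    rwa [hφ y hn, norm_zero] at hle
  · change ‖φ y - (φ y - radialRetraction ε (φ y))‖ ≤ ε
    rw [sub_sub_cancel]
    exact norm_radialRetraction_le hε _

namespace ArrowGroupoid

variable {G : Type*} [TopologicalSpace G] [ArrowGroupoid G] [IsLCEtaleGroupoid G]
  {U : Set (UnitSpace G)}

theorem ofCZeroUnits_ccToCZero (χ : C_c(UnitSpace G, ℂ)) :
    ofCZeroUnits (ccToCZero χ) = ofCc (unitsHom χ) := extendCZero_apply _ χ

theorem unitsHom_mem_supported (hU : IsOpen U) {χ : C_c(UnitSpace G, ℂ)} (hχ : tsupport χ ⊆ U) :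
    unitsHom χ ∈ CcAlg.supported {g : G | r g ∈ U} := by
  obtain ⟨κ, hκ1, -⟩ := exists_bump_of_isCompact χ.hasCompactSupport.isCompact isOpen_univ
    (Set.subset_univ _)
  have hχκ : χ * κ = χ := by
    ext x
    change χ x * κ x = χ x
    by_cases hx : x ∈ tsupport χ
    · rw [hκ1 hx, Pi.one_apply, mul_one]
    · rw [image_eq_zero_of_notMem_tsupport hx, zero_mul]
  rw [← hχκ, map_mul, CcAlg.unitsHom_mul]
  exact CcAlg.diag_mem_supported hU hχ _

theorem ofCZeroUnits_mem_idealOver (hU : IsOpen U) {φ : C₀(UnitSpace G, ℂ)}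
    (hφ : ∀ x ∉ U, φ x = 0) : ofCZeroUnits φ ∈ idealOver U := by
  refine Metric.mem_closure_iff.2 fun ε hε => ?_
  obtain ⟨χ, hχU, hχ⟩ := exists_norm_sub_ccToCZero_le φ hφ (half_pos hε)
  refine ⟨ofCc (unitsHom χ), ⟨unitsHom χ, unitsHom_mem_supported hU hχU, rfl⟩, ?_⟩
  rw [dist_eq_norm, ← ofCZeroUnits_ccToCZero, ← map_sub]
  calc ‖ofCZeroUnits (φ - ccToCZero χ)‖ ≤ ‖φ - ccToCZero χ‖ :=
        NonUnitalStarAlgHom.norm_apply_le ofCZeroUnits _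
    _ ≤ ε / 2 := hχ
    _ < ε := half_lt_self hε

theorem ofCc_mem_closedIdealSpan (hU : IsOpen U) {f : CcAlg G}
    (hf : f ∈ CcAlg.supported {g : G | r g ∈ U}) : ofCc f ∈
      closedIdealSpan (ofCZeroUnits '' {φ : C₀(UnitSpace G, ℂ) | ∀ x ∉ U, φ x = 0}) := by
  refine Submodule.mem_sInf.2 fun I ⟨_, hI, hmul⟩ => ?_
  obtain ⟨χ, hχU, hχ⟩ := CcAlg.exists_diag_eq_self hU hf
  rw [← hχ, ← CcAlg.unitsHom_mul, map_mul, ← ofCZeroUnits_ccToCZero]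
  exact (hmul _ _ (hI ⟨ccToCZero χ, fun x hx =>
    image_eq_zero_of_notMem_tsupport fun h => hx (hχU h), rfl⟩)).2

theorem idealOver_eq_closedIdealSpan (hU : IsOpen U) (hX : IsInvariant U) :
    idealOver U =
      closedIdealSpan (ofCZeroUnits '' {φ : C₀(UnitSpace G, ℂ) | ∀ x ∉ U, φ x = 0}) := by
  have hI := isStarIdeal_idealOver hU hX
  refine le_antisymm (Submodule.topologicalClosure_minimal _ ?_ ?_) (sInf_le ⟨?_, ?_, ?_⟩)
  · rintro _ ⟨f, hf, rfl⟩
    exact ofCc_mem_closedIdealSpan hU hf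
  · rw [closedIdealSpan, Submodule.coe_sInf]
    exact isClosed_biInter fun I hI => hI.1
  · exact isClosed_idealOver U
  · rintro _ ⟨φ, hφ, rfl⟩
    exact ofCZeroUnits_mem_idealOver hU hφ
  · exact fun a b hb => ⟨hI.mul_mem_left a b hb, hI.mul_mem_right a hb⟩

end ArrowGroupoid

end

theorem proposition1p1 {G : Type*} [TopologicalSpace G] [ArrowGroupoid G] [IsLCEtaleGroupoid G]
    (X : Set (ArrowGroupoid.UnitSpace G)) (hc : IsClosed X) (hX : ArrowGroupoid.IsInvariant X) :
    {a : ArrowGroupoid.FullCStar G | ArrowGroupoid.restrictHom hX hc a = 0} =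
        closure (ArrowGroupoid.ofCc ''
          {f : ArrowGroupoid.CcAlg G | f.fn ∈ Cc {g : G | ArrowGroupoid.r g ∉ X}}) ∧
      closure (ArrowGroupoid.ofCc ''
          {f : ArrowGroupoid.CcAlg G | f.fn ∈ Cc {g : G | ArrowGroupoid.r g ∉ X}}) =
        (closedIdealSpan (ArrowGroupoid.ofCZeroUnits ''
            {φ : C₀(ArrowGroupoid.UnitSpace G, ℂ) | ∀ x ∈ X, φ x = 0}) :
          Set (ArrowGroupoid.FullCStar G)) ∧
      Function.Injective (ArrowGroupoid.extendHom hX.compl hc.isOpen_compl) ∧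
      Set.range (ArrowGroupoid.extendHom hX.compl hc.isOpen_compl) =
        {a : ArrowGroupoid.FullCStar G | ArrowGroupoid.restrictHom hX hc a = 0} ∧
      Function.Surjective (ArrowGroupoid.restrictHom hX hc) := by
  have hker : {a : ArrowGroupoid.FullCStar G | ArrowGroupoid.restrictHom hX hc a = 0} =
      (ArrowGroupoid.idealOver Xᶜ : Set (ArrowGroupoid.FullCStar G)) :=
    Set.ext fun _ => ArrowGroupoid.restrictHom_eq_zero_iff hX hc
  have hspan := ArrowGroupoid.idealOver_eq_closedIdealSpan hc.isOpen_compl hX.compl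
  simp only [Set.mem_compl_iff, not_not] at hspan
  exact ⟨hker, congrArg SetLike.coe hspan,
    ArrowGroupoid.extendHom_injective hX.compl hc.isOpen_compl,
    (ArrowGroupoid.range_extendHom hX.compl hc.isOpen_compl).trans hker.symm,
    ArrowGroupoid.restrictHom_surjective hX hc⟩
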